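/- **Setting.** All spaces carry their Euclidean norm. *Determinantal varieties.* Let $1\le r<p\le q$ and let $C(p,q,r)$ be the set of real $p\times q$ matrices of rank at most $r$, in $V=M(p,q;\mathbb R)\cong\mathbb R^{pq}$. Put $e_i=X_{ii}$ ($1\le i\le r$), where $X_{ij}$ are the matrix units, let $K$ be the span of the $X_{ij}$ with $i>r$, $j>r$, and let $G=SO(p)\times SO(q)$ act by $X\mapsto PXQ^T$. *Pfaffian varieties.* Let $r\ge1$, $2r<m$ and let $\mathbf C(m,2r)$ be the set of real skew-symmetric $m\times m$ matrices of rank at most $2r$, in $V=\mathrm{Skew}(m,\mathbb R)\cong\mathbb R^{m(m-1)/2}$, where the matrices $Y_{ij}$ ($i<j$) with entry $1$ at $(i,j)$, $-1$ at $(j,i)$ and $0$ elsewhere form an orthonormal basis. Put $e_i=Y_{2i-1,2i}$ ($1\le i\le r$), let $K$ be the span of the $Y_{ij}$ with $2r<i<j$, and let $G=SO(m)$ act by $X\mapsto QXQ^T$. *Slicings.* In both cases write $M(x)=\sum_{i=1}^r x_ie_i$ and $$H=\{M(x)+N:\ x_1>\dots>x_r>0,\ N\in K,\ |N|<x_r\}.$$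 The primary slicing sets are the images $\varphi(H)$, $\varphi\in G$. They are the level sets of the map $\pi:\varphi(X)\mapsto\varphi(M(a))$ ($X\in H$, $\varphi\in G$), where $a_1>\dots>a_r>0$ is a fixed reference tuple. The primary weighting function is $w_1=1/J\pi$, where $J\pi$ is the Jacobian of $\pi$ of dimension $\dim V-\dim H$ (another choice of $a$ multiplies $w_1$ by a positive constant). The secondary slicing sets are the level sets $$H_c=\{X\in H:\ h(X)=(c_1^2/2,\dots,c_r^2/2)\},\qquad c_1>\dots>c_r>0,$$ of $h:H\to\mathbb R^r$, $h_i(M(x)+N)=\tfrac12(x_i^2-|N|^2)$, and $w_2=1/J_rh$ is the secondary weighting function. Here $J_kF=\max|DF(v_1)\wedge\dots\wedge DF(v_k)|$ over orthonormal $v_1,\dots,v_k$ tangent to the domain of $F$. For $g:(0,\infty)\to[0,\infty)$ let $f(X)=g(|X|)$. We say that $fw_1w_2$ *is minimal at the cone* $C$ if, for every $c_1>\dots>c_r>0$, the set $H_c\cap C$ is nonempty and the restriction of $fw_1w_2$ to $H_c$ attains its minimum at every point of $H_c\cap C$. **Proposition 4.1.** Let $g:(0,\infty)\to[0,\infty)$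 and $f(X)=g(|X|)$. (1) If $g$ is non-decreasing, then $fw_1w_2$ is minimal at the cone for every $C(p,q,r)$ with $1\le r<p\le q$, $p+q-2r\ge4$, and for every $\mathbf C(m,2r)$ with $r\ge 1$, $m-2r\ge3$. (2) If $g(s)/s$ is non-decreasing on $(0,\infty)$, then $fw_1w_2$ is minimal at the cone for $C(2,2,1)$, $C(2,3,1)$ and $\mathbf C(4,2)$. The functions $g(s)=s^\alpha$ with $\alpha\ge1$ satisfy this hypothesis. (3) Let $n\ge3$. If $g$ is $C^1$ on $(0,\infty)$ and not identically zero, then $fw_1w_2$ is not minimal at the cone for any of $C(n,n+1,n-1)$, $C(n,n,n-1)$ and $\mathbf C(2n,2n-2)$. -/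

import Mathlib

open Set
open scoped Matrix

noncomputable section

namespace DirectedSlicing

/-! ### Jacobians -/

/-- The `k`-dimensional Jacobian of a linear map `L` between Euclidean spaces: the maximum of
`‖L v₁ ∧ ⋯ ∧ L v_k‖` over orthonormal `k`-frames `v₁, …, v_k` of the source, where the norm of a
simple `k`-vector is the square root of the Gram determinant of its factors. -/
def jacobian {E F : Type*} [NormedAddCommGroup E] [InnerProductSpace ℝ E]
    [NormedAddCommGroup F] [InnerProductSpace ℝ F] (k : ℕ) (L : E →L[ℝ] F) : ℝ :=
  sSup {s : ℝ | ∃ v : Fin k → E, Orthonormal ℝ v ∧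
    s = Real.sqrt (Matrix.gram ℝ (fun i => L (v i))).det}

/-- Strictly decreasing tuples of positive numbers, `x₁ > ⋯ > x_r > 0`. -/
def chamber (r : ℕ) : Set (Fin r → ℝ) := {x | StrictAnti x ∧ ∀ i, 0 < x i}

/-! ### The two-step slicing, for both families of matrix cones at once -/

/-- The data which determine the primary and the secondary slicing for a cone in a Euclidean
space `V` : the cone, the rotations acting on `V`, the vectors `e₁, …, e_r` spanning the wedge
`{∑ xᵢ eᵢ : x₁ > ⋯ > x_r > 0}` in the cone, and the normal space `K` of the cone along it.
Only the two instances `determinantal` and `pfaffian` below are ever used. -/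
structure Data (V : Type*) [NormedAddCommGroup V] [InnerProductSpace ℝ V] (r : ℕ) where
  cone : Set V
  rotations : Set (V → V)
  e : Fin r → V
  K : Submodule ℝ V

namespace Data

variable {V : Type*} [NormedAddCommGroup V] [InnerProductSpace ℝ V] [FiniteDimensional ℝ V]
  {r : ℕ} (D : Data V r)

/-- The point `M(x) = ∑ xᵢ eᵢ`. -/
def M (x : Fin r → ℝ) : V := ∑ i, x i • D.e i

/-- The wedge-shaped set `H` of all `M(x) + N`, with `x₁ > ⋯ > x_r > 0`, `N ∈ K` and `|N|`
smaller than the smallest `xᵢ`. -/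
def H : Set V :=
  {X | ∃ x ∈ chamber r, ∃ N ∈ D.K, (∀ i, ‖N‖ < x i) ∧ X = D.M x + N}

open Classical in
/-- The primary slicing sets are the rotated copies `φ(H)` of `H`.  They are the level sets of
the map `φ(X) ↦ φ(M(a))` (for `X ∈ H` and `φ` a rotation), which labels the slicing set `φ(H)` by
the point `φ(M(a))` of the orbit of a fixed reference point `M(a)` of the wedge.  Outside the
union of the primary slicing sets the value is irrelevant. -/
def primaryMap (a : Fin r → ℝ) (Y : V) : V :=
  if h : ∃ φ ∈ D.rotations, ∃ X ∈ D.H, Y = φ X then h.choose (D.M a) else 0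

/-- The number of dimensions of the space of primary slicing sets, i.e. the codimension of `H`. -/
def primaryDim : ℕ :=
  Module.finrank ℝ V - (r + Module.finrank ℝ D.K)

/-- The primary weighting function: the reciprocal of the Jacobian of the primary slicing map.
Another reference point `a` only changes it by a positive constant factor. -/
def w₁ (a : Fin r → ℝ) (X : V) : ℝ :=
  1 / jacobian D.primaryDim (fderiv ℝ (D.primaryMap a) X)

/-- The function `h` whose level sets in `H` are the secondary slicing sets:
`hᵢ(M(x) + N) = (xᵢ² - |N|²) / 2`.  (The `eᵢ` are orthonormal and orthogonal to `K`, so `xᵢ` is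
the inner product with `eᵢ` and `N` is the orthogonal projection to `K`.) -/
def h (X : V) : EuclideanSpace ℝ (Fin r) :=
  WithLp.toLp 2 fun i => (inner ℝ (D.e i) X ^ 2 - ‖D.K.starProjection X‖ ^ 2) / 2

/-- The linear subspace spanned by the `eᵢ` and `K`; `H` is an open subset of it. -/
def span : Submodule ℝ V := Submodule.span ℝ (Set.range D.e) ⊔ D.K

/-- The secondary weighting function: the reciprocal of the Jacobian of `h` on `H`. -/
def w₂ (X : V) : ℝ :=
  1 / jacobian r ((fderiv ℝ D.h X).comp D.span.subtypeL)

/-- The secondary slicing set `H_c`, the level set of `h : H → ℝ^r` at `(c₁²/2, …, c_r²/2)`. -/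
def Hc (c : Fin r → ℝ) : Set V := {X | X ∈ D.H ∧ ∀ i, D.h X i = c i ^ 2 / 2}

/-- The function `f w₁ w₂` for the radial density `f(X) = g(|X|)`. -/
def fw₁w₂ (a : Fin r → ℝ) (g : ℝ → ℝ) (X : V) : ℝ := g ‖X‖ * D.w₁ a X * D.w₂ X

/-- Within every secondary slicing set `H_c`, the function `f w₁ w₂` attains its minimum at the
cone.  (The sets `H_c` with `c` in the chamber are all the nonempty ones.) -/
def MinimalAtCone (a : Fin r → ℝ) (g : ℝ → ℝ) : Prop :=
  ∀ c ∈ chamber r, (D.Hc c ∩ D.cone).Nonempty ∧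
    ∀ X₀ ∈ D.Hc c ∩ D.cone, IsMinOn (D.fw₁w₂ a g) (D.Hc c) X₀

end Data

/-! ### Determinantal varieties -/

/-- `p × q` matrices with the Euclidean (Frobenius) inner product. -/
abbrev MatSpace (p q : ℕ) := EuclideanSpace ℝ (Fin p × Fin q)

/-- A point of `MatSpace p q` as a matrix. -/
def toMat {p q : ℕ} (X : MatSpace p q) : Matrix (Fin p) (Fin q) ℝ := Matrix.of fun i j => X (i, j)

/-- A matrix as a point of `MatSpace p q`. -/
def ofMat {p q : ℕ} (A : Matrix (Fin p) (Fin q) ℝ) : MatSpace p q :=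
  WithLp.toLp 2 fun ij => A ij.1 ij.2

/-- The determinantal variety `C(p,q,r)` of `p × q` matrices of rank at most `r`, with the
rotations `X ↦ P X Qᵀ`, `P ∈ SO(p)`, `Q ∈ SO(q)`, the wedge spanned by the matrix units `X_{ii}`,
`i ≤ r`, and the normal space spanned by the matrix units `X_{ij}` with `i > r` and `j > r`
(indices start from `0` in the code). -/
def determinantal (p q r : ℕ) : Data (MatSpace p q) r where
  cone := {X | (toMat X).rank ≤ r}
  rotations := {φ | ∃ P ∈ Matrix.specialOrthogonalGroup (Fin p) ℝ,
    ∃ Q ∈ Matrix.specialOrthogonalGroup (Fin q) ℝ, φ = fun X => ofMat (P * toMat X * Qᵀ)}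
  e := fun i => ofMat (Matrix.of fun s t => if s.val = i.val ∧ t.val = i.val then 1 else 0)
  K := Submodule.span ℝ
    {X | ∃ (s : Fin p) (t : Fin q), r ≤ s.val ∧ r ≤ t.val ∧ X = EuclideanSpace.single (s, t) 1}

/-! ### Pfaffian varieties -/

/-- Skew-symmetric `m × m` matrices, identified with `ℝ^{m(m-1)/2}` through the entries above the
diagonal; thus the matrices `Y_{ij}`, `i < j`, form an orthonormal basis. -/
abbrev SkewSpace (m : ℕ) := EuclideanSpace ℝ {ij : Fin m × Fin m // ij.1 < ij.2}

/-- A point of `SkewSpace m` as a skew-symmetric matrix. -/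
def toSkew {m : ℕ} (X : SkewSpace m) : Matrix (Fin m) (Fin m) ℝ := Matrix.of fun i j =>
  if hij : i < j then X ⟨(i, j), hij⟩ else if hji : j < i then -X ⟨(j, i), hji⟩ else 0

/-- A skew-symmetric matrix as a point of `SkewSpace m`. -/
def ofSkew {m : ℕ} (A : Matrix (Fin m) (Fin m) ℝ) : SkewSpace m :=
  WithLp.toLp 2 fun ij => A ij.1.1 ij.1.2

/-- The Pfaffian variety `C(m,2r)` of skew-symmetric `m × m` matrices of rank at most `2r`, with
the rotations `X ↦ Q X Qᵀ`, `Q ∈ SO(m)`, the wedge spanned by `Y_{2i-1,2i}`, `i ≤ r`, and the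
normal space spanned by the `Y_{ij}` with `2r < i < j` (indices start from `0` in the code). -/
def pfaffian (m r : ℕ) : Data (SkewSpace m) r where
  cone := {X | (toSkew X).rank ≤ 2 * r}
  rotations := {φ | ∃ Q ∈ Matrix.specialOrthogonalGroup (Fin m) ℝ,
    φ = fun X => ofSkew (Q * toSkew X * Qᵀ)}
  e := fun i => WithLp.toLp 2 fun st =>
    if st.1.1.val = 2 * i.val ∧ st.1.2.val = 2 * i.val + 1 then 1 else 0
  K := Submodule.span ℝ
    {X | ∃ st : {ij : Fin m × Fin m // ij.1 < ij.2}, 2 * r ≤ st.1.1.val ∧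
      X = EuclideanSpace.single st 1}

end DirectedSlicing

end

noncomputable section

namespace DirectedSlicing

open Module Filter Topology

set_option linter.unusedSectionVars false

/-! ### Jacobians as volume distortions and Gram determinants. -/

section Jacobians

variable {E F : Type*} [NormedAddCommGroup E] [InnerProductSpace ℝ E] [FiniteDimensional ℝ E]
  [NormedAddCommGroup F] [InnerProductSpace ℝ F]

/-! Both weights can be computed along the wedge. The gradients of the components of `h` along `H`
are xᵢeᵢ − N, with Gram matrix diag(xᵢ²) plus the constant |N|², so 1/w₂ = ∏ xᵢ · √(1 + |N|² ∑
1/xᵢ²) (`Data.IsOrtho.w₂_eq`). For w₁, exponentials of skew-symmetric matrices give local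
coordinates (ξ, Y) ↦ Φ ξ Y, with Y in the span of `H`, and in them π is Φ ξ Y ↦ Φ ξ (M(a)). The
infinitesimal action takes values in the orthogonal complement of the span, with matrix B(X), and w₁
= |det B(X)| / |det B(M(a))| (`Data.Chart.w₁_eq`). That π is well defined is a statement on singular
values: those in the wedge directions exceed those of N, so they and their singular spaces are
determined by the matrix (`IsWedge.orbit_map_eq`).

The matrix B is block diagonal. A Schur complement turns its i-th block into xᵢ^k det(xᵢ² − YᵢYᵢᵀ),
where Yᵢ is the part of X with labels beyond i and k is the excess of columns over rows. This splits
further into differences xᵢ² − xⱼ² and the factor det(xᵢ² − NNᵀ), with N read as its corner matrix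
(`Model.det_chart_B`). On `Hc c` one has xᵢ² = cᵢ² + |N|²: the differences are constant, and only
the powers of xᵢ and the last factor vary. As the eigenvalues of NNᵀ sum to |N|², that factor is at
least xᵢ^(2(p−r)−2) cᵢ². In the skew case the nonzero eigenvalues come in pairs and the bound is
xᵢ^(2(m−2r)−4) cᵢ⁴. Hence w₁ ≥ κ ∏ xᵢ^e with equality at the cone, where e = p+q−2r−2 or e =
2(m−2r)−4 (`determinantal_weightGE`, `pfaffian_weightGE`). If N has one row, or is skew of size two,
equality holds everywhere.

What remains is to compare g(|X|) ∏ xᵢ^(e−1) / √(1 + |N|² ∑ 1/xᵢ²) with its value at N = 0. For e ≥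
2 a spare factor ∏ xᵢ absorbs the root (`Data.minimalAtCone_of_monotoneOn`). For r = 1 the root
times x is |X|, which is why g(s)/s enters (`Data.minimalAtCone_of_monotoneOn_div`). For e ≤ 1 and r
≥ 2, letting |N| and the smallest cᵢ tend to 0 together with |M(c)| fixed keeps the root away from 1
while |X| → |M(c)|, so continuity of g excludes minimality (`Data.not_minimalAtCone`). -/

lemma normDet_le_one_of_norm_le {f : E →ₗ[ℝ] F} [FiniteDimensional ℝ F]
    (h : finrank ℝ E = finrank ℝ F) (hf : ∀ v, ‖f v‖ ≤ ‖v‖) : f.normDet ≤ 1 := by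
  let bE : OrthonormalBasis (Fin (finrank ℝ F)) ℝ E := (stdOrthonormalBasis ℝ E).reindex (finCongr h)
  let bF := stdOrthonormalBasis ℝ F
  have : Fact (finrank ℝ F = finrank ℝ F) := ⟨rfl⟩
  have h1 : f.normDet = |bF.toBasis.det (fun i => f (bE i))| := by
    rw [LinearMap.normDet_eq_norm_det_toMatrix f bE bF, Basis.det_apply, Real.norm_eq_abs]
    congr 2
    ext i j
    simp [LinearMap.toMatrix_apply, Basis.toMatrix_apply]
  rw [h1, ← bF.toBasis.orientation.volumeForm_robust' bF]
  -- Hadamard's inequality, applied to the images of an orthonormal basis, which have length at most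
  -- one.
  refine (Orientation.abs_volumeForm_apply_le _ _).trans ?_
  refine Finset.prod_le_one (fun _ _ => norm_nonneg _) fun i _ => (hf _).trans ?_
  rw [bE.orthonormal.1 i]

lemma sqrt_det_gram_eq_normDet {ι : Type*} [Fintype ι] [DecidableEq ι] (f : E →ₗ[ℝ] F)
    (b : OrthonormalBasis ι ℝ E) :
    Real.sqrt (Matrix.gram ℝ (fun i => f (b i))).det = f.normDet := by
  have := f.normDet_sq_eq_det_gram b
  rw [← this]
  exact Real.sqrt_sq f.normDet_nonneg

/-- The Jacobian of a map vanishing on the orthogonal complement of a `k`-dimensional subspace is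
the volume distortion on that subspace. -/
lemma jacobian_eq_normDet {k : ℕ} {W : Submodule ℝ E} (hk : finrank ℝ W = k) (L : E →L[ℝ] F)
    (hL : ∀ v ∈ Wᗮ, L v = 0) :
    jacobian k L = ((L : E →ₗ[ℝ] F) ∘ₗ W.subtype).normDet := by
  have hfact : ∀ v, L v = L (W.orthogonalProjectionOnto v) := by
    intro v
    have := hL _ (W.sub_starProjection_mem_orthogonal v)
    rw [map_sub, sub_eq_zero] at this
    rw [this]; rfl
  refine IsGreatest.csSup_eq ⟨?_, ?_⟩
  · let b : OrthonormalBasis (Fin k) ℝ W := (stdOrthonormalBasis ℝ W).reindex (finCongr hk)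
    refine ⟨fun i => (b i : E), ?_, ?_⟩
    · exact b.orthonormal.comp_linearIsometry W.subtypeₗᵢ
    · rw [← sqrt_det_gram_eq_normDet _ b]; rfl
  · rintro s ⟨v, hv, rfl⟩
    let S : Submodule ℝ E := Submodule.span ℝ (Set.range v)
    have hbS : ∀ i, (Basis.span hv.linearIndependent i : E) = v i := fun i =>
      congrArg Subtype.val (Basis.span_apply hv.linearIndependent i)
    let b : OrthonormalBasis (Fin k) ℝ S := (Basis.span hv.linearIndependent).toOrthonormalBasis
      (by
        rw [← S.subtypeₗᵢ.orthonormal_comp_iff]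
        convert hv
        ext i
        exact hbS i)
    have hb : ∀ i, (b i : E) = v i := fun i => by
      rw [Basis.coe_toOrthonormalBasis]; exact hbS i
    have hS : finrank ℝ S = finrank ℝ W := by
      rw [hk, finrank_eq_card_basis b.toBasis, Fintype.card_fin]
    have e1 : (fun i => L (v i)) = fun i => ((L : E →ₗ[ℝ] F) ∘ₗ S.subtype) (b i) := by
      ext i; simp [hb]
    rw [e1, sqrt_det_gram_eq_normDet]
    -- On the span `S` of a competing frame, `L` factors through the orthogonal projection `S → W`.
    -- This is a contraction between spaces of equal dimension, so it does not increase volume.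
    have e2 : (L : E →ₗ[ℝ] F) ∘ₗ S.subtype = ((L : E →ₗ[ℝ] F) ∘ₗ W.subtype) ∘ₗ
        ((W.orthogonalProjectionOnto : E →ₗ[ℝ] W) ∘ₗ S.subtype) := by
      ext x; exact hfact x
    rw [e2, LinearMap.normDet_comp_of_finrank_eq _ _ hS]
    refine mul_le_of_le_one_right (LinearMap.normDet_nonneg _) (normDet_le_one_of_norm_le hS ?_)
    intro x
    exact W.norm_starProjection_apply_le (x : E)

/-- The Jacobian of a map of the form `v ↦ (⟪n i, v⟫)ᵢ`. -/
lemma jacobian_eq_sqrt_det_gram {k : ℕ} {n : Fin k → E} (hn : LinearIndependent ℝ n)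
    (L : E →L[ℝ] EuclideanSpace ℝ (Fin k)) (hL : ∀ v i, L v i = inner ℝ (n i) v) :
    jacobian k L = Real.sqrt (Matrix.gram ℝ n).det := by
  let W : Submodule ℝ E := Submodule.span ℝ (Set.range n)
  have hk : finrank ℝ W = k := by rw [finrank_span_eq_card hn, Fintype.card_fin]
  have hnW : ∀ i, n i ∈ W := fun i => Submodule.subset_span ⟨i, rfl⟩
  rw [jacobian_eq_normDet hk L]
  swap
  · intro v hv
    ext i
    rw [hL]
    exact (Submodule.mem_orthogonal _ _).1 hv _ (hnW i)
  let b : OrthonormalBasis (Fin k) ℝ W := (stdOrthonormalBasis ℝ W).reindex (finCongr hk)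
  rw [← sqrt_det_gram_eq_normDet _ b]
  -- `C` holds the coordinates of the `n i` in an orthonormal basis of their span. The two Gram
  -- matrices are `Cᵀ * C` and `C * Cᵀ`, so their determinants agree.
  let C : Matrix (Fin k) (Fin k) ℝ := Matrix.of fun i l => inner ℝ (n i) (b l : E)
  have h1 : Matrix.gram ℝ (fun i => ((L : E →ₗ[ℝ] EuclideanSpace ℝ (Fin k)) ∘ₗ W.subtype) (b i))
      = Cᵀ * C := by
    ext i j
    simp [Matrix.mul_apply, C, PiLp.inner_apply, hL, mul_comm]
  have h2 : Matrix.gram ℝ n = C * Cᵀ := by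
    ext i j
    simp only [Matrix.gram_apply, Matrix.mul_apply, C, Matrix.of_apply, Matrix.transpose_apply]
    have := b.sum_inner_mul_inner ⟨n i, hnW i⟩ ⟨n j, hnW j⟩
    simp only [Submodule.coe_inner] at this
    rw [← this]
    exact Finset.sum_congr rfl fun l _ => by rw [real_inner_comm (n j)]
  rw [h1, h2, Matrix.det_mul, Matrix.det_mul, mul_comm]

end Jacobians

/-- Matrix determinant lemma: after factoring out the diagonal, the constant matrix is a rank one
perturbation of the identity. This is the Gram determinant behind the secondary weight. -/
lemma det_diagonal_add_const {r : ℕ} {x : Fin r → ℝ} (hx : ∀ i, 0 < x i) (t : ℝ) :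
    (Matrix.of fun i j : Fin r => (if i = j then x i ^ 2 else 0) + t).det
      = (∏ i, x i) ^ 2 * (1 + t * ∑ i, 1 / x i ^ 2) := by
  have h : (Matrix.of fun i j : Fin r => (if i = j then x i ^ 2 else 0) + t)
      = Matrix.diagonal (fun i => x i ^ 2) *
        (1 + Matrix.replicateCol Unit (fun i => t / x i ^ 2) *
          Matrix.replicateRow Unit (fun _ => (1 : ℝ))) := by
    ext i j
    have := (hx i).ne'
    rw [Matrix.diagonal_mul]
    simp only [Matrix.of_apply, Matrix.add_apply, Matrix.mul_apply, Matrix.replicateCol_apply,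
      Matrix.replicateRow_apply, Finset.univ_unique, Finset.sum_singleton, Matrix.one_apply]
    split_ifs <;> field_simp
    ring
  rw [h, Matrix.det_mul, Matrix.det_diagonal, Matrix.det_one_add_replicateCol_mul_replicateRow,
    Finset.prod_pow, dotProduct, Finset.mul_sum]
  simp [div_eq_mul_inv]

/-! ### Geometry of the wedge and the secondary weight. -/

namespace Data

variable {V : Type*} [NormedAddCommGroup V] [InnerProductSpace ℝ V] [FiniteDimensional ℝ V]
  {r : ℕ}

/-- The vectors `eᵢ` are orthonormal and orthogonal to `K`. -/
structure IsOrtho (D : Data V r) : Prop where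
  orthonormal : Orthonormal ℝ D.e
  inner_eq_zero : ∀ i, ∀ N ∈ D.K, inner ℝ (D.e i) N = 0

variable {D : Data V r}

lemma M_mem_span (x : Fin r → ℝ) : D.M x ∈ D.span :=
  Submodule.mem_sup_left <| Submodule.sum_mem _ fun i _ =>
    Submodule.smul_mem _ _ (Submodule.subset_span ⟨i, rfl⟩)

lemma e_mem_span (i : Fin r) : D.e i ∈ D.span :=
  Submodule.mem_sup_left (Submodule.subset_span ⟨i, rfl⟩)

lemma K_le_span : D.K ≤ D.span := le_sup_right

lemma add_mem_span (x : Fin r → ℝ) {N : V} (hN : N ∈ D.K) : D.M x + N ∈ D.span :=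
  Submodule.add_mem _ (M_mem_span x) (K_le_span hN)

lemma exists_eq_of_mem_span {Y : V} (hY : Y ∈ D.span) : ∃ x, ∃ N ∈ D.K, Y = D.M x + N := by
  obtain ⟨u, hu, N, hN, rfl⟩ := Submodule.mem_sup.1 hY
  obtain ⟨x, rfl⟩ := (Submodule.mem_span_range_iff_exists_fun ℝ).1 hu
  exact ⟨x, N, hN, rfl⟩

lemma H_subset_span : D.H ⊆ D.span := by
  rintro _ ⟨x, -, N, hN, -, rfl⟩
  exact add_mem_span x hN

namespace IsOrtho

variable (hD : D.IsOrtho)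
include hD

lemma inner_e_M (i : Fin r) (x : Fin r → ℝ) : inner ℝ (D.e i) (D.M x) = x i :=
  hD.orthonormal.inner_right_fintype x i

lemma inner_e_add (i : Fin r) (x : Fin r → ℝ) {N : V} (hN : N ∈ D.K) :
    inner ℝ (D.e i) (D.M x + N) = x i := by
  rw [inner_add_right, hD.inner_e_M, hD.inner_eq_zero i N hN, add_zero]

lemma inner_M_K (x : Fin r → ℝ) {N : V} (hN : N ∈ D.K) : inner ℝ (D.M x) N = 0 := by
  simp [M, sum_inner, inner_smul_left, hD.inner_eq_zero _ N hN]

lemma starProjection_add (x : Fin r → ℝ) {N : V} (hN : N ∈ D.K) :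
    D.K.starProjection (D.M x + N) = N := by
  refine (Submodule.eq_starProjection_of_mem_of_inner_eq_zero hN fun w hw => ?_)
  rw [add_sub_cancel_right, hD.inner_M_K x hw]

lemma norm_M_sq (x : Fin r → ℝ) : ‖D.M x‖ ^ 2 = ∑ i, x i ^ 2 := by
  rw [← real_inner_self_eq_norm_sq, M, hD.orthonormal.inner_sum]
  simp [sq]

lemma norm_add_sq (x : Fin r → ℝ) {N : V} (hN : N ∈ D.K) :
    ‖D.M x + N‖ ^ 2 = ∑ i, x i ^ 2 + ‖N‖ ^ 2 := by
  rw [norm_add_sq_real, hD.inner_M_K x hN, hD.norm_M_sq]; ring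

lemma h_add (i : Fin r) (x : Fin r → ℝ) {N : V} (hN : N ∈ D.K) :
    D.h (D.M x + N) i = (x i ^ 2 - ‖N‖ ^ 2) / 2 := by
  simp [h, hD.inner_e_add i x hN, hD.starProjection_add x hN]

lemma mem_Hc {c : Fin r → ℝ} {X : V} (hX : X ∈ D.Hc c) : ∃ x ∈ chamber r, ∃ N ∈ D.K,
    (∀ i, ‖N‖ < x i) ∧ X = D.M x + N ∧ ∀ i, x i ^ 2 = c i ^ 2 + ‖N‖ ^ 2 := by
  obtain ⟨⟨x, hx, N, hN, hlt, rfl⟩, hc⟩ := hX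
  refine ⟨x, hx, N, hN, hlt, rfl, fun i => ?_⟩
  have := hc i
  rw [hD.h_add i x hN] at this
  linarith

lemma add_mem_Hc {c x : Fin r → ℝ} (hc : c ∈ chamber r) (hx : x ∈ chamber r) {N : V}
    (hN : N ∈ D.K) (hxc : ∀ i, x i ^ 2 = c i ^ 2 + ‖N‖ ^ 2) : D.M x + N ∈ D.Hc c := by
  refine ⟨⟨x, hx, N, hN, fun i => ?_, rfl⟩, fun i => ?_⟩
  · refine lt_of_pow_lt_pow_left₀ 2 (hx.2 i).le ?_
    rw [hxc]
    have := pow_pos (hc.2 i) 2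
    linarith
  · rw [hD.h_add i x hN, hxc]; ring

lemma finrank_span : finrank ℝ D.span = r + finrank ℝ D.K := by
  have h1 : Disjoint (Submodule.span ℝ (Set.range D.e)) D.K := by
    rw [Submodule.disjoint_def]
    intro v hv hK
    obtain ⟨x, rfl⟩ := (Submodule.mem_span_range_iff_exists_fun ℝ).1 hv
    have := hD.inner_M_K x hK
    exact inner_self_eq_zero.1 this
  have h2 := Submodule.finrank_sup_add_finrank_inf_eq (Submodule.span ℝ (Set.range D.e)) D.K
  rw [h1.eq_bot, finrank_bot, add_zero,
    finrank_span_eq_card hD.orthonormal.linearIndependent, Fintype.card_fin] at h2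
  exact h2

lemma finrank_span_orthogonal : finrank ℝ D.spanᗮ = D.primaryDim := by
  have := Submodule.finrank_add_finrank_orthogonal D.span
  rw [hD.finrank_span] at this
  rw [primaryDim]
  omega

lemma hasFDerivAt_h (X : V) : ∃ L : V →L[ℝ] EuclideanSpace ℝ (Fin r), HasFDerivAt D.h L X ∧
    ∀ Y i, L Y i = inner ℝ (D.e i) X * inner ℝ (D.e i) Y
      - inner ℝ (D.K.starProjection X) (D.K.starProjection Y) := by
  have hi : ∀ i, HasFDerivAt (fun X => D.h X i)
      ((1 / 2 : ℝ) • ((2 * inner ℝ (D.e i) X) • innerSL ℝ (D.e i)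
        - 2 • (innerSL ℝ (D.K.starProjection X)).comp D.K.starProjection)) X := by
    intro i
    have h1 : HasFDerivAt (fun X => inner ℝ (D.e i) X) (innerSL ℝ (D.e i)) X :=
      (innerSL ℝ (D.e i)).hasFDerivAt
    have h2 : HasFDerivAt (fun X => ‖D.K.starProjection X‖ ^ 2) _ X :=
      D.K.starProjection.hasFDerivAt.norm_sq
    have h3 := ((h1.pow 2).sub h2).const_smul (1 / 2 : ℝ)
    refine (h3.congr_of_eventuallyEq (.of_forall fun Y => ?_)).congr_fderiv ?_
    · simp [h]; ring
    · ext Y; simp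
  let L : V →L[ℝ] EuclideanSpace ℝ (Fin r) :=
    (EuclideanSpace.equiv (Fin r) ℝ).symm.toContinuousLinearMap.comp
      (ContinuousLinearMap.pi fun i =>
        ((1 / 2 : ℝ) • ((2 * inner ℝ (D.e i) X) • innerSL ℝ (D.e i)
        - 2 • (innerSL ℝ (D.K.starProjection X)).comp D.K.starProjection)))
  refine ⟨L, ?_, fun Y i => ?_⟩
  · rw [← hasFDerivWithinAt_univ, hasFDerivWithinAt_euclidean]
    exact fun i => (hi i).hasFDerivWithinAt
  · simp [L]; ring

/-- The secondary weighting function on the wedge `H`. -/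
lemma w₂_eq {x : Fin r → ℝ} (hx : x ∈ chamber r) {N : V} (hN : N ∈ D.K) :
    D.w₂ (D.M x + N)
      = 1 / ((∏ i, x i) * Real.sqrt (1 + ‖N‖ ^ 2 * ∑ i, 1 / x i ^ 2)) := by
  obtain ⟨L, hL, hLY⟩ := hD.hasFDerivAt_h (D.M x + N)
  -- The gradients of the components of `h` along the span of `H`. Their orthogonal wedge parts give
  -- the diagonal of the Gram matrix, their common part `-N` the constant.
  let n : Fin r → D.span := fun i => ⟨x i • D.e i - N,
    Submodule.sub_mem _ (Submodule.smul_mem _ _ (e_mem_span i)) (K_le_span hN)⟩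
  have hgram : Matrix.gram ℝ n
      = Matrix.of fun i j : Fin r => (if i = j then x i ^ 2 else 0) + ‖N‖ ^ 2 := by
    ext i j
    have := orthonormal_iff_ite.1 hD.orthonormal i j
    simp only [Matrix.gram_apply, Submodule.coe_inner, n, inner_sub_left, inner_sub_right,
      inner_smul_left, inner_smul_right, this, hD.inner_eq_zero _ N hN, Matrix.of_apply,
      real_inner_self_eq_norm_sq, real_inner_comm (D.e _) N]
    split_ifs with hij
    · subst hij; simp; ring
    · simp
  have hdet := det_diagonal_add_const hx.2 (‖N‖ ^ 2)
  rw [← hgram] at hdet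
  have hprod : 0 < ∏ i, x i := Finset.prod_pos fun i _ => hx.2 i
  have hpos : 0 < (Matrix.gram ℝ n).det := by
    rw [hdet]
    have : 0 ≤ ∑ i, 1 / x i ^ 2 := Finset.sum_nonneg fun i _ => by positivity
    positivity
  have hJ := jacobian_eq_sqrt_det_gram (Matrix.linearIndependent_of_det_gram_ne_zero hpos.ne')
    (L.comp D.span.subtypeL) (by
      intro v i
      have hNv : inner ℝ N (D.K.starProjection (v : V)) = inner ℝ N (v : V) := by
        have := D.K.starProjection_inner_eq_zero (v : V) N hN
        rw [inner_sub_left, sub_eq_zero] at this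
        rw [real_inner_comm, ← this, real_inner_comm]
      simp [hLY, n, hD.inner_e_add i x hN, hD.starProjection_add x hN, inner_sub_left,
        inner_smul_left, hNv])
  rw [w₂, hL.fderiv, hJ, hdet, Real.sqrt_mul (by positivity), Real.sqrt_sq hprod.le]

end IsOrtho

end Data

/-! ### The primary weight through a chart of rotations. -/

namespace Data

variable {V : Type*} [NormedAddCommGroup V] [InnerProductSpace ℝ V] [FiniteDimensional ℝ V]
  {r : ℕ} {D : Data V r}

/-- The wedge is cut out of its span by strict inequalities between continuous functions; positivity
of the coordinates is implied by the norm bound. Openness keeps the wedge component of nearby points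
inside `H`, where the primary map is known. -/
lemma IsOrtho.H_mem_nhds (hD : D.IsOrtho) {X : D.span} (hX : (X : V) ∈ D.H) :
    {Y : D.span | (Y : V) ∈ D.H} ∈ 𝓝 X := by
  obtain ⟨x, hx, N, hN, hlt, hXeq⟩ := hX
  have hc : ∀ i, Continuous fun Y : D.span => inner ℝ (D.e i) (Y : V) := fun i => by fun_prop
  have hcN : Continuous fun Y : D.span => ‖D.K.starProjection (Y : V)‖ := by fun_prop
  have hXi : ∀ i, inner ℝ (D.e i) (X : V) = x i := fun i => by rw [hXeq, hD.inner_e_add i x hN]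
  have hXN : ‖D.K.starProjection (X : V)‖ = ‖N‖ := by rw [hXeq, hD.starProjection_add x hN]
  have h1 : ∀ᶠ Y : D.span in 𝓝 X, ∀ i j, i < j →
      inner ℝ (D.e j) (Y : V) < inner ℝ (D.e i) (Y : V) := by
    refine eventually_all.2 fun i => eventually_all.2 fun j => eventually_imp_distrib_left.2
      fun hij => (hc j).continuousAt.eventually_lt (hc i).continuousAt ?_
    rw [hXi, hXi]
    exact hx.1 hij
  have h2 : ∀ᶠ Y : D.span in 𝓝 X, ∀ i, ‖D.K.starProjection (Y : V)‖ < inner ℝ (D.e i) (Y : V) := by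
    refine eventually_all.2 fun i => hcN.continuousAt.eventually_lt (hc i).continuousAt ?_
    rw [hXi, hXN]
    exact hlt i
  filter_upwards [h1, h2] with Y hY1 hY2
  obtain ⟨y, N', hN', hY⟩ := exists_eq_of_mem_span Y.2
  simp only [hY, hD.inner_e_add _ y hN', hD.starProjection_add y hN'] at hY1 hY2
  exact ⟨y, ⟨fun i j hij => hY1 i j hij, fun i => (norm_nonneg _).trans_lt (hY2 i)⟩, N', hN',
    hY2, hY⟩

/-- A family of rotations parametrized by a vector space `J → ℝ` of the dimension of the primary
slicing, together with its infinitesimal action `ρ` : along the span of `H` this takes values in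
the orthogonal complement of the span, and is represented there, in the coordinates `σ`, by the
matrices `B`. -/
structure Chart (D : Data V r) (J : Type*) [Fintype J] [DecidableEq J] where
  Φ : (J → ℝ) → V → V
  ρ : V → (J → ℝ) →L[ℝ] V
  σ : (J → ℝ) →ₗ[ℝ] V
  B : V → Matrix J J ℝ
  Φ_mem : ∀ ξ, Φ ξ ∈ D.rotations
  Φ_zero : ∀ X, Φ 0 X = X
  hasStrictFDerivAt : ∀ X, HasStrictFDerivAt (fun z : (J → ℝ) × V => Φ z.1 z.2)
    ((ρ X).comp (ContinuousLinearMap.fst ℝ _ _) + ContinuousLinearMap.snd ℝ _ _) (0, X)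
  σ_injective : Function.Injective σ
  range_σ : LinearMap.range σ = D.spanᗮ
  ρ_eq : ∀ X ∈ D.span, ∀ ξ, ρ X ξ = σ (B X *ᵥ ξ)

/-- The primary slicing map does not depend on the choices made in its definition. -/
def WellDefined (D : Data V r) : Prop :=
  ∀ a, ∀ φ ∈ D.rotations, ∀ ψ ∈ D.rotations, ∀ X ∈ D.H, ∀ Y ∈ D.H, φ X = ψ Y → φ (D.M a) = ψ (D.M a)

/-- The rotation picked by `choose` may come from another presentation of the same point;
well-definedness makes the choice immaterial. -/
lemma WellDefined.primaryMap_eq (hW : D.WellDefined) (a : Fin r → ℝ) {φ : V → V}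
    (hφ : φ ∈ D.rotations) {X : V} (hX : X ∈ D.H) : D.primaryMap a (φ X) = φ (D.M a) := by
  have h : ∃ ψ ∈ D.rotations, ∃ Y ∈ D.H, φ X = ψ Y := ⟨φ, hφ, X, hX, rfl⟩
  rw [primaryMap, dif_pos h]
  obtain ⟨hψ, Y, hY, he⟩ := h.choose_spec
  exact (hW a _ hφ _ hψ X hX Y hY he).symm

namespace Chart

variable {J : Type*} [Fintype J] [DecidableEq J] (T : D.Chart J)

lemma σ_mem (ξ : J → ℝ) : T.σ ξ ∈ D.spanᗮ := T.range_σ ▸ LinearMap.mem_range_self _ _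

/-- `σ` as an isomorphism onto the orthogonal complement of the span of `H`. -/
def σEquiv : (J → ℝ) ≃ₗ[ℝ] D.spanᗮ :=
  (LinearEquiv.ofInjective T.σ T.σ_injective).trans (LinearEquiv.ofEq _ _ T.range_σ)

lemma coe_σEquiv (ξ : J → ℝ) : (T.σEquiv ξ : V) = T.σ ξ := rfl

/-- The derivative of `(ξ, Y) ↦ Φ ξ Y` on `(J → ℝ) × span H`. -/
def tangentMap (X : V) : ((J → ℝ) × D.span) →ₗ[ℝ] V :=
  ((T.ρ X : (J → ℝ) →ₗ[ℝ] V)).coprod D.span.subtype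

/-- The rotational directions are orthogonal to the span of `H` and `σ` parametrizes the whole
complement, so the only condition for the inverse function theorem is that `B X` be invertible. -/
lemma tangentMap_bijective {X : V} (hX : X ∈ D.span) (hB : (T.B X).det ≠ 0) :
    Function.Bijective (T.tangentMap X) := by
  constructor
  · rw [← LinearMap.ker_eq_bot, LinearMap.ker_eq_bot']
    rintro ⟨ξ, Y⟩ h
    have h' : T.σ (T.B X *ᵥ ξ) + (Y : V) = 0 := by
      rw [← T.ρ_eq X hX]; exact h
    have hY : (Y : V) = 0 := by
      have h0 := (Submodule.mem_orthogonal _ _).1 (T.σ_mem (T.B X *ᵥ ξ)) Y Y.2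
      rw [eq_neg_of_add_eq_zero_left h', inner_neg_right, neg_eq_zero] at h0
      exact inner_self_eq_zero.1 h0
    rw [hY, add_zero] at h'
    have h2 := T.σ_injective (h'.trans (map_zero T.σ).symm)
    have h3 := Matrix.eq_zero_of_mulVec_eq_zero hB h2
    exact Prod.ext h3 (Subtype.ext hY)
  · intro v
    have hv : v - D.span.starProjection v ∈ D.spanᗮ := D.span.sub_starProjection_mem_orthogonal v
    obtain ⟨η, hη⟩ := T.range_σ ▸ hv
    refine ⟨((T.B X)⁻¹ *ᵥ η, ⟨D.span.starProjection v, D.span.starProjection_apply_mem v⟩), ?_⟩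
    change T.ρ X ((T.B X)⁻¹ *ᵥ η) + D.span.starProjection v = v
    rw [T.ρ_eq X hX, Matrix.mulVec_mulVec, Matrix.mul_nonsing_inv _ hB.isUnit, Matrix.one_mulVec,
      hη, sub_add_cancel]

/-- The primary weighting function on the wedge `H`. -/
theorem w₁_eq (hD : D.IsOrtho) (hW : D.WellDefined) (a : Fin r → ℝ) {X : V} (hX : X ∈ D.H)
    (hB : (T.B X).det ≠ 0) : D.w₁ a X = |(T.B X).det| / |(T.B (D.M a)).det| := by
  have hXs : X ∈ D.span := H_subset_span hX
  let L₀ : ((J → ℝ) × D.span) ≃L[ℝ] V :=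
    (LinearEquiv.ofBijective _ (T.tangentMap_bijective hXs hB)).toContinuousLinearEquiv
  have hL₀ : ∀ ξ (Y : D.span), L₀ (ξ, Y) = T.ρ X ξ + Y := fun ξ Y => rfl
  have hΨ : HasStrictFDerivAt (fun z : (J → ℝ) × D.span => T.Φ z.1 z.2)
      (L₀ : ((J → ℝ) × D.span) →L[ℝ] V) (0, ⟨X, hXs⟩) := by
    have h1 : HasStrictFDerivAt (fun z : (J → ℝ) × D.span => (z.1, (z.2 : V)))
        ((ContinuousLinearMap.fst ℝ (J → ℝ) D.span).prod
          (D.span.subtypeL.comp (ContinuousLinearMap.snd ℝ (J → ℝ) D.span))) (0, ⟨X, hXs⟩) :=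
      ((ContinuousLinearMap.fst ℝ (J → ℝ) D.span).prod
        (D.span.subtypeL.comp (ContinuousLinearMap.snd ℝ (J → ℝ) D.span))).hasStrictFDerivAt
    refine (HasStrictFDerivAt.comp (0, (⟨X, hXs⟩ : D.span)) (T.hasStrictFDerivAt X)
      h1).congr_fderiv ?_
    ext z <;> simp [hL₀]
  have hΨX : T.Φ 0 X = X := T.Φ_zero X
  -- `G` recovers from a nearby point its rotation parameter and its position in the wedge.
  let G := hΨ.localInverse
  have hG : HasStrictFDerivAt G (L₀.symm : V →L[ℝ] (J → ℝ) × D.span) X := by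
    have := hΨ.to_localInverse
    simp only [hΨX] at this
    exact this
  have hGX : G X = (0, ⟨X, hXs⟩) := by
    have := hΨ.localInverse_apply_image
    simp only [hΨX] at this
    exact this
  have hright : ∀ᶠ Z in 𝓝 X, T.Φ (G Z).1 (G Z).2 = Z := by
    have := hΨ.eventually_right_inverse
    simp only [hΨX] at this
    exact this
  have hmem : ∀ᶠ Z in 𝓝 X, ((G Z).2 : V) ∈ D.H := by
    have hc : ContinuousAt (fun Z => (G Z).2) X := hG.continuousAt.snd
    have hn : {Y : D.span | (Y : V) ∈ D.H} ∈ 𝓝 (G X).2 := by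
      rw [hGX]
      exact hD.H_mem_nhds hX
    exact hc.eventually_mem hn
  -- Near `X` the primary map keeps the rotation and replaces the wedge component by the reference
  -- point.
  have hev : D.primaryMap a =ᶠ[𝓝 X] fun Z => T.Φ (G Z).1 (D.M a) := by
    filter_upwards [hright, hmem] with Z h1 h2
    conv_lhs => rw [← h1]
    exact hW.primaryMap_eq a (T.Φ_mem _) h2
  have hfd : HasFDerivAt (fun Z => T.Φ (G Z).1 (D.M a))
      ((T.ρ (D.M a)).comp ((ContinuousLinearMap.fst ℝ _ _).comp
        (L₀.symm : V →L[ℝ] (J → ℝ) × D.span))) X := by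
    have h1 : HasStrictFDerivAt (fun Z => ((G Z).1, D.M a))
        (((ContinuousLinearMap.fst ℝ _ _).comp
        (L₀.symm : V →L[ℝ] (J → ℝ) × D.span)).prod (0 : V →L[ℝ] V)) X :=
      hG.fst.prodMk (hasStrictFDerivAt_const _ _)
    have h2 := T.hasStrictFDerivAt (D.M a)
    have h3 : (fun Z => ((G Z).1, D.M a)) X = (0, D.M a) := by simp [hGX]
    rw [← h3] at h2
    refine HasStrictFDerivAt.hasFDerivAt ((HasStrictFDerivAt.comp X h2 h1).congr_fderiv ?_)
    ext
    simp
  -- The derivative vanishes along the span of `H`, so only its restriction to the orthogonal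
  -- complement contributes.
  rw [w₁, hev.fderiv_eq, hfd.fderiv, jacobian_eq_normDet hD.finrank_span_orthogonal]
  swap
  · intro v hv
    rw [Submodule.orthogonal_orthogonal] at hv
    have : L₀.symm v = (0, ⟨v, hv⟩) := by
      rw [ContinuousLinearEquiv.symm_apply_eq, hL₀]; simp
    simp [this]
  -- A displacement `σ η` at `X` is produced by the parameter `(B X)⁻¹ η`, which displaces `M a` by
  -- `σ (B (M a) (B X)⁻¹ η)`. The derivative thus becomes an endomorphism of the complement, and its
  -- determinant can be read off in the coordinates `σ`.
  let S : D.spanᗮ →ₗ[ℝ] D.spanᗮ :=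
    T.σEquiv.conj (Matrix.toLin' (T.B (D.M a) * (T.B X)⁻¹))
  have hS : (((T.ρ (D.M a)).comp ((ContinuousLinearMap.fst ℝ _ _).comp
        (L₀.symm : V →L[ℝ] (J → ℝ) × D.span)) : V →L[ℝ] V) : V →ₗ[ℝ] V) ∘ₗ D.spanᗮ.subtype
      = D.spanᗮ.subtype ∘ₗ S := by
    ext v
    obtain ⟨η, rfl⟩ := T.σEquiv.surjective v
    have : L₀.symm (T.σEquiv η : V) = ((T.B X)⁻¹ *ᵥ η, 0) := by
      rw [ContinuousLinearEquiv.symm_apply_eq, hL₀, T.ρ_eq X hXs, Matrix.mulVec_mulVec,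
        Matrix.mul_nonsing_inv _ hB.isUnit, Matrix.one_mulVec]
      simp [coe_σEquiv]
    have hl : (D.spanᗮ.subtype (S (T.σEquiv η)) : V)
        = T.σ ((T.B (D.M a) * (T.B X)⁻¹) *ᵥ η) := by
      simp [S, LinearEquiv.conj_apply, coe_σEquiv, -map_mul]
    change T.ρ (D.M a) (L₀.symm (T.σEquiv η : V)).1 = D.spanᗮ.subtype (S (T.σEquiv η))
    rw [this, hl, T.ρ_eq _ (M_mem_span a), Matrix.mulVec_mulVec]
  have hdet : LinearMap.det S
      = LinearMap.det (Matrix.toLin' (T.B (D.M a) * (T.B X)⁻¹)) := by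
    rw [← LinearMap.det_conj _ T.σEquiv]
    rfl
  rw [hS, LinearMap.normDet_comp_of_finrank_eq _ _ rfl, LinearMap.normDet_subtype, one_mul,
    LinearMap.normDet_eq_abs_det, hdet,
    LinearMap.det_toLin', Matrix.det_mul,
    Matrix.det_nonsing_inv, Ring.inverse_eq_inv', abs_mul, abs_inv, one_div, mul_inv, inv_inv,
    mul_comm, div_eq_mul_inv]

end Chart

end Data

lemma one_add_sum_le_prod {ι : Type*} (s : Finset ι) {f : ι → ℝ} (hf : ∀ i, 0 ≤ f i) :
    1 + ∑ i ∈ s, f i ≤ ∏ i ∈ s, (1 + f i) := by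
  classical
  induction s using Finset.induction_on with
  | empty => simp
  | insert i s hi ih =>
    rw [Finset.sum_insert hi, Finset.prod_insert hi]
    have h1 : 0 ≤ ∑ i ∈ s, f i := Finset.sum_nonneg fun i _ => hf i
    nlinarith [hf i, mul_nonneg (hf i) h1, mul_le_mul_of_nonneg_left ih (add_nonneg zero_le_one (hf i))]

/-! ### From estimates of the primary weight to minimality or its failure. -/

namespace Data

variable {V : Type*} [NormedAddCommGroup V] [InnerProductSpace ℝ V] [FiniteDimensional ℝ V]
  {r : ℕ} {D : Data V r}

/-- The cone meets the wedge `H` exactly in the points `M(x)`. -/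
def ConeSpec (D : Data V r) : Prop :=
  ∀ x ∈ chamber r, ∀ N ∈ D.K, D.M x + N ∈ D.cone ↔ N = 0

/-- Along each secondary slicing set the primary weight is, up to a positive constant, at least
`∏ xᵢ ^ e`, with equality at the cone. -/
def WeightGE (D : Data V r) (a : Fin r → ℝ) (e : ℕ) : Prop :=
  ∀ c ∈ chamber r, ∃ κ : ℝ, 0 < κ ∧ D.w₁ a (D.M c) = κ * ∏ i, c i ^ e ∧
    ∀ x ∈ chamber r, ∀ N ∈ D.K, (∀ i, ‖N‖ < x i) → (∀ i, x i ^ 2 = c i ^ 2 + ‖N‖ ^ 2) →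
      κ * ∏ i, x i ^ e ≤ D.w₁ a (D.M x + N)

/-- Along each secondary slicing set the primary weight is, up to a positive constant,
`∏ xᵢ ^ e`. -/
def WeightEq (D : Data V r) (a : Fin r → ℝ) (e : ℕ) : Prop :=
  ∀ c ∈ chamber r, ∃ κ : ℝ, 0 < κ ∧
    ∀ x ∈ chamber r, ∀ N ∈ D.K, (∀ i, ‖N‖ < x i) → (∀ i, x i ^ 2 = c i ^ 2 + ‖N‖ ^ 2) →
      D.w₁ a (D.M x + N) = κ * ∏ i, x i ^ e

lemma IsOrtho.M_mem_Hc (hD : D.IsOrtho) {c : Fin r → ℝ} (hc : c ∈ chamber r) : D.M c ∈ D.Hc c := by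
  simpa using hD.add_mem_Hc hc hc D.K.zero_mem (by simp)

lemma ConeSpec.M_mem (hC : D.ConeSpec) {c : Fin r → ℝ} (hc : c ∈ chamber r) : D.M c ∈ D.cone := by
  simpa using (hC c hc 0 D.K.zero_mem).2 rfl

lemma ConeSpec.eq_M (hC : D.ConeSpec) (hD : D.IsOrtho) {c : Fin r → ℝ} (hc : c ∈ chamber r)
    {X : V} (hX : X ∈ D.Hc c ∩ D.cone) : X = D.M c := by
  obtain ⟨x, hx, N, hN, -, rfl, hxc⟩ := hD.mem_Hc hX.1
  obtain rfl := (hC x hx N hN).1 hX.2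
  have : x = c := by
    funext i
    have := hxc i
    simp only [norm_zero, ne_eq, OfNat.ofNat_ne_zero, not_false_eq_true, zero_pow, add_zero] at this
    exact (pow_left_inj₀ (hx.2 i).le (hc.2 i).le two_ne_zero).1 this
  rw [this, add_zero]

lemma IsOrtho.w₂_M (hD : D.IsOrtho) {c : Fin r → ℝ} (hc : c ∈ chamber r) :
    D.w₂ (D.M c) = 1 / ∏ i, c i := by
  simpa using hD.w₂_eq hc D.K.zero_mem

/-- Since `Hc c` meets the cone only in `M c`, where the bound on the primary weight is an equality,
the constant `κ` cancels and a scalar inequality in `c`, `x` and `‖N‖` remains. -/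
lemma minimalAtCone_of_le (hD : D.IsOrtho) (hC : D.ConeSpec) {a : Fin r → ℝ} {e : ℕ}
    (hw : D.WeightGE a e) {g : ℝ → ℝ} (hg : ∀ s, 0 < s → 0 ≤ g s)
    (hr : 1 ≤ r)
    (hle : ∀ c ∈ chamber r, ∀ x ∈ chamber r, ∀ N ∈ D.K, (∀ i, x i ^ 2 = c i ^ 2 + ‖N‖ ^ 2) →
      g ‖D.M c‖ * (∏ i, c i ^ e) / ∏ i, c i ≤ g ‖D.M x + N‖ * (∏ i, x i ^ e) /
        ((∏ i, x i) * Real.sqrt (1 + ‖N‖ ^ 2 * ∑ i, 1 / x i ^ 2))) :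
    D.MinimalAtCone a g := by
  intro c hc
  refine ⟨⟨D.M c, hD.M_mem_Hc hc, hC.M_mem hc⟩, fun X₀ hX₀ X hX => ?_⟩
  obtain rfl := hC.eq_M hD hc hX₀
  obtain ⟨x, hx, N, hN, hlt, rfl, hxc⟩ := hD.mem_Hc hX
  obtain ⟨κ, hκ, hw0, hw1⟩ := hw c hc
  have h1 := hw1 x hx N hN hlt hxc
  have h2 := hle c hc x hx N hN hxc
  have hpos : 0 < ‖D.M x + N‖ := by
    have h3 := hD.norm_add_sq x hN
    have h4 : 0 < ∑ i, x i ^ 2 :=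
      Finset.sum_pos (fun i _ => pow_pos (hx.2 i) 2) ⟨⟨0, hr⟩, Finset.mem_univ _⟩
    exact (norm_nonneg _).lt_of_ne' fun h0 => by
      rw [h0] at h3
      nlinarith [sq_nonneg ‖N‖]
  have hP : 0 < ∏ i, x i := Finset.prod_pos fun i _ => hx.2 i
  simp only [mem_ofPred_eq, fw₁w₂]
  rw [hw0, hD.w₂_M hc, hD.w₂_eq hx hN]
  calc g ‖D.M c‖ * (κ * ∏ i, c i ^ e) * (1 / ∏ i, c i)
      = κ * (g ‖D.M c‖ * (∏ i, c i ^ e) / ∏ i, c i) := by ring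
    _ ≤ κ * (g ‖D.M x + N‖ * (∏ i, x i ^ e) /
        ((∏ i, x i) * Real.sqrt (1 + ‖N‖ ^ 2 * ∑ i, 1 / x i ^ 2))) := by gcongr
    _ = g ‖D.M x + N‖ * (κ * ∏ i, x i ^ e) *
        (1 / ((∏ i, x i) * Real.sqrt (1 + ‖N‖ ^ 2 * ∑ i, 1 / x i ^ 2))) := by ring
    _ ≤ _ := by
      have := hg _ hpos
      gcongr

/-- The square of the right side is ∏ (1 + t/cᵢ²) ≥ 1 + t ∑ 1/cᵢ², and cᵢ ≤ xᵢ. -/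
lemma sqrt_le_prod_div {c x : Fin r → ℝ} (hc : c ∈ chamber r) (hx : x ∈ chamber r) {t : ℝ}
    (ht : 0 ≤ t) (hxc : ∀ i, x i ^ 2 = c i ^ 2 + t) :
    Real.sqrt (1 + t * ∑ i, 1 / x i ^ 2) ≤ (∏ i, x i) / ∏ i, c i := by
  have hx0 : 0 < ∏ i, x i := Finset.prod_pos fun i _ => hx.2 i
  have hc0 : 0 < ∏ i, c i := Finset.prod_pos fun i _ => hc.2 i
  refine Real.sqrt_le_iff.2 ⟨by positivity, ?_⟩
  rw [← Finset.prod_div_distrib, ← Finset.prod_pow]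
  have h1 : ∀ i, (x i / c i) ^ 2 = 1 + t / c i ^ 2 := fun i => by
    have := hc.2 i
    rw [div_pow, hxc]; field_simp
  simp_rw [h1]
  refine le_trans ?_ (one_add_sum_le_prod _ fun i => by positivity)
  rw [Finset.mul_sum]
  gcongr with i
  rw [mul_one_div]
  have := hc.2 i
  gcongr
  refine le_of_sq_le_sq ?_ (hx.2 i).le
  rw [hxc]; linarith

/-- Of the `e` powers of ∏ xᵢ, one cancels the product in the secondary weight and a second pays for
the square root by `sqrt_le_prod_div`. The others, like the norm, do not decrease away from the
cone. -/
theorem minimalAtCone_of_monotoneOn (hD : D.IsOrtho) (hC : D.ConeSpec) {a : Fin r → ℝ} {e : ℕ}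
    (he : 2 ≤ e) (hr : 1 ≤ r) (hw : D.WeightGE a e) {g : ℝ → ℝ} (hg : ∀ s, 0 < s → 0 ≤ g s)
    (hmono : MonotoneOn g (Ioi 0)) : D.MinimalAtCone a g := by
  refine minimalAtCone_of_le hD hC hw hg hr fun c hc x hx N hN hxc => ?_
  have hx0 : 0 < ∏ i, x i := Finset.prod_pos fun i _ => hx.2 i
  have hc0 : 0 < ∏ i, c i := Finset.prod_pos fun i _ => hc.2 i
  have hS := sqrt_le_prod_div hc hx (sq_nonneg ‖N‖) hxc
  have hS0 : 0 < Real.sqrt (1 + ‖N‖ ^ 2 * ∑ i, 1 / x i ^ 2) := by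
    have : 0 ≤ ∑ i, 1 / x i ^ 2 := Finset.sum_nonneg fun i _ => by positivity
    positivity
  have hcx : ∏ i, c i ≤ ∏ i, x i := Finset.prod_le_prod (fun i _ => (hc.2 i).le) fun i _ => by
    refine le_of_sq_le_sq ?_ (hx.2 i).le
    rw [hxc]; nlinarith [sq_nonneg ‖N‖]
  have hnc : 0 < ‖D.M c‖ := by
    have h3 := hD.norm_M_sq c
    have h4 : 0 < ∑ i, c i ^ 2 :=
      Finset.sum_pos (fun i _ => pow_pos (hc.2 i) 2) ⟨⟨0, hr⟩, Finset.mem_univ _⟩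
    exact (norm_nonneg _).lt_of_ne' fun h0 => by
      rw [h0] at h3
      linarith
  have hnx : ‖D.M c‖ ≤ ‖D.M x + N‖ := by
    refine le_of_sq_le_sq ?_ (norm_nonneg _)
    rw [hD.norm_M_sq, hD.norm_add_sq x hN]
    have : ∑ i, c i ^ 2 ≤ ∑ i, x i ^ 2 := Finset.sum_le_sum fun i _ => by
      rw [hxc]; nlinarith [sq_nonneg ‖N‖]
    nlinarith [sq_nonneg ‖N‖]
  have hgm : g ‖D.M c‖ ≤ g ‖D.M x + N‖ := hmono hnc (hnc.trans_le hnx) hnx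
  have hg0 := hg _ hnc
  obtain ⟨k, rfl⟩ := Nat.exists_eq_add_of_le he
  rw [Finset.prod_pow, Finset.prod_pow]
  set p := ∏ i, x i
  set q := ∏ i, c i
  set S := Real.sqrt (1 + ‖N‖ ^ 2 * ∑ i, 1 / x i ^ 2)
  rw [div_le_div_iff₀ hc0 (by positivity)]
  rw [le_div_iff₀ hc0] at hS
  have h1 : q ^ k ≤ p ^ k := by gcongr
  calc g ‖D.M c‖ * q ^ (2 + k) * (p * S) = g ‖D.M c‖ * q ^ k * p * q * (S * q) := by ring
    _ ≤ g ‖D.M x + N‖ * p ^ k * p * q * p := by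
      have := hg0.trans hgm
      gcongr
    _ = g ‖D.M x + N‖ * p ^ (2 + k) * q := by ring

/-- With a single coordinate, x √(1 + |N|²/x²) is |X|. The lower bound is then a constant times
g(|X|)/|X| · x^e, and no condition on `e` is needed. -/
theorem minimalAtCone_of_monotoneOn_div {D : Data V 1} (hD : D.IsOrtho) (hC : D.ConeSpec)
    {a : Fin 1 → ℝ} {e : ℕ} (hw : D.WeightGE a e) {g : ℝ → ℝ} (hg : ∀ s, 0 < s → 0 ≤ g s)
    (hmono : MonotoneOn (fun s => g s / s) (Ioi 0)) : D.MinimalAtCone a g := by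
  refine minimalAtCone_of_le hD hC hw hg le_rfl fun c hc x hx N hN hxc => ?_
  simp only [Fin.prod_univ_one, Fin.sum_univ_one, Fin.isValue]
  have hc0 := hc.2 0
  have hx0 := hx.2 0
  have hcx : c 0 ≤ x 0 := by
    refine le_of_sq_le_sq ?_ hx0.le
    rw [hxc]; nlinarith [sq_nonneg ‖N‖]
  have hnc : ‖D.M c‖ = c 0 := by
    rw [← sq_eq_sq₀ (norm_nonneg _) hc0.le, hD.norm_M_sq, Fin.sum_univ_one]
  have hS : x 0 * Real.sqrt (1 + ‖N‖ ^ 2 * (1 / x 0 ^ 2)) = ‖D.M x + N‖ := by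
    rw [← sq_eq_sq₀ (by positivity) (norm_nonneg _), hD.norm_add_sq x hN, Fin.sum_univ_one,
      mul_pow, Real.sq_sqrt (by positivity)]
    field_simp
  have hle : c 0 ≤ ‖D.M x + N‖ := by
    refine le_of_sq_le_sq ?_ (norm_nonneg _)
    rw [hD.norm_add_sq x hN, Fin.sum_univ_one, hxc]
    nlinarith [sq_nonneg ‖N‖]
  have hgm : g (c 0) / c 0 ≤ g ‖D.M x + N‖ / ‖D.M x + N‖ :=
    hmono hc0 (hc0.trans_le hle) hle
  rw [hS, hnc]
  have h0 := div_nonneg (hg _ hc0) hc0.le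
  calc g (c 0) * c 0 ^ e / c 0 = g (c 0) / c 0 * c 0 ^ e := by ring
    _ ≤ g ‖D.M x + N‖ / ‖D.M x + N‖ * x 0 ^ e := by
      have := h0.trans hgm
      gcongr
    _ = _ := by ring

/-- There are points of the chamber of any given norm with arbitrarily small last coordinate. -/
lemma exists_mem_chamber_norm_eq (hr : 2 ≤ r) {s ε : ℝ} (hs : 0 < s) (hε : 0 < ε) :
    ∃ c ∈ chamber r, ∑ i, c i ^ 2 = s ^ 2 ∧ ∃ i, c i ≤ ε := by
  -- The point is a geometric progression of ratio `δ`, rescaled to norm `s`. As `r ≥ 2`, its last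
  -- coordinate is at most `s * δ`.
  obtain ⟨δ, hδ0, hδ1⟩ : ∃ δ, 0 < δ ∧ δ < min 1 (ε / s) := exists_between (by positivity)
  rw [lt_min_iff] at hδ1
  set S := ∑ i : Fin r, (δ ^ (i : ℕ)) ^ 2 with hSdef
  have h1S : 1 ≤ S := by
    have := Finset.single_le_sum (f := fun i : Fin r => (δ ^ (i : ℕ)) ^ 2)
      (fun i _ => by positivity) (Finset.mem_univ ⟨0, by omega⟩)
    simpa using this
  have hq : 1 ≤ Real.sqrt S := Real.one_le_sqrt.2 h1S
  refine ⟨fun i => s / Real.sqrt S * δ ^ (i : ℕ), ⟨fun i j hij => ?_, fun i => by positivity⟩, ?_,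
    ⟨r - 1, by omega⟩, ?_⟩
  · have : δ ^ (j : ℕ) < δ ^ (i : ℕ) := pow_lt_pow_right_of_lt_one₀ hδ0 hδ1.1 hij
    dsimp only
    gcongr
  · simp_rw [mul_pow (s / Real.sqrt S)]
    rw [← Finset.mul_sum, ← hSdef, div_pow, Real.sq_sqrt (by linarith)]
    field_simp
  · have h1 : δ ^ (r - 1) ≤ δ := pow_le_of_le_one hδ0.le hδ1.1.le (by omega)
    have h2 : s / Real.sqrt S ≤ s := div_le_self hs.le hq
    calc s / Real.sqrt S * δ ^ (r - 1) ≤ s * δ := by gcongr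
      _ ≤ ε := by rw [mul_comm, ← le_div_iff₀ hs]; exact hδ1.2.le

/-- Fix |M(c)| = s with g(s) > 0, let some coordinate of `c` be at most t, and take |N| = t. As e ≤
1, the powers of ∏ xᵢ cannot compensate the square root, which is at least √(3/2). Minimality would
force g to gain this factor between s and √(s² + (r+1)t²) for every t > 0, contradicting continuity
at s. -/
theorem not_minimalAtCone (hD : D.IsOrtho) (hC : D.ConeSpec) {a : Fin r → ℝ} {e : ℕ}
    (he : e ≤ 1) (hr : 2 ≤ r) (hw : D.WeightEq a e) (hK : ∃ N ∈ D.K, N ≠ 0) {g : ℝ → ℝ}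
    (hcont : ContinuousOn g (Ioi 0))
    (hg : ∀ s, 0 < s → 0 ≤ g s) (hne : ∃ s, 0 < s ∧ g s ≠ 0) : ¬ D.MinimalAtCone a g := by
  intro hmin
  obtain ⟨s, hs, hgs⟩ := hne
  have hgs : 0 < g s := (hg s hs).lt_of_ne' hgs
  have key : ∀ t, 0 < t → g s * Real.sqrt (3 / 2) ≤ g (Real.sqrt (s ^ 2 + (r + 1) * t ^ 2)) := by
    intro t ht
    obtain ⟨c, hc, hcs, k, hck⟩ := exists_mem_chamber_norm_eq hr hs ht
    obtain ⟨N, hN, hNt⟩ : ∃ N ∈ D.K, ‖N‖ = t := by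
      obtain ⟨N, hN, hN0⟩ := hK
      have := norm_pos_iff.2 hN0
      exact ⟨(t / ‖N‖) • N, D.K.smul_mem _ hN, by
        rw [norm_smul, Real.norm_eq_abs, abs_of_pos (by positivity)]; field_simp⟩
    let x : Fin r → ℝ := fun i => Real.sqrt (c i ^ 2 + t ^ 2)
    have hxc : ∀ i, x i ^ 2 = c i ^ 2 + ‖N‖ ^ 2 := fun i => by
      rw [hNt]; exact Real.sq_sqrt (by positivity)
    have hx : x ∈ chamber r := by
      refine ⟨fun i j hij => Real.sqrt_lt_sqrt (by positivity) ?_,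
        fun i => Real.sqrt_pos.2 (by positivity)⟩
      have := hc.1 hij
      have := hc.2 j
      gcongr
    have hlt : ∀ i, ‖N‖ < x i := fun i => by
      refine lt_of_pow_lt_pow_left₀ 2 (hx.2 i).le ?_
      rw [hxc]
      have := pow_pos (hc.2 i) 2
      linarith
    obtain ⟨κ, hκ, hw1⟩ := hw c hc
    have hmin' := (hmin c hc).2 _ ⟨hD.M_mem_Hc hc, hC.M_mem hc⟩ (hD.add_mem_Hc hc hx hN hxc)
    have hw0 : D.w₁ a (D.M c) = κ * ∏ i, c i ^ e := by
      simpa using hw1 c hc 0 D.K.zero_mem (by simpa using hc.2) (by simp)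
    simp only [mem_ofPred_eq, fw₁w₂] at hmin'
    rw [hw0, hw1 x hx N hN hlt hxc, hD.w₂_M hc, hD.w₂_eq hx hN] at hmin'
    have hnc : ‖D.M c‖ = s := by
      rw [← sq_eq_sq₀ (norm_nonneg _) hs.le, hD.norm_M_sq, hcs]
    have hnx : ‖D.M x + N‖ = Real.sqrt (s ^ 2 + (r + 1) * t ^ 2) := by
      rw [eq_comm, Real.sqrt_eq_iff_mul_self_eq (by positivity) (norm_nonneg _), ← sq,
        hD.norm_add_sq x hN]
      simp_rw [hxc]
      rw [Finset.sum_add_distrib, hcs, hNt]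
      simp
      ring
    rw [hnc, hnx] at hmin'
    have hG : 0 ≤ g (Real.sqrt (s ^ 2 + (r + 1) * t ^ 2)) := hg _ (by positivity)
    have hx0 : 0 < ∏ i, x i := Finset.prod_pos fun i _ => hx.2 i
    have hc0 : 0 < ∏ i, c i := Finset.prod_pos fun i _ => hc.2 i
    have hcx : ∏ i, c i ≤ ∏ i, x i := Finset.prod_le_prod (fun i _ => (hc.2 i).le) fun i _ => by
      refine le_of_sq_le_sq ?_ (hx.2 i).le
      rw [hxc]; nlinarith [sq_nonneg ‖N‖]
    have hS : Real.sqrt (3 / 2) ≤ Real.sqrt (1 + ‖N‖ ^ 2 * ∑ i, 1 / x i ^ 2) := by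
      apply Real.sqrt_le_sqrt
      have h1 : 1 / x k ^ 2 ≤ ∑ i, 1 / x i ^ 2 :=
        Finset.single_le_sum (f := fun i => 1 / x i ^ 2) (fun i _ => by positivity)
          (Finset.mem_univ k)
      -- The small coordinate alone contributes at least 1/2 to |N|² ∑ 1/xᵢ².
      have h2 : x k ^ 2 ≤ 2 * ‖N‖ ^ 2 := by
        rw [hxc, hNt]
        nlinarith [hc.2 k]
      have h3 : 1 / (2 * ‖N‖ ^ 2) ≤ 1 / x k ^ 2 :=
        one_div_le_one_div_of_le (pow_pos (hx.2 k) 2) h2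
      have h4 : ‖N‖ ^ 2 * (1 / (2 * ‖N‖ ^ 2)) = 1 / 2 := by
        have : 0 < ‖N‖ := hNt ▸ ht
        field_simp
      nlinarith [mul_le_mul_of_nonneg_left (h3.trans h1) (sq_nonneg ‖N‖)]
    have h32 : 0 < Real.sqrt (3 / 2) := by positivity
    rw [Finset.prod_pow, Finset.prod_pow] at hmin'
    set p := ∏ i, x i
    set q := ∏ i, c i
    set S := Real.sqrt (1 + ‖N‖ ^ 2 * ∑ i, 1 / x i ^ 2)
    set G := g (Real.sqrt (s ^ 2 + (r + 1) * t ^ 2))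
    have hS0 : 0 < S := h32.trans_le hS
    have h5 : g s * (q ^ e / q) ≤ G * (p ^ e / p) / S := by
      refine le_of_mul_le_mul_left ?_ hκ
      calc κ * (g s * (q ^ e / q)) = g s * (κ * q ^ e) * (1 / q) := by ring
        _ ≤ _ := hmin'
        _ = _ := by field_simp
    have h6 : p ^ e / p ≤ q ^ e / q := by
      interval_cases e
      · simp only [pow_zero]; gcongr
      · simp [hx0.ne', hc0.ne']
    have h7 : g s * (q ^ e / q) ≤ G / S * (q ^ e / q) :=
      h5.trans (by
        rw [mul_div_right_comm]
        gcongr)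
    have h8 := le_of_mul_le_mul_right h7 (by positivity)
    rw [le_div_iff₀ hS0] at h8
    exact (mul_le_mul_of_nonneg_left hS hgs.le).trans h8
  have hlim : Tendsto (fun t : ℝ => g (Real.sqrt (s ^ 2 + (r + 1) * t ^ 2))) (𝓝[>] 0) (𝓝 (g s)) := by
    have h1 : ContinuousAt g s := hcont.continuousAt (Ioi_mem_nhds hs)
    have h2 : Tendsto (fun t : ℝ => Real.sqrt (s ^ 2 + (r + 1) * t ^ 2)) (𝓝 0) (𝓝 s) := by
      have : Continuous fun t : ℝ => Real.sqrt (s ^ 2 + (r + 1) * t ^ 2) := by fun_prop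
      have h3 := this.tendsto 0
      simpa [Real.sqrt_sq hs.le] using h3
    exact (h1.tendsto.comp h2).mono_left nhdsWithin_le_nhds
  have hle : g s * Real.sqrt (3 / 2) ≤ g s :=
    ge_of_tendsto hlim (eventually_nhdsWithin_of_forall fun t ht => key t ht)
  have h1 : 1 < Real.sqrt (3 / 2) := by
    rw [Real.lt_sqrt zero_le_one]; norm_num
  nlinarith

end Data

section Determinants

/-! ### Determinants of `y - A Aᵀ` -/

/-- The inequality ∏ (1 − fᵢ/y) ≥ 1 − ∑ fᵢ/y, cleared of denominators so that y = 0 need not be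
excluded. -/
lemma pow_card_mul_le_mul_prod {ι : Type*} (s : Finset ι) {f : ι → ℝ} {y : ℝ}
    (hf : ∀ i, 0 ≤ f i) (hy : ∑ i ∈ s, f i ≤ y) :
    y ^ s.card * (y - ∑ i ∈ s, f i) ≤ y * ∏ i ∈ s, (y - f i) := by
  classical
  induction s using Finset.induction_on with
  | empty => simp
  | insert i s hi ih =>
    rw [Finset.sum_insert hi] at hy ⊢
    rw [Finset.prod_insert hi, Finset.card_insert_of_notMem hi]
    have h1 : 0 ≤ ∑ i ∈ s, f i := Finset.sum_nonneg fun i _ => hf i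
    have h2 := mul_le_mul_of_nonneg_left (ih (by linarith [hf i])) (a := y - f i) (by linarith)
    have h3 : 0 ≤ y ^ s.card := pow_nonneg (by linarith [hf i]) _
    have h4 := mul_nonneg h3 (mul_nonneg (hf i) h1)
    calc y ^ (s.card + 1) * (y - (f i + ∑ i ∈ s, f i))
        ≤ (y - f i) * (y ^ s.card * (y - ∑ i ∈ s, f i)) := by rw [pow_succ]; linarith
      _ ≤ _ := h2
      _ = _ := by ring

variable {n k : Type*} [Fintype n] [DecidableEq n] [Fintype k]

/-- Lower bound for the characteristic polynomial of a Gram matrix to the right of its trace. -/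
lemma pow_card_mul_le_mul_det (A : Matrix n k ℝ) {y : ℝ} (hy : (A * Aᵀ).trace ≤ y) :
    y ^ Fintype.card n * (y - (A * Aᵀ).trace) ≤ y * (y • (1 : Matrix n n ℝ) - A * Aᵀ).det := by
  have hS : (A * Aᵀ).PosSemidef := by
    simpa using Matrix.posSemidef_self_mul_conjTranspose A
  have htr : (A * Aᵀ).trace = ∑ i, hS.1.eigenvalues i := by
    simpa using hS.1.trace_eq_sum_eigenvalues
  have hdet : (y • (1 : Matrix n n ℝ) - A * Aᵀ).det = ∏ i, (y - hS.1.eigenvalues i) := by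
    have h1 := congrArg (Polynomial.eval y) hS.1.charpoly_eq
    rw [Matrix.eval_charpoly, Polynomial.eval_prod] at h1
    simpa [Matrix.smul_one_eq_diagonal, Matrix.scalar_apply] using h1
  rw [htr] at hy
  rw [hdet, htr]
  exact pow_card_mul_le_mul_prod _ hS.eigenvalues_nonneg hy

/-- The spectrum of a real skew-symmetric matrix is symmetric, in terms of the characteristic
polynomial of `N Nᵀ`. -/
lemma exists_eigenvalues_of_skew {N : Matrix n n ℝ} (hN : Nᵀ = -N) :
    ∃ μ : n → ℝ, (∀ z : ℝ, ∏ i, (z - μ i) = ∏ i, (z + μ i)) ∧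
      (N * Nᵀ).trace = ∑ i, μ i ^ 2 ∧
      ∀ y : ℝ, (y • (1 : Matrix n n ℝ) - N * Nᵀ).det = ∏ i, (y - μ i ^ 2) := by
  let NC : Matrix n n ℂ := N.map (algebraMap ℝ ℂ)
  -- The matrix iN is Hermitian with square N Nᵀ, and its transpose is its negative. The first fact
  -- gives the trace and the determinant in terms of real eigenvalues, the second the symmetry of
  -- the spectrum.
  let H : Matrix n n ℂ := Complex.I • NC
  have hNC : NCᵀ = -NC := by
    ext i j
    have := congrFun (congrFun hN i) j
    simp only [Matrix.transpose_apply, Matrix.neg_apply] at this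
    simp [NC, this]
  have hH : H.IsHermitian := by
    ext i j
    have := congrFun (congrFun hN i) j
    simp only [Matrix.transpose_apply, Matrix.neg_apply] at this
    simp [H, NC, this]
  have hHT : Hᵀ = -H := by simp [H, Matrix.transpose_smul, hNC]
  let U : Matrix n n ℂ := hH.eigenvectorUnitary
  have hU : U * star U = 1 := Unitary.coe_mul_star_self _
  have hU' : star U * U = 1 := Unitary.coe_star_mul_self _
  let d : Matrix n n ℂ := Matrix.diagonal (RCLike.ofReal ∘ hH.eigenvalues)
  have hspec : H = U * d * star U := by
    have := hH.spectral_theorem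
    rwa [Unitary.conjStarAlgAut_apply] at this
  have hdetU : U.det * (star U).det = 1 := by rw [← Matrix.det_mul, hU, Matrix.det_one]
  have hsq : H * H = U * (d * d) * star U := by
    rw [hspec]
    calc U * d * star U * (U * d * star U) = U * d * (star U * U) * d * star U := by
          simp only [Matrix.mul_assoc]
      _ = _ := by rw [hU']; simp only [Matrix.mul_one, Matrix.mul_assoc]
  have hHH : H * H = (N * Nᵀ).map (algebraMap ℝ ℂ) := by
    rw [hN, Matrix.map_mul]
    simp only [H, Matrix.smul_mul, Matrix.mul_smul, smul_smul, Complex.I_mul_I]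
    ext i j
    simp [NC, Matrix.mul_apply]
  have hconj : ∀ (z : ℂ) (e : Matrix n n ℂ), (z • (1 : Matrix n n ℂ) - U * e * star U).det
      = (z • (1 : Matrix n n ℂ) - e).det := by
    intro z e
    have : z • (1 : Matrix n n ℂ) - U * e * star U
        = U * (z • (1 : Matrix n n ℂ) - e) * star U := by
      rw [Matrix.mul_sub, Matrix.sub_mul, Matrix.mul_smul, Matrix.mul_one, Matrix.smul_mul, hU]
    rw [this, Matrix.det_mul, Matrix.det_mul, mul_right_comm, hdetU, one_mul]
  refine ⟨hH.eigenvalues, fun z => ?_, ?_, fun y => ?_⟩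
  · have h1 : ((z : ℂ) • (1 : Matrix n n ℂ) - H).det = ∏ i, ((z : ℂ) - hH.eigenvalues i) := by
      conv_lhs => rw [hspec]
      rw [hconj, Matrix.smul_one_eq_diagonal, Matrix.diagonal_sub, Matrix.det_diagonal]
      rfl
    have h2 : ((z : ℂ) • (1 : Matrix n n ℂ) - H).det = ∏ i, ((z : ℂ) + hH.eigenvalues i) := by
      rw [← Matrix.det_transpose, Matrix.transpose_sub, Matrix.transpose_smul,
        Matrix.transpose_one, hHT]
      have : -H = U * (-d) * star U := by
        conv_lhs => rw [hspec]
        rw [Matrix.mul_neg, Matrix.neg_mul]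
      rw [this, hconj, sub_neg_eq_add, Matrix.smul_one_eq_diagonal, Matrix.diagonal_add,
        Matrix.det_diagonal]
      rfl
    have := h1.symm.trans h2
    exact_mod_cast this
  · have h1 : (H * H).trace = ∑ i, (hH.eigenvalues i : ℂ) ^ 2 := by
      rw [hsq, Matrix.trace_mul_comm, ← Matrix.mul_assoc, hU', Matrix.one_mul,
        Matrix.diagonal_mul_diagonal, Matrix.trace_diagonal]
      simp [sq]
    have h2 : (H * H).trace = ((N * Nᵀ).trace : ℂ) := by
      rw [hHH]
      simp [Matrix.trace]
    have := h2.symm.trans h1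
    exact_mod_cast this
  · have h1 : ((y : ℂ) • (1 : Matrix n n ℂ) - H * H).det
        = ∏ i, ((y : ℂ) - (hH.eigenvalues i : ℂ) ^ 2) := by
      rw [hsq, hconj, Matrix.diagonal_mul_diagonal, Matrix.smul_one_eq_diagonal,
        Matrix.diagonal_sub, Matrix.det_diagonal]
      simp [sq]
    have h2 : ((y : ℂ) • (1 : Matrix n n ℂ) - H * H)
        = (algebraMap ℝ ℂ).mapMatrix (y • (1 : Matrix n n ℝ) - N * Nᵀ) := by
      rw [hHH]
      ext i j
      simp [Matrix.one_apply]
      split_ifs <;> simp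
    rw [h2, ← RingHom.map_det] at h1
    have h3 : (((y • (1 : Matrix n n ℝ) - N * Nᵀ).det : ℝ) : ℂ)
        = ∏ i, ((y : ℂ) - (hH.eigenvalues i : ℂ) ^ 2) := h1
    exact_mod_cast h3

/-- The sharper form of `pow_card_mul_le_mul_det` for skew-symmetric matrices. -/
lemma pow_card_mul_le_sq_mul_det_of_skew {N : Matrix n n ℝ} (hN : Nᵀ = -N) {y t : ℝ}
    (ht : (N * Nᵀ).trace = 2 * t) (hy : t ≤ y) :
    y ^ Fintype.card n * (y - t) ^ 2 ≤ y ^ 2 * (y • (1 : Matrix n n ℝ) - N * Nᵀ).det := by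
  obtain ⟨μ, hsymm, htr, hdet⟩ := exists_eigenvalues_of_skew hN
  -- Equality of the two products as polynomials makes the multiset of eigenvalues invariant under
  -- negation.
  have hms : Finset.univ.val.map μ = Finset.univ.val.map fun i => -μ i := by
    have h1 : ∏ i, (Polynomial.X - Polynomial.C (μ i)) =
        ∏ i, (Polynomial.X - Polynomial.C (-μ i)) := by
      refine Polynomial.funext fun z => ?_
      simpa [Polynomial.eval_prod] using hsymm z
    have h2 := congrArg Polynomial.roots h1
    have hroots : ∀ f : n → ℝ, (∏ i, (Polynomial.X - Polynomial.C (f i))).roots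
        = Finset.univ.val.map f := fun f => by
      rw [← Polynomial.roots_multiset_prod_X_sub_C (Finset.univ.val.map f), Multiset.map_map]
      rfl
    rwa [hroots, hroots] at h2
  let P := Finset.univ.filter fun i => 0 < μ i
  let M := Finset.univ.filter fun i => 0 < -μ i
  let Z := Finset.univ.filter fun i => μ i = 0
  have hPM : P.val.map μ = M.val.map fun i => -μ i := by
    have := congrArg (Multiset.filter (0 < ·)) hms
    rwa [Multiset.filter_map, Multiset.filter_map] at this
  have hcard : P.card = M.card := by
    have := congrArg Multiset.card hPM
    simpa using this
  have hsplit : ∀ f : n → ℝ, ∏ i, f i = (∏ i ∈ P, f i) * (∏ i ∈ M, f i) * ∏ i ∈ Z, f i := by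
    intro f
    rw [← Finset.prod_filter_mul_prod_filter_not Finset.univ (fun i => 0 < μ i),
      ← Finset.prod_filter_mul_prod_filter_not (Finset.univ.filter fun i => ¬ 0 < μ i)
        (fun i => 0 < -μ i), Finset.filter_filter, Finset.filter_filter, ← mul_assoc]
    congr 2
    · congr 1
      ext i
      simp only [Finset.mem_filter, Finset.mem_univ, true_and, M]
      constructor <;> intro h <;> grind
    · ext i
      simp only [Finset.mem_filter, Finset.mem_univ, true_and, Z]
      constructor <;> intro h <;> grind
  have hsplit' : ∑ i, μ i ^ 2 = (∑ i ∈ P, μ i ^ 2) + (∑ i ∈ M, μ i ^ 2) := by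
    rw [← Finset.sum_filter_add_sum_filter_not Finset.univ (fun i => 0 < μ i)]
    congr 1
    symm
    refine Finset.sum_subset (fun i hi => ?_) fun i hi hi' => ?_
    · simp only [Finset.mem_filter, Finset.mem_univ, true_and, M] at hi ⊢
      linarith
    · simp only [Finset.mem_filter, Finset.mem_univ, true_and, M] at hi hi'
      have : μ i = 0 := by linarith
      simp [this]
  have hprodPM : ∏ i ∈ P, (y - μ i ^ 2) = ∏ i ∈ M, (y - μ i ^ 2) := by
    have := congrArg (fun s => (s.map fun z : ℝ => y - z ^ 2).prod) hPM
    simpa using this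
  have hsumPM : ∑ i ∈ P, μ i ^ 2 = ∑ i ∈ M, μ i ^ 2 := by
    have := congrArg (fun s => (s.map fun z : ℝ => z ^ 2).sum) hPM
    simpa using this
  -- The positive and the negative eigenvalues each carry half of the trace, so the product
  -- inequality applies to one half with sum `t`; squaring it then accounts for the other half.
  have hsum : ∑ i ∈ P, μ i ^ 2 = t := by linarith
  have hZ : ∏ i ∈ Z, (y - μ i ^ 2) = y ^ Z.card := by
    rw [Finset.prod_congr rfl (g := fun _ => y), Finset.prod_const]
    intro i hi
    have : μ i = 0 := (Finset.mem_filter.1 hi).2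
    simp [this]
  have hcardn : y ^ Fintype.card n = y ^ P.card * y ^ P.card * y ^ Z.card := by
    have := hsplit fun _ => y
    simpa [hcard] using this
  have ht0 : 0 ≤ t := hsum ▸ Finset.sum_nonneg fun i _ => sq_nonneg _
  have hb := pow_card_mul_le_mul_prod P (f := fun i => μ i ^ 2) (fun i => sq_nonneg _)
    (hsum.le.trans hy)
  rw [hsum] at hb
  have hy0 : 0 ≤ y := ht0.trans hy
  rw [hdet, hsplit, ← hprodPM, hZ, hcardn]
  calc y ^ P.card * y ^ P.card * y ^ Z.card * (y - t) ^ 2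
      = (y ^ P.card * (y - t)) ^ 2 * y ^ Z.card := by ring
    _ ≤ (y * ∏ i ∈ P, (y - μ i ^ 2)) ^ 2 * y ^ Z.card := by
      have : 0 ≤ y ^ P.card * (y - t) := mul_nonneg (by positivity) (by linarith)
      gcongr
    _ = _ := by ring

lemma det_blockDiagonal'_eq {ι : Type*} [Fintype ι] [LinearOrder ι] {m : ι → Type*}
    [∀ i, Fintype (m i)] [∀ i, DecidableEq (m i)] (A : ∀ i, Matrix (m i) (m i) ℝ) :
    (Matrix.blockDiagonal' A).det = ∏ i, (A i).det := by
  rw [(Matrix.blockTriangular_blockDiagonal' A).det_fintype]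
  refine Finset.prod_congr rfl fun i _ => ?_
  let e : m i ≃ {a : Σ i, m i // a.1 = i} :=
    { toFun := fun a => ⟨⟨i, a⟩, rfl⟩
      invFun := fun a => a.2 ▸ a.1.2
      left_inv := fun a => rfl
      right_inv := by rintro ⟨⟨j, a⟩, rfl⟩; rfl }
  rw [← Matrix.det_submatrix_equiv_self e]
  congr 1
  ext a b
  simp [e, Matrix.toSquareBlock_def]

/-- Schur complement of the lower right scalar block; the surplus of columns over rows survives as a
power of `x`. -/
lemma det_fromBlocks_smul_one [DecidableEq k] {x : ℝ} (hx : 0 < x) (Y : Matrix n k ℝ)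
    (h : Fintype.card n ≤ Fintype.card k) :
    (Matrix.fromBlocks (x • 1) (-Y) (-Yᵀ) (x • 1)).det
      = x ^ (Fintype.card k - Fintype.card n) * (x ^ 2 • (1 : Matrix n n ℝ) - Y * Yᵀ).det := by
  let _ : Invertible (x • (1 : Matrix k k ℝ)) :=
    ⟨x⁻¹ • 1, by simp [hx.ne'], by simp [hx.ne']⟩
  have hinv : ⅟(x • (1 : Matrix k k ℝ)) = x⁻¹ • 1 := rfl
  rw [Matrix.det_fromBlocks₂₂, hinv]
  have h1 : x ^ 2 • (1 : Matrix n n ℝ) - Y * Yᵀ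
      = x • (x • (1 : Matrix n n ℝ) - -Y * (x⁻¹ • (1 : Matrix k k ℝ)) * -Yᵀ) := by
    simp [smul_sub, smul_smul, sq, hx.ne']
  rw [h1, Matrix.det_smul, Matrix.det_smul, Matrix.det_one, mul_one, ← mul_assoc, ← pow_add,
    Nat.sub_add_cancel h]

end Determinants

section Wedge

/-! ### Matrices with prescribed largest singular values -/

variable {R C : Type*} [Fintype R] [Fintype C] [DecidableEq C] {r : ℕ}

/-- The columns of `X` with label `< r` are orthogonal to all others and have length
`x (label)`; on the span of the other coordinates `X` is bounded by `ν`. -/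
structure IsWedge (lab : C → ℕ) (x : Fin r → ℝ) (ν : ℝ) (X : Matrix R C ℝ) : Prop where
  gram : ∀ s t (h : lab s < r), (Xᵀ * X) s t = if s = t then x ⟨lab s, h⟩ ^ 2 else 0
  norm_le : ∀ u : C → ℝ, (∀ s, lab s < r → u s = 0) →
    (X *ᵥ u) ⬝ᵥ (X *ᵥ u) ≤ ν ^ 2 * (u ⬝ᵥ u)

variable {lab : C → ℕ} {x x' : Fin r → ℝ} {ν ν' : ℝ} {X X' : Matrix R C ℝ} {U : Matrix C C ℝ}

lemma IsWedge.gram' (hX : IsWedge lab x ν X) (s t : C) (h : lab t < r) :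
    (Xᵀ * X) s t = if s = t then x ⟨lab t, h⟩ ^ 2 else 0 := by
  have h1 : (Xᵀ * X) s t = (Xᵀ * X) t s := by
    simp [Matrix.mul_apply, mul_comm]
  rw [h1, hX.gram t s h]
  simp [eq_comm]

lemma IsWedge.mul_gram (hX' : IsWedge lab x' ν' X') (s t : C) (h : lab t < r) :
    (U * (X'ᵀ * X')) s t = U s t * x' ⟨lab t, h⟩ ^ 2 := by
  rw [Matrix.mul_apply, Finset.sum_eq_single t]
  · rw [hX'.gram' t t h, if_pos rfl]
  · intro k _ hk
    rw [hX'.gram' k t h, if_neg hk, mul_zero]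
  · simp

lemma IsWedge.gram_mul (hX : IsWedge lab x ν X) (s t : C) (h : lab s < r) :
    (Xᵀ * X * U) s t = x ⟨lab s, h⟩ ^ 2 * U s t := by
  rw [Matrix.mul_apply, Finset.sum_eq_single s]
  · rw [hX.gram s s h, if_pos rfl]
  · intro k _ hk
    rw [hX.gram s k h, if_neg hk.symm, zero_mul]
  · simp

/-- Column `t` of `U` is an eigenvector of `Xᵀ * X` for the square of the value of `x'` at `t`. Its
part with labels at least `r` satisfies the same eigenvalue equation, but there `Xᵀ * X` is bounded
by `ν ^ 2`, which is smaller, so that part vanishes. -/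
lemma IsWedge.intertwining_eq_zero (hX : IsWedge lab x ν X) (hX' : IsWedge lab x' ν' X')
    (hν : 0 ≤ ν) (hU : Xᵀ * X * U = U * (X'ᵀ * X')) {s t : C} (hs : ¬ lab s < r)
    (ht : lab t < r) (hlt : ν < x' ⟨lab t, ht⟩) : U s t = 0 := by
  let u : C → ℝ := fun k => if lab k < r then 0 else U k t
  have hu : ∀ k, lab k < r → u k = 0 := fun k hk => if_pos hk
  have hGu : ∀ k, ¬ lab k < r → ((Xᵀ * X) *ᵥ u) k = x' ⟨lab t, ht⟩ ^ 2 * u k := by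
    intro k hk
    have h1 : ((Xᵀ * X) *ᵥ u) k = (Xᵀ * X * U) k t := by
      rw [Matrix.mulVec, dotProduct, Matrix.mul_apply]
      refine Finset.sum_congr rfl fun l _ => ?_
      by_cases hl : lab l < r
      · have : k ≠ l := fun h => hk (h ▸ hl)
        rw [hX.gram' k l hl, if_neg this, zero_mul, zero_mul]
      · simp [u, hl]
    rw [h1, hU, hX'.mul_gram k t ht]
    simp [u, hk, mul_comm]
  have h2 : (X *ᵥ u) ⬝ᵥ (X *ᵥ u) = x' ⟨lab t, ht⟩ ^ 2 * (u ⬝ᵥ u) := by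
    have h3 : (X *ᵥ u) ⬝ᵥ (X *ᵥ u) = u ⬝ᵥ ((Xᵀ * X) *ᵥ u) := by
      rw [← Matrix.mulVec_mulVec, Matrix.dotProduct_mulVec u, Matrix.vecMul_transpose]
    rw [h3, dotProduct, dotProduct, Finset.mul_sum]
    refine Finset.sum_congr rfl fun k _ => ?_
    by_cases hk : lab k < r
    · simp [hu k hk]
    · rw [hGu k hk]; ring
  have h4 := hX.norm_le u hu
  rw [h2] at h4
  have h5 : ν ^ 2 < x' ⟨lab t, ht⟩ ^ 2 := by gcongr
  have h6 : 0 ≤ u ⬝ᵥ u := Finset.sum_nonneg fun k _ => mul_self_nonneg _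
  have h7 : u ⬝ᵥ u = 0 := by nlinarith
  have h8 := congrFun (dotProduct_self_eq_zero.1 h7) s
  simpa [u, hs] using h8

lemma eq_of_forall_exists_eq (hx : StrictAnti x) (hx' : StrictAnti x')
    (h : ∀ j, ∃ i, x i = x' j) : x = x' := by
  have hsub : Set.range x' ⊆ Set.range x := by
    rintro _ ⟨j, rfl⟩
    exact h j
  have hcard : Set.range x' = Set.range x := by
    refine Set.eq_of_subset_of_ncard_le hsub ?_ (Set.finite_range _)
    rw [← Set.image_univ, ← Set.image_univ, Set.ncard_image_of_injective _ hx.injective,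
      Set.ncard_image_of_injective _ hx'.injective]
  exact (hx.range_inj hx').1 hcard.symm

/-- The order of `ν` and `ν'` puts every `x' j` above `ν`, so a column of `U` with label `j` has a
nonzero entry at a label below `r`. Comparing both sides of the intertwining relation there exhibits
`x' j` as a value of `x`. -/
lemma IsWedge.values_eq_of_le (hX : IsWedge lab x ν X) (hX' : IsWedge lab x' ν' X')
    (hν : 0 ≤ ν) (hle : ν ≤ ν') (hx : x ∈ chamber r) (hx' : x' ∈ chamber r)
    (hlt' : ∀ j, ν' < x' j) (hlab : ∀ j : Fin r, ∃ t, lab t = j)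
    (hUU : Uᵀ * U = 1) (hU : Xᵀ * X * U = U * (X'ᵀ * X')) : x = x' := by
  refine eq_of_forall_exists_eq hx.1 hx'.1 fun j => ?_
  obtain ⟨t, ht⟩ := hlab j
  have htr : lab t < r := ht ▸ j.2
  obtain ⟨s, hs⟩ : ∃ s, U s t ≠ 0 := by
    by_contra! h
    have := congrFun (congrFun hUU t) t
    simp [Matrix.mul_apply, h] at this
  have hsr : lab s < r := by
    by_contra hsr
    exact hs (hX.intertwining_eq_zero hX' hν hU hsr htr (hle.trans_lt (hlt' _)))
  refine ⟨⟨lab s, hsr⟩, ?_⟩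
  have h1 := hX.gram_mul (U := U) s t hsr
  rw [hU, hX'.mul_gram s t htr, mul_comm] at h1
  have h2 := mul_right_cancel₀ hs h1
  have h3 : (⟨lab t, htr⟩ : Fin r) = j := Fin.ext ht
  rw [h3] at h2
  exact ((sq_eq_sq₀ (hx'.2 _).le (hx.2 _).le).1 h2).symm

/-- A pair of orthogonal matrices which takes `X` to `X'` takes `X D` to `X' D'`, for corresponding
functions `D`, `D'` of the singular values. -/
theorem IsWedge.orbit_map_eq [DecidableEq R] (hX : IsWedge lab x ν X) (hX' : IsWedge lab x' ν' X')
    (hν : 0 ≤ ν) (hν' : 0 ≤ ν') (hx : x ∈ chamber r) (hx' : x' ∈ chamber r)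
    (hlt : ∀ j, ν < x j) (hlt' : ∀ j, ν' < x' j) (hlab : ∀ j : Fin r, ∃ t, lab t = j)
    {A : Matrix R C ℝ} {a : Fin r → ℝ}
    (hA : A = X * Matrix.diagonal fun s => if h : lab s < r then a ⟨lab s, h⟩ / x ⟨lab s, h⟩ else 0)
    (hA' : A = X' * Matrix.diagonal fun s =>
      if h : lab s < r then a ⟨lab s, h⟩ / x' ⟨lab s, h⟩ else 0)
    {P P' : Matrix R R ℝ} {Q Q' : Matrix C C ℝ} (hP : P ∈ Matrix.orthogonalGroup R ℝ)
    (hP' : P' ∈ Matrix.orthogonalGroup R ℝ) (hQ : Q ∈ Matrix.orthogonalGroup C ℝ)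
    (hQ' : Q' ∈ Matrix.orthogonalGroup C ℝ) (h : P * X * Qᵀ = P' * X' * Q'ᵀ) :
    P * A * Qᵀ = P' * A * Q'ᵀ := by
  have hP1 : P * Pᵀ = 1 := (Matrix.mem_orthogonalGroup_iff _ _).1 hP
  have hP2 : Pᵀ * P = 1 := (Matrix.mem_orthogonalGroup_iff' _ _).1 hP
  have hP1' : P' * P'ᵀ = 1 := (Matrix.mem_orthogonalGroup_iff _ _).1 hP'
  have hP2' : P'ᵀ * P' = 1 := (Matrix.mem_orthogonalGroup_iff' _ _).1 hP'
  have hQ1 : Q * Qᵀ = 1 := (Matrix.mem_orthogonalGroup_iff _ _).1 hQ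
  have hQ2 : Qᵀ * Q = 1 := (Matrix.mem_orthogonalGroup_iff' _ _).1 hQ
  have hQ1' : Q' * Q'ᵀ = 1 := (Matrix.mem_orthogonalGroup_iff _ _).1 hQ'
  have hQ2' : Q'ᵀ * Q' = 1 := (Matrix.mem_orthogonalGroup_iff' _ _).1 hQ'
  obtain ⟨U, hUdef⟩ : ∃ U : Matrix C C ℝ, U = Qᵀ * Q' := ⟨_, rfl⟩
  obtain ⟨W, hWdef⟩ : ∃ W : Matrix R R ℝ, W = Pᵀ * P' := ⟨_, rfl⟩
  have hXU : X * U = W * X' := by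
    calc X * U = (Pᵀ * P) * X * Qᵀ * Q' := by rw [hP2, Matrix.one_mul, hUdef, Matrix.mul_assoc]
      _ = Pᵀ * (P * X * Qᵀ) * Q' := by simp only [Matrix.mul_assoc]
      _ = Pᵀ * P' * X' * (Q'ᵀ * Q') := by rw [h]; simp only [Matrix.mul_assoc]
      _ = W * X' := by rw [hQ2', Matrix.mul_one, hWdef]
  have hUU : Uᵀ * U = 1 := by
    calc Uᵀ * U = Q'ᵀ * (Q * Qᵀ) * Q' := by
          simp only [hUdef, Matrix.transpose_mul, Matrix.transpose_transpose, Matrix.mul_assoc]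
      _ = 1 := by rw [hQ1, Matrix.mul_one, hQ2']
  have hUU' : U * Uᵀ = 1 := mul_eq_one_comm.1 hUU
  have hWW : W * Wᵀ = 1 := by
    calc W * Wᵀ = Pᵀ * (P' * P'ᵀ) * P := by
          simp only [hWdef, Matrix.transpose_mul, Matrix.transpose_transpose, Matrix.mul_assoc]
      _ = 1 := by rw [hP1', Matrix.mul_one, hP2]
  have hWW' : Wᵀ * W = 1 := mul_eq_one_comm.1 hWW
  -- Orthogonality of `U` and `W` transposes the relation `X * U = W * X'`; together they show that
  -- `U` intertwines the two Gram matrices.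
  have hXW : Xᵀ * W = U * X'ᵀ := by
    have h1 : Uᵀ * Xᵀ = X'ᵀ * Wᵀ := by
      rw [← Matrix.transpose_mul, hXU, Matrix.transpose_mul]
    calc Xᵀ * W = U * (Uᵀ * Xᵀ) * W := by rw [← Matrix.mul_assoc, hUU', Matrix.one_mul]
      _ = U * X'ᵀ * (Wᵀ * W) := by rw [h1]; simp only [Matrix.mul_assoc]
      _ = U * X'ᵀ := by rw [hWW', Matrix.mul_one]
  have hU : Xᵀ * X * U = U * (X'ᵀ * X') := by
    rw [Matrix.mul_assoc, hXU, ← Matrix.mul_assoc, hXW, Matrix.mul_assoc]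
  have hUt : X'ᵀ * X' * Uᵀ = Uᵀ * (Xᵀ * X) := by
    have := congrArg Matrix.transpose hU
    simpa only [Matrix.transpose_mul, Matrix.transpose_transpose] using this.symm
  have hxx : x = x' := by
    rcases le_total ν ν' with hle | hle
    · exact hX.values_eq_of_le hX' hν hle hx hx' hlt' hlab hUU hU
    · exact (hX'.values_eq_of_le hX hν' hle hx' hx hlt hlab (U := Uᵀ)
        (by rw [Matrix.transpose_transpose, hUU']) hUt).symm
  subst hxx
  -- `U` links labels below `r` only when the singular values agree, and does not link them to
  -- labels at least `r`; on the remaining block the diagonal matrix is zero.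
  have hcomm : (Matrix.diagonal fun s =>
        if h : lab s < r then a ⟨lab s, h⟩ / x ⟨lab s, h⟩ else 0) * U
      = U * Matrix.diagonal fun s =>
        if h : lab s < r then a ⟨lab s, h⟩ / x ⟨lab s, h⟩ else 0 := by
    ext s t
    rw [Matrix.diagonal_mul, Matrix.mul_diagonal]
    by_cases hs : lab s < r <;> by_cases ht : lab t < r
    · by_cases h0 : U s t = 0
      · simp [h0]
      · have h1 := hX.gram_mul (U := U) s t hs
        rw [hU, hX'.mul_gram s t ht, mul_comm] at h1
        have h2 := mul_right_cancel₀ h0 h1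
        have h3 := hx.1.injective ((sq_eq_sq₀ (hx.2 _).le (hx.2 _).le).1 h2)
        rw [dif_pos hs, dif_pos ht, h3, mul_comm]
    · have := hX'.intertwining_eq_zero hX hν' hUt (s := t) (t := s) ht hs (hlt' _)
      rw [Matrix.transpose_apply] at this
      simp [this]
    · have := hX.intertwining_eq_zero hX' hν hU (s := s) (t := t) hs ht (hlt _)
      simp [this]
    · simp [hs, ht]
  have hAU : A * U = W * A := by
    conv_lhs => rw [hA]
    conv_rhs => rw [hA']
    rw [Matrix.mul_assoc, hcomm, ← Matrix.mul_assoc, hXU, Matrix.mul_assoc]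
  calc P * A * Qᵀ = P * (A * U) * Q'ᵀ := by
        simp only [hUdef, Matrix.mul_assoc]
        rw [hQ1', Matrix.mul_one]
    _ = (P * Pᵀ) * P' * A * Q'ᵀ := by rw [hAU]; simp only [hWdef, Matrix.mul_assoc]
    _ = P' * A * Q'ᵀ := by rw [hP1, Matrix.one_mul]

/-- A matrix of the wedge with a nonzero column beyond the first ones has larger rank. -/
lemma IsWedge.card_lt_rank (hX : IsWedge lab x ν X) (hx : ∀ i, 0 < x i) {s₀ : R} {t₀ : C}
    (ht₀ : ¬ lab t₀ < r) (h0 : X s₀ t₀ ≠ 0) :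
    (Finset.univ.filter fun t => lab t < r).card < X.rank := by
  -- These columns are independent: the inner product of a relation with a column of label below `r`
  -- isolates its coefficient, and then the entry `X s₀ t₀` kills the last one.
  let T := {t : C // lab t < r ∨ t = t₀}
  have hcard : Fintype.card T = (Finset.univ.filter fun t => lab t < r).card + 1 := by
    rw [Fintype.card_subtype, ← Finset.card_insert_of_notMem (a := t₀) (by simp [ht₀])]
    congr 1
    ext t
    simp [or_comm]
  have hli : LinearIndependent ℝ (X.submatrix id (Subtype.val : T → C))ᵀ.row := by
    rw [Fintype.linearIndependent_iff]
    intro w hw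
    have hw' : ∀ s, ∑ t : T, w t * X s t = 0 := fun s => by
      have := congrFun hw s
      simpa [Matrix.row] using this
    have h1 : ∀ t : T, lab t < r → w t = 0 := by
      intro t ht
      have h2 : ∑ t' : T, w t' * (Xᵀ * X) t t' = 0 := by
        have : ∑ t' : T, w t' * (Xᵀ * X) t t' = ∑ s, X s t * ∑ t' : T, w t' * X s t' := by
          simp only [Matrix.mul_apply, Matrix.transpose_apply, Finset.mul_sum]
          rw [Finset.sum_comm]
          exact Finset.sum_congr rfl fun _ _ => Finset.sum_congr rfl fun _ _ => by ring
        rw [this]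
        simp [hw']
      rw [Finset.sum_eq_single t] at h2
      · rw [hX.gram t t ht, if_pos rfl] at h2
        exact (mul_eq_zero.1 h2).resolve_right (pow_pos (hx _) 2).ne'
      · intro b _ hb
        rw [hX.gram t b ht, if_neg (fun h => hb (Subtype.ext h.symm)), mul_zero]
      · simp
    have h3 : w ⟨t₀, Or.inr rfl⟩ = 0 := by
      have h4 := hw' s₀
      rw [Finset.sum_eq_single (⟨t₀, Or.inr rfl⟩ : T)] at h4
      · exact (mul_eq_zero.1 h4).resolve_right h0
      · rintro ⟨b, hb | hb⟩ _ hne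
        · rw [h1 _ hb, zero_mul]
        · exact absurd (Subtype.ext hb) hne
      · simp
    rintro ⟨t, ht | rfl⟩
    · exact h1 _ ht
    · exact h3
  have h5 := hli.rank_matrix
  rw [Matrix.rank_transpose, hcard] at h5
  have h6 := X.rank_submatrix_le id (Subtype.val : T → C)
  omega

lemma rank_le_card_of_col_eq_zero (h : ∀ s t, ¬ lab t < r → X s t = 0) :
    X.rank ≤ (Finset.univ.filter fun t => lab t < r).card := by
  rw [← Matrix.rank_transpose]
  refine Matrix.rank_le_card_of_support_subset _ _ fun t ht => ?_
  simp only [Finset.coe_filter, Finset.mem_univ, true_and, mem_ofPred_eq]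
  by_contra hc
  exact ht (funext fun s => h s t hc)

end Wedge

/-! ### Splitting the determinant of one block into differences and a normal factor. -/

section Tail

variable {R C : Type*} [Fintype R] [DecidableEq R] [Fintype C] [DecidableEq C] {r : ℕ}
  {labR : R → ℕ} {labC : C → ℕ} {x : Fin r → ℝ} {ν : ℝ} {X : Matrix R C ℝ}

/-- The part of `X` with labels larger than `i`. -/
def tail (labR : R → ℕ) (labC : C → ℕ) (i : ℕ) (X : Matrix R C ℝ) :
    Matrix {s // i < labR s} {t // i < labC t} ℝ :=
  X.submatrix Subtype.val Subtype.val

/-- The part of `X` with labels at least `r`. -/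
def corner (labR : R → ℕ) (labC : C → ℕ) (r : ℕ) (X : Matrix R C ℝ) :
    Matrix {s // r ≤ labR s} {t // r ≤ labC t} ℝ :=
  X.submatrix Subtype.val Subtype.val

/-- The rows of `X` with label `< r` are orthogonal to all others, of length `x (label)`, and the
entries vanish unless their labels are equal or both at least `r`. -/
structure IsBlock (labR : R → ℕ) (labC : C → ℕ) (x : Fin r → ℝ) (X : Matrix R C ℝ) : Prop where
  gram : ∀ s t (h : labR s < r), (X * Xᵀ) s t = if s = t then x ⟨labR s, h⟩ ^ 2 else 0
  eq_zero : ∀ s t, labR s < r ∨ labC t < r → labR s ≠ labC t → X s t = 0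

lemma IsBlock.tail_mul_transpose (hX : IsBlock labR labC x X) (i : Fin r)
    (s t : {s // (i : ℕ) < labR s}) :
    (tail labR labC i X * (tail labR labC i X)ᵀ) s t = (X * Xᵀ) s t := by
  rw [Matrix.mul_apply, Matrix.mul_apply]
  refine Fintype.sum_of_injective Subtype.val Subtype.val_injective _ _ (fun k hk => ?_)
    fun k => rfl
  have h1 : ¬ (i : ℕ) < labC k := fun h => hk ⟨⟨k, h⟩, rfl⟩
  have h2 := s.2
  rw [hX.eq_zero s k (Or.inr (by omega)) (by omega), zero_mul]

lemma IsBlock.corner_mul_transpose (hX : IsBlock labR labC x X)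
    (s t : {s // r ≤ labR s}) :
    (corner labR labC r X * (corner labR labC r X)ᵀ) s t = (X * Xᵀ) s t := by
  rw [Matrix.mul_apply, Matrix.mul_apply]
  refine Fintype.sum_of_injective Subtype.val Subtype.val_injective _ _ (fun k hk => ?_)
    fun k => rfl
  have h1 : ¬ r ≤ labC k := fun h => hk ⟨⟨k, h⟩, rfl⟩
  have h2 := s.2
  rw [hX.eq_zero s k (Or.inr (by omega)) (by omega), zero_mul]

/-- Deleting the columns of small label does not change the row Gram entries concerned. Rows with
label below `r` are orthogonal to all others, so the matrix is block triangular with a diagonal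
first block. -/
lemma IsBlock.det_tail (hX : IsBlock labR labC x X) (i : Fin r) (y : ℝ) :
    (y • (1 : Matrix {s // (i : ℕ) < labR s} _ ℝ)
        - tail labR labC i X * (tail labR labC i X)ᵀ).det
      = (∏ s : {s : {s // (i : ℕ) < labR s} // labR s < r}, (y - x ⟨labR s, s.2⟩ ^ 2)) *
        (y • (1 : Matrix {s // r ≤ labR s} _ ℝ)
          - corner labR labC r X * (corner labR labC r X)ᵀ).det := by
  have hent : ∀ s t, (y • 1 - tail labR labC i X * (tail labR labC i X)ᵀ :
        Matrix {s // (i : ℕ) < labR s} {s // (i : ℕ) < labR s} ℝ) s t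
      = (if s = t then y else 0) - (X * Xᵀ) s t := fun s t => by
    rw [Matrix.sub_apply, hX.tail_mul_transpose]
    simp [Matrix.one_apply]
  have hsymm : ∀ s t, (X * Xᵀ) s t = (X * Xᵀ) t s := fun s t => by
    simp [Matrix.mul_apply, mul_comm]
  rw [Matrix.twoBlockTriangular_det _ (fun s => labR s.1 < r)]
  swap
  · intro s hs t ht
    have hne : s.1 ≠ t.1 := fun h => hs (by rw [h]; exact ht)
    rw [hent, hsymm, hX.gram _ _ ht, if_neg hne.symm, if_neg (fun h => hne (congrArg _ h)),
      sub_zero]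
  congr 1
  · rw [← Matrix.det_diagonal]
    congr 1
    ext s t
    rw [Matrix.toSquareBlockProp_def, Matrix.of_apply, hent, hX.gram _ _ s.2,
      Matrix.diagonal_apply]
    by_cases hst : s = t
    · subst hst; simp
    · have h1 : s.1 ≠ t.1 := fun h => hst (Subtype.ext h)
      have h2 : s.1.1 ≠ t.1.1 := fun h => h1 (Subtype.ext h)
      rw [if_neg h1, if_neg h2, if_neg hst, sub_zero]
  · let e : {s // r ≤ labR s} ≃ {s : {s // (i : ℕ) < labR s} // ¬ labR s.1 < r} :=
      { toFun := fun s => ⟨⟨s.1, i.2.trans_le s.2⟩, not_lt.2 s.2⟩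
        invFun := fun s => ⟨s.1.1, not_lt.1 s.2⟩
        left_inv := fun s => rfl
        right_inv := fun s => rfl }
    rw [← Matrix.det_submatrix_equiv_self e]
    congr 1
    ext s t
    rw [Matrix.submatrix_apply, Matrix.toSquareBlockProp_def, Matrix.of_apply, hent,
      Matrix.sub_apply, hX.corner_mul_transpose]
    simp [Matrix.one_apply, e, Subtype.ext_iff]

end Tail

section Rotations

/-! ### Exponentials of skew-symmetric matrices -/

variable {n : Type*} [Fintype n] [DecidableEq n]

/-- The determinant is the square of that of exp(A/2), which is itself orthogonal, hence it is 1. -/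
lemma exp_mem_specialOrthogonalGroup {A : Matrix n n ℝ} (hA : Aᵀ = -A) :
    NormedSpace.exp A ∈ Matrix.specialOrthogonalGroup n ℝ := by
  have horth : ∀ B : Matrix n n ℝ, Bᵀ = -B →
      NormedSpace.exp B ∈ Matrix.orthogonalGroup n ℝ := by
    intro B hB
    rw [Matrix.mem_orthogonalGroup_iff]
    change NormedSpace.exp B * (NormedSpace.exp B)ᵀ = 1
    rw [← Matrix.exp_transpose, hB, Matrix.exp_neg]
    exact Matrix.mul_nonsing_inv _ ((Matrix.isUnit_iff_isUnit_det _).1 (Matrix.isUnit_exp B))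
  rw [Matrix.mem_specialOrthogonalGroup_iff]
  refine ⟨horth A hA, ?_⟩
  let B : Matrix n n ℝ := (1 / 2 : ℝ) • A
  have hB : Bᵀ = -B := by simp [B, Matrix.transpose_smul, hA]
  have hBA : A = B + B := by
    ext i j
    simp [B]
    ring
  have hd : (NormedSpace.exp B).det * (NormedSpace.exp B).det = 1 := by
    have h1 := (Matrix.mem_orthogonalGroup_iff _ _).1 (horth B hB)
    have h2 := congrArg Matrix.det h1
    rw [Matrix.det_mul, Matrix.det_one] at h2
    rw [← h2]
    congr 1
    exact (Matrix.det_transpose _).symm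
  rw [hBA, Matrix.exp_add_of_commute _ _ (Commute.refl B), Matrix.det_mul, hd]

-- A normed algebra structure is needed only to differentiate the exponential at 0. The entrywise
-- form of the result leaves no trace of the chosen norm.
attribute [local instance] Matrix.linftyOpNormedAddCommGroup Matrix.linftyOpNormedSpace
  Matrix.linftyOpNormedRing Matrix.linftyOpNormedAlgebra in
lemma hasStrictFDerivAt_exp_entry {E : Type*} [NormedAddCommGroup E] [NormedSpace ℝ E]
    [FiniteDimensional ℝ E] (L : E →ₗ[ℝ] Matrix n n ℝ) (i j : n) :
    HasStrictFDerivAt (fun ξ => NormedSpace.exp (L ξ) i j)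
      (LinearMap.toContinuousLinearMap (Matrix.entryLinearMap ℝ ℝ i j ∘ₗ L)) 0 := by
  have h1 : HasStrictFDerivAt (fun ξ => L ξ) (LinearMap.toContinuousLinearMap L) 0 :=
    (LinearMap.toContinuousLinearMap L).hasStrictFDerivAt
  have h2 : HasStrictFDerivAt (NormedSpace.exp : Matrix n n ℝ → Matrix n n ℝ)
      (1 : Matrix n n ℝ →L[ℝ] Matrix n n ℝ) (L 0) := by
    rw [map_zero]
    exact hasStrictFDerivAt_exp_zero
  have h3 : HasStrictFDerivAt (fun A : Matrix n n ℝ => A i j)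
      (LinearMap.toContinuousLinearMap (Matrix.entryLinearMap ℝ ℝ i j)) (NormedSpace.exp (L 0)) :=
    (LinearMap.toContinuousLinearMap (Matrix.entryLinearMap ℝ ℝ i j)).hasStrictFDerivAt
  refine (HasStrictFDerivAt.comp 0 h3 (HasStrictFDerivAt.comp 0 h2 h1)).congr_fderiv ?_
  ext
  rfl

end Rotations

/-! ### The derivative of the action of exponentials. -/

section Action

variable {I J R C : Type*} [Fintype I] [Fintype J] [Fintype R] [DecidableEq R] [Fintype C]
  [DecidableEq C]

lemma hasStrictFDerivAt_exp_action (toM : EuclideanSpace ℝ I →ₗ[ℝ] Matrix R C ℝ)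
    (LA : (J → ℝ) →ₗ[ℝ] Matrix R R ℝ) (LB : (J → ℝ) →ₗ[ℝ] Matrix C C ℝ) (s : R) (t : C)
    (X : EuclideanSpace ℝ I) (L : (J → ℝ) × EuclideanSpace ℝ I →L[ℝ] ℝ)
    (hL : ∀ ξ Y, L (ξ, Y) = (LA ξ * toM X + toM X * (LB ξ)ᵀ + toM Y) s t) :
    HasStrictFDerivAt (fun z : (J → ℝ) × EuclideanSpace ℝ I =>
      (NormedSpace.exp (LA z.1) * toM z.2 * (NormedSpace.exp (LB z.1))ᵀ) s t) L (0, X) := by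
  have hP : ∀ k, HasStrictFDerivAt
      (fun z : (J → ℝ) × EuclideanSpace ℝ I => NormedSpace.exp (LA z.1) s k) _ (0, X) := fun k =>
    HasStrictFDerivAt.comp (0, X) (f := Prod.fst) (hasStrictFDerivAt_exp_entry LA s k)
      hasStrictFDerivAt_fst
  have hQ : ∀ k, HasStrictFDerivAt
      (fun z : (J → ℝ) × EuclideanSpace ℝ I => NormedSpace.exp (LB z.1) t k) _ (0, X) := fun k =>
    HasStrictFDerivAt.comp (0, X) (f := Prod.fst) (hasStrictFDerivAt_exp_entry LB t k)
      hasStrictFDerivAt_fst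
  have hX : ∀ k l, HasStrictFDerivAt
      (fun z : (J → ℝ) × EuclideanSpace ℝ I => toM z.2 k l) _ (0, X) := fun k l =>
    HasStrictFDerivAt.comp (0, X) (f := Prod.snd)
      (LinearMap.toContinuousLinearMap (Matrix.entryLinearMap ℝ ℝ k l ∘ₗ toM)).hasStrictFDerivAt
      hasStrictFDerivAt_snd
  have h := HasStrictFDerivAt.fun_sum (u := Finset.univ) fun l _ =>
    (HasStrictFDerivAt.fun_sum (u := Finset.univ) fun k _ => (hP k).mul (hX k l)).mul (hQ l)
  refine (h.congr_of_eventuallyEq (.of_forall fun z => ?_)).congr_fderiv ?_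
  · simp [Matrix.mul_apply]
  · refine ContinuousLinearMap.ext fun z => ?_
    obtain ⟨ξ, Y⟩ := z
    rw [hL]
    simp only [map_zero, NormedSpace.exp_zero, Matrix.add_apply, Matrix.mul_apply,
      Matrix.transpose_apply]
    simp [Matrix.one_apply, Finset.sum_add_distrib, mul_comm]
    ring

end Action

/-! ### Matrix models and the primary weight in terms of determinants. -/

variable {I : Type*} [Fintype I] {r : ℕ}

/-- Index set of the infinitesimal rotations: `ξ (i, s)`, `ξ (i, t)` rotate the coordinates with
label `i` into the row `s`, the column `t` of larger label. -/
abbrev RotIndex {R C : Type*} (labR : R → ℕ) (labC : C → ℕ) (r : ℕ) :=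
  Σ i : Fin r, {s : R // (i : ℕ) < labR s} ⊕ {t : C // (i : ℕ) < labC t}

/-- The matrix of the infinitesimal action at the matrix `X` with leading singular values `x`. -/
def rotMatrix {R C : Type*} [DecidableEq R] [DecidableEq C] (labR : R → ℕ) (labC : C → ℕ)
    (x : Fin r → ℝ) (X : Matrix R C ℝ) :
    Matrix (RotIndex labR labC r) (RotIndex labR labC r) ℝ :=
  Matrix.blockDiagonal' fun i : Fin r => Matrix.fromBlocks (x i • 1) (-tail labR labC i X)
    (-(tail labR labC i X)ᵀ) (x i • 1)

/-- A realization of the ambient space by matrices on which the rotations act by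
`X ↦ P X Qᵀ`. -/
structure Model (D : Data (EuclideanSpace ℝ I) r) (R C : Type*) [Fintype R] [DecidableEq R]
    [Fintype C] [DecidableEq C] where
  toM : EuclideanSpace ℝ I →ₗ[ℝ] Matrix R C ℝ
  row : I → R
  col : I → C
  labR : R → ℕ
  labC : C → ℕ
  LA : (RotIndex labR labC r → ℝ) →ₗ[ℝ] Matrix R R ℝ
  LB : (RotIndex labR labC r → ℝ) →ₗ[ℝ] Matrix C C ℝ
  σ : (RotIndex labR labC r → ℝ) →ₗ[ℝ] EuclideanSpace ℝ I
  isOrtho : D.IsOrtho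
  toM_row_col : ∀ X i, toM X (row i) (col i) = X i
  exp_mem : ∀ ξ, (fun X => WithLp.toLp 2 fun i => (NormedSpace.exp (LA ξ) * toM X *
    (NormedSpace.exp (LB ξ))ᵀ) (row i) (col i)) ∈ D.rotations
  exists_rot : ∀ φ ∈ D.rotations, ∃ P ∈ Matrix.orthogonalGroup R ℝ,
    ∃ Q ∈ Matrix.orthogonalGroup C ℝ, ∀ X, toM (φ X) = P * toM X * Qᵀ
  σ_injective : Function.Injective σ
  range_σ : LinearMap.range σ = D.spanᗮ
  action_eq : ∀ x, ∀ N ∈ D.K, ∀ ξ i,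
    (LA ξ * toM (D.M x + N) + toM (D.M x + N) * (LB ξ)ᵀ) (row i) (col i)
      = σ (rotMatrix labR labC x (toM (D.M x + N)) *ᵥ ξ) i
  isWedge : ∀ x, ∀ N ∈ D.K, IsWedge labC x ‖N‖ (toM (D.M x + N))
  isBlock : ∀ x, ∀ N ∈ D.K, IsBlock labR labC x (toM (D.M x + N))
  exists_labC : ∀ j : Fin r, ∃ t, labC t = j
  toM_M : ∀ a x, (∀ i, 0 < x i) → ∀ N ∈ D.K, toM (D.M a) = toM (D.M x + N) *
    Matrix.diagonal fun s => if h : labC s < r then a ⟨labC s, h⟩ / x ⟨labC s, h⟩ else 0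
  exists_entry_ne_zero : ∀ x, ∀ N ∈ D.K, N ≠ 0 → ∃ s t, ¬ labC t < r ∧ toM (D.M x + N) s t ≠ 0
  mem_cone : ∀ X, X ∈ D.cone ↔ (toM X).rank ≤ (Finset.univ.filter fun t => labC t < r).card

namespace Model

variable {D : Data (EuclideanSpace ℝ I) r} {R C : Type*} [Fintype R] [DecidableEq R]
    [Fintype C] [DecidableEq C] (T : Model D R C)

include T in
lemma wellDefined : D.WellDefined := by
  rintro a φ hφ ψ hψ _ ⟨x, hx, N, hN, hlt, rfl⟩ _ ⟨x', hx', N', hN', hlt', rfl⟩ h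
  obtain ⟨P, hP, Q, hQ, hφ⟩ := T.exists_rot φ hφ
  obtain ⟨P', hP', Q', hQ', hψ⟩ := T.exists_rot ψ hψ
  have h1 := congrArg T.toM h
  rw [hφ, hψ] at h1
  have h2 := (T.isWedge x N hN).orbit_map_eq (T.isWedge x' N' hN') (norm_nonneg _)
    (norm_nonneg _) hx hx' hlt hlt' T.exists_labC (T.toM_M a x hx.2 N hN)
    (T.toM_M a x' hx'.2 N' hN') hP hP' hQ hQ' h1
  rw [← hφ, ← hψ] at h2
  ext i
  rw [← T.toM_row_col, h2, T.toM_row_col]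

lemma toM_M_eq_zero {x : Fin r → ℝ} (hx : ∀ i, 0 < x i) (s : R) (t : C) (ht : ¬ T.labC t < r) :
    T.toM (D.M x) s t = 0 := by
  rw [T.toM_M x x hx 0 D.K.zero_mem, Matrix.mul_diagonal, dif_neg ht, mul_zero]

include T in
lemma coneSpec : D.ConeSpec := by
  intro x hx N hN
  rw [T.mem_cone]
  constructor
  · intro h
    by_contra hN0
    obtain ⟨s, t, ht, h0⟩ := T.exists_entry_ne_zero x N hN hN0
    exact absurd h (not_le.2 ((T.isWedge x N hN).card_lt_rank hx.2 ht h0))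
  · rintro rfl
    rw [add_zero]
    exact rank_le_card_of_col_eq_zero (T.toM_M_eq_zero hx.2)

/-- The chart of rotations by exponentials. -/
def chart : D.Chart (RotIndex T.labR T.labC r) where
  Φ ξ X := WithLp.toLp 2 fun i => (NormedSpace.exp (T.LA ξ) * T.toM X *
    (NormedSpace.exp (T.LB ξ))ᵀ) (T.row i) (T.col i)
  ρ X := LinearMap.toContinuousLinearMap
    { toFun := fun ξ => WithLp.toLp 2 fun i =>
        (T.LA ξ * T.toM X + T.toM X * (T.LB ξ)ᵀ) (T.row i) (T.col i)
      map_add' := fun ξ η => by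
        ext i
        simp [Matrix.add_mul, Matrix.mul_add]
        ring
      map_smul' := fun c ξ => by
        ext i
        simp [mul_add] }
  σ := T.σ
  B X := rotMatrix T.labR T.labC (fun i => inner ℝ (D.e i) X) (T.toM X)
  Φ_mem := T.exp_mem
  Φ_zero X := by
    ext i
    simp [T.toM_row_col]
  hasStrictFDerivAt X := by
    rw [hasStrictFDerivAt_euclidean]
    intro i
    refine hasStrictFDerivAt_exp_action T.toM T.LA T.LB (T.row i) (T.col i) X _ fun ξ Y => ?_
    simp [T.toM_row_col]
  σ_injective := T.σ_injective
  range_σ := T.range_σ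
  ρ_eq X hX ξ := by
    obtain ⟨x, N, hN, rfl⟩ := Data.exists_eq_of_mem_span hX
    ext i
    simp only [T.isOrtho.inner_e_add _ x hN]
    exact T.action_eq x N hN ξ i

/-- The determinant which governs the dependence of the primary weight on the normal part. -/
def normalDet (x : Fin r → ℝ) (N : EuclideanSpace ℝ I) (i : Fin r) : ℝ :=
  (x i ^ 2 • (1 : Matrix {s // r ≤ T.labR s} _ ℝ) -
    corner T.labR T.labC r (T.toM (D.M x + N)) * (corner T.labR T.labC r (T.toM (D.M x + N)))ᵀ).det

/-- The number of rows beyond the first ones. -/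
def normalRows : ℕ := Fintype.card {s // r ≤ T.labR s}

lemma normalDet_zero {x : Fin r → ℝ} (hx : ∀ i, 0 < x i) (i : Fin r) :
    T.normalDet x 0 i = x i ^ (2 * T.normalRows) := by
  have h : corner T.labR T.labC r (T.toM (D.M x)) = 0 := by
    ext s t
    exact T.toM_M_eq_zero hx s t (not_lt.2 t.2)
  rw [normalDet, add_zero, h]
  simp [normalRows, pow_mul]

/-- The product of the differences `xᵢ² - xⱼ²` over the rows with labels `j > i`. -/
def vandermonde (x : Fin r → ℝ) (i : Fin r) : ℝ :=
  ∏ s : {s : {s // (i : ℕ) < T.labR s} // T.labR s < r}, (x i ^ 2 - x ⟨T.labR s, s.2⟩ ^ 2)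

lemma vandermonde_pos {x : Fin r → ℝ} (hx : x ∈ chamber r) (i : Fin r) : 0 < T.vandermonde x i := by
  refine Finset.prod_pos fun s _ => ?_
  have h1 : x ⟨T.labR s, s.2⟩ < x i := hx.1 s.1.2
  have h2 := hx.2 ⟨T.labR s, s.2⟩
  rw [sub_pos]
  gcongr

/-- Along a secondary slicing set all squares are shifted by the same amount `t = |N|²`, so their
differences are constant there. -/
lemma vandermonde_eq {x c : Fin r → ℝ} {t : ℝ} (h : ∀ i, x i ^ 2 = c i ^ 2 + t) (i : Fin r) :
    T.vandermonde x i = T.vandermonde c i := by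
  refine Finset.prod_congr rfl fun s _ => ?_
  rw [h, h]; ring

variable {k : ℕ}

/-- Beyond every label there are `k` more columns than rows. -/
def ColExcess (k : ℕ) : Prop := ∀ i : Fin r,
  Fintype.card {t // (i : ℕ) < T.labC t} = Fintype.card {s // (i : ℕ) < T.labR s} + k

/-- One block per wedge coordinate: the Schur complement yields the power of `x i`, and
`IsBlock.det_tail` the other two factors. -/
lemma det_chart_B (hk : T.ColExcess k) {x : Fin r → ℝ} (hx : x ∈ chamber r)
    {N : EuclideanSpace ℝ I} (hN : N ∈ D.K) : (T.chart.B (D.M x + N)).det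
      = ∏ i, (x i ^ k * (T.vandermonde x i * T.normalDet x N i)) := by
  have h1 : T.chart.B (D.M x + N) = rotMatrix T.labR T.labC x (T.toM (D.M x + N)) := by
    simp only [chart, T.isOrtho.inner_e_add _ x hN]
  rw [h1, rotMatrix, det_blockDiagonal'_eq]
  refine Finset.prod_congr rfl fun i _ => ?_
  rw [det_fromBlocks_smul_one (hx.2 i) _ (by rw [hk i]; omega), hk i, Nat.add_sub_cancel_left,
    (T.isBlock x N hN).det_tail]
  rfl

lemma w₁_eq (hk : T.ColExcess k) {a x : Fin r → ℝ} (hx : x ∈ chamber r)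
    {N : EuclideanSpace ℝ I} (hN : N ∈ D.K) (hlt : ∀ i, ‖N‖ < x i)
    (hpos : ∀ i, 0 < T.normalDet x N i) :
    D.w₁ a (D.M x + N) = (∏ i, (x i ^ k * (T.vandermonde x i * T.normalDet x N i))) /
      |(T.chart.B (D.M a)).det| := by
  have hdet : 0 < (T.chart.B (D.M x + N)).det := by
    rw [T.det_chart_B hk hx hN]
    exact Finset.prod_pos fun i _ =>
      mul_pos (pow_pos (hx.2 i) _) (mul_pos (T.vandermonde_pos hx i) (hpos i))
  rw [T.chart.w₁_eq T.isOrtho T.wellDefined a ⟨x, hx, N, hN, hlt, rfl⟩ hdet.ne', abs_of_pos hdet,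
    T.det_chart_B hk hx hN]

lemma det_chart_B_M_pos (hk : T.ColExcess k) {a : Fin r → ℝ} (ha : a ∈ chamber r) :
    0 < |(T.chart.B (D.M a)).det| := by
  have := T.det_chart_B hk ha D.K.zero_mem
  rw [add_zero] at this
  rw [this]
  refine abs_pos.2 (Finset.prod_pos fun i _ =>
      mul_pos (pow_pos (ha.2 i) _) (mul_pos (T.vandermonde_pos ha i) ?_)).ne'
  rw [T.normalDet_zero ha.2]
  exact pow_pos (ha.2 i) _

/-- The constant of proportionality of the primary weight along a secondary slicing set. -/
def constant (a c : Fin r → ℝ) (b : ℕ) : ℝ :=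
  (∏ i, (T.vandermonde c i * (c i ^ 2) ^ b)) / |(T.chart.B (D.M a)).det|

lemma constant_pos (hk : T.ColExcess k) {a c : Fin r → ℝ} (ha : a ∈ chamber r)
    (hc : c ∈ chamber r) (b : ℕ) : 0 < T.constant a c b :=
  div_pos (Finset.prod_pos fun i _ => mul_pos (T.vandermonde_pos hc i)
    (pow_pos (pow_pos (hc.2 i) 2) b)) (T.det_chart_B_M_pos hk ha)

/-- The factors xᵢ² − |N|² equal cᵢ² on the slicing set and are absorbed in the constant; only the
powers of xᵢ remain variable. -/
lemma constant_mul (a : Fin r → ℝ) {x c : Fin r → ℝ} {N : EuclideanSpace ℝ I}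
    (h : ∀ i, x i ^ 2 = c i ^ 2 + ‖N‖ ^ 2) (b d : ℕ) :
    T.constant a c b * ∏ i, x i ^ (k + d)
      = (∏ i, (x i ^ k * (T.vandermonde x i * (x i ^ d * (x i ^ 2 - ‖N‖ ^ 2) ^ b)))) /
      |(T.chart.B (D.M a)).det| := by
  rw [constant, div_mul_eq_mul_div, ← Finset.prod_mul_distrib]
  congr 1
  refine Finset.prod_congr rfl fun i _ => ?_
  rw [T.vandermonde_eq h, h i, add_sub_cancel_right]
  ring

theorem weightEq (hk : T.ColExcess k) {a : Fin r → ℝ} (ha : a ∈ chamber r) {b d : ℕ}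
    (h : ∀ x ∈ chamber r, ∀ N ∈ D.K, (∀ i, ‖N‖ < x i) → ∀ i,
      T.normalDet x N i = x i ^ d * (x i ^ 2 - ‖N‖ ^ 2) ^ b) : D.WeightEq a (k + d) := by
  intro c hc
  refine ⟨T.constant a c b, T.constant_pos hk ha hc b, fun x hx N hN hlt hxc => ?_⟩
  have hpos : ∀ i, 0 < T.normalDet x N i := fun i => by
    rw [h x hx N hN hlt i, hxc, add_sub_cancel_right]
    exact mul_pos (pow_pos (hx.2 i) _) (pow_pos (pow_pos (hc.2 i) 2) b)
  rw [T.w₁_eq hk hx hN hlt hpos, T.constant_mul a hxc]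
  simp_rw [h x hx N hN hlt]

/-- The relation `hd` makes the lower bound homogeneous of the degree of `normalDet`, hence an
equality at N = 0. -/
theorem weightGE (hk : T.ColExcess k) {a : Fin r → ℝ} (ha : a ∈ chamber r) {b d : ℕ}
    (hd : 2 * T.normalRows = d + 2 * b)
    (h : ∀ x ∈ chamber r, ∀ N ∈ D.K, (∀ i, ‖N‖ < x i) → ∀ i,
      x i ^ d * (x i ^ 2 - ‖N‖ ^ 2) ^ b ≤ T.normalDet x N i) : D.WeightGE a (k + d) := by
  intro c hc
  refine ⟨T.constant a c b, T.constant_pos hk ha hc b, ?_, fun x hx N hN hlt hxc => ?_⟩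
  · have hpos : ∀ i, 0 < T.normalDet c 0 i := fun i => by
      rw [T.normalDet_zero hc.2]
      exact pow_pos (hc.2 i) _
    have h1 := T.w₁_eq hk (a := a) hc D.K.zero_mem (by simpa using hc.2) hpos
    rw [add_zero] at h1
    rw [h1, T.constant_mul a (x := c) (N := 0) (by simp)]
    congr 1
    refine Finset.prod_congr rfl fun i _ => ?_
    rw [T.normalDet_zero hc.2, hd]
    simp [pow_add, pow_mul]
  · have hpos' : ∀ i, 0 < x i ^ d * (x i ^ 2 - ‖N‖ ^ 2) ^ b := fun i => by
      rw [hxc, add_sub_cancel_right]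
      exact mul_pos (pow_pos (hx.2 i) _) (pow_pos (pow_pos (hc.2 i) 2) b)
    have hpos : ∀ i, 0 < T.normalDet x N i := fun i =>
      (hpos' i).trans_le (h x hx N hN hlt i)
    rw [T.w₁_eq hk hx hN hlt hpos, T.constant_mul a hxc]
    have hv := T.vandermonde_pos hx
    refine div_le_div_of_nonneg_right (Finset.prod_le_prod (fun i _ => ?_) fun i _ => ?_)
      (abs_nonneg _)
    · exact (mul_pos (pow_pos (hx.2 i) _) (mul_pos (hv i) (hpos' i))).le
    · have := (hx.2 i).le
      have := (hv i).le
      have := h x hx N hN hlt i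
      gcongr

end Model

/-! ### Wedges and normal spaces spanned by coordinate vectors. -/

section Coordinates

variable {I : Type*} [Fintype I] [DecidableEq I] {r : ℕ}

/-- The vectors `eᵢ` are the coordinate vectors `ι i`, and `K` is spanned by the coordinate vectors
in `S`. -/
structure IsCoordinate (D : Data (EuclideanSpace ℝ I) r) (ι : Fin r → I) (S : Set I) : Prop where
  e_eq : ∀ i, D.e i = EuclideanSpace.single (ι i) 1
  K_eq : D.K = Submodule.span ℝ {X | ∃ j ∈ S, X = EuclideanSpace.single j 1}
  injective : Function.Injective ι
  notMem : ∀ i, ι i ∉ S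

namespace IsCoordinate

variable {D : Data (EuclideanSpace ℝ I) r} {ι : Fin r → I} {S : Set I} (hD : IsCoordinate D ι S)
include hD

lemma apply_eq_zero {N : EuclideanSpace ℝ I} (hN : N ∈ D.K) {j : I} (hj : j ∉ S) : N j = 0 := by
  rw [hD.K_eq] at hN
  induction hN using Submodule.span_induction with
  | mem X hX =>
    obtain ⟨k, hk, rfl⟩ := hX
    have : j ≠ k := fun h => hj (h ▸ hk)
    simp [this]
  | zero => rfl
  | add X Y _ _ hX hY => simp [hX, hY]
  | smul c X _ hX => simp [hX]

lemma single_mem {j : I} (hj : j ∈ S) : EuclideanSpace.single j (1 : ℝ) ∈ D.K := by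
  rw [hD.K_eq]
  exact Submodule.subset_span ⟨j, hj, rfl⟩

lemma inner_e (i : Fin r) (X : EuclideanSpace ℝ I) : inner ℝ (D.e i) X = X (ι i) := by
  rw [hD.e_eq, EuclideanSpace.inner_single_left]
  simp

lemma isOrtho : D.IsOrtho where
  orthonormal := by
    rw [orthonormal_iff_ite]
    intro i j
    rw [hD.inner_e, hD.e_eq]
    simp [hD.injective.eq_iff]
  inner_eq_zero i N hN := by
    rw [hD.inner_e, hD.apply_eq_zero hN (hD.notMem i)]

lemma M_apply (x : Fin r → ℝ) (i : Fin r) : D.M x (ι i) = x i := by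
  rw [← hD.inner_e, hD.isOrtho.inner_e_M]

lemma M_apply_of_notMem (x : Fin r → ℝ) {j : I} (hj : ∀ i, ι i ≠ j) : D.M x j = 0 := by
  have : ∀ i, D.e i j = 0 := fun i => by
    rw [hD.e_eq]
    simp [(hj i).symm]
  simp [Data.M, this]

lemma mem_span_orthogonal (v : EuclideanSpace ℝ I) :
    v ∈ D.spanᗮ ↔ (∀ i, v (ι i) = 0) ∧ ∀ j ∈ S, v j = 0 := by
  constructor
  · intro hv
    rw [Submodule.mem_orthogonal] at hv
    refine ⟨fun i => ?_, fun j hj => ?_⟩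
    · rw [← hD.inner_e]
      exact hv _ (Data.e_mem_span i)
    · have := hv _ (Data.K_le_span (hD.single_mem hj))
      rw [EuclideanSpace.inner_single_left] at this
      simpa using this
  · rintro ⟨h1, h2⟩
    rw [Submodule.mem_orthogonal]
    intro u hu
    obtain ⟨x, N, hN, rfl⟩ := Data.exists_eq_of_mem_span hu
    rw [PiLp.inner_apply]
    refine Finset.sum_eq_zero fun j _ => ?_
    by_cases hj : v j = 0
    · simp [hj]
    · have h3 : j ∉ S := fun h => hj (h2 j h)
      have h4 : ∀ i, ι i ≠ j := fun i h => hj (h ▸ h1 i)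
      simp [hD.apply_eq_zero hN h3, hD.M_apply_of_notMem x h4]

end IsCoordinate

end Coordinates

/-! ### Coordinates of the infinitesimal action. -/

section RotMatrix

variable {R C : Type*} [Fintype R] [DecidableEq R] [Fintype C] [DecidableEq C] {r : ℕ}
  {labR : R → ℕ} {labC : C → ℕ} (x : Fin r → ℝ) (X : Matrix R C ℝ) (ξ : RotIndex labR labC r → ℝ)

lemma blockDiagonal'_mulVec {ι : Type*} [Fintype ι] [DecidableEq ι] {m : ι → Type*}
    [∀ i, Fintype (m i)] (A : ∀ i, Matrix (m i) (m i) ℝ) (ξ : (Σ i, m i) → ℝ) (i : ι) (a : m i) :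
    (Matrix.blockDiagonal' A *ᵥ ξ) ⟨i, a⟩ = (A i *ᵥ fun b => ξ ⟨i, b⟩) a := by
  rw [Matrix.mulVec, dotProduct, Fintype.sum_sigma, Finset.sum_eq_single i]
  · simp [Matrix.mulVec, dotProduct]
  · intro j _ hj
    refine Finset.sum_eq_zero fun b _ => ?_
    rw [Matrix.blockDiagonal'_apply_ne _ _ _ hj.symm, zero_mul]
  · simp

lemma rotMatrix_mulVec_inl (i : Fin r) (s : {s : R // (i : ℕ) < labR s}) :
    (rotMatrix labR labC x X *ᵥ ξ) ⟨i, Sum.inl s⟩ =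
      x i * ξ ⟨i, Sum.inl s⟩ - ∑ t : {t : C // (i : ℕ) < labC t}, X s t * ξ ⟨i, Sum.inr t⟩ := by
  rw [rotMatrix, blockDiagonal'_mulVec, Matrix.mulVec, dotProduct, Fintype.sum_sum_type]
  simp [tail, Matrix.one_apply, sub_eq_add_neg]

lemma rotMatrix_mulVec_inr (i : Fin r) (t : {t : C // (i : ℕ) < labC t}) :
    (rotMatrix labR labC x X *ᵥ ξ) ⟨i, Sum.inr t⟩ =
      x i * ξ ⟨i, Sum.inr t⟩ - ∑ s : {s : R // (i : ℕ) < labR s}, X s t * ξ ⟨i, Sum.inl s⟩ := by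
  rw [rotMatrix, blockDiagonal'_mulVec, Matrix.mulVec, dotProduct, Fintype.sum_sum_type]
  simp [tail, Matrix.one_apply, sub_eq_add_neg, add_comm]

end RotMatrix

/-! ### Bounds for the normal factor of a rectangular matrix. -/

section NormalDet

variable {n k : Type*} [Fintype n] [DecidableEq n] [Fintype k]

lemma pow_mul_le_det (A : Matrix n k ℝ) {x τ : ℝ} (hx : 0 < x) (hτ : (A * Aᵀ).trace = τ)
    (hle : τ ≤ x ^ 2) {d : ℕ} (hd : 2 * Fintype.card n = d + 2) :
    x ^ d * (x ^ 2 - τ) ^ 1 ≤ (x ^ 2 • (1 : Matrix n n ℝ) - A * Aᵀ).det := by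
  have h := pow_card_mul_le_mul_det A (hτ.le.trans hle)
  rw [hτ, ← pow_mul, hd, pow_add] at h
  refine le_of_mul_le_mul_left ?_ (pow_pos hx 2)
  linarith

/-- With one row the only entry of `A * Aᵀ` is its trace, so the general lower bound becomes an
equality. -/
lemma det_eq_of_card_eq_one (A : Matrix n k ℝ) {x τ : ℝ} (hτ : (A * Aᵀ).trace = τ)
    (hn : Fintype.card n = 1) :
    (x ^ 2 • (1 : Matrix n n ℝ) - A * Aᵀ).det = x ^ 0 * (x ^ 2 - τ) ^ 1 := by
  obtain ⟨i, hi⟩ := Fintype.card_eq_one_iff.1 hn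
  have hsub : Subsingleton n := ⟨fun a b => (hi a).trans (hi b).symm⟩
  rw [Matrix.det_eq_elem_of_subsingleton _ i, ← hτ, Matrix.trace,
    Fintype.sum_eq_single i fun j hj => absurd (hi j) hj]
  simp

end NormalDet

/-! ### Determinantal varieties -/

section Determinantal

variable {p q r : ℕ}

/-- The skew-symmetric matrix with prescribed columns `i < r` below the diagonal. -/
def skewOfColumns (p r : ℕ) : ((Σ i : Fin r, {s : Fin p // (i : ℕ) < s}) → ℝ) →ₗ[ℝ]
    Matrix (Fin p) (Fin p) ℝ where
  toFun η := Matrix.of fun a b =>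
    if h : b.val < r ∧ b.val < a.val then η ⟨⟨b, h.1⟩, ⟨a, h.2⟩⟩
    else if h : a.val < r ∧ a.val < b.val then -η ⟨⟨a, h.1⟩, ⟨b, h.2⟩⟩ else 0
  map_add' η θ := by
    ext a b
    simp only [Matrix.of_apply, Matrix.add_apply, Pi.add_apply]
    split_ifs <;> ring
  map_smul' c η := by
    ext a b
    simp only [Matrix.of_apply, Matrix.smul_apply, Pi.smul_apply, smul_eq_mul, RingHom.id_apply]
    split_ifs <;> ring

variable (η : (Σ i : Fin r, {s : Fin p // (i : ℕ) < s}) → ℝ)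

lemma skewOfColumns_of_lt {a b : Fin p} (hb : b.val < r) (h : b.val < a.val) :
    skewOfColumns p r η a b = η ⟨⟨b, hb⟩, ⟨a, h⟩⟩ := dif_pos ⟨hb, h⟩

lemma skewOfColumns_of_gt {a b : Fin p} (ha : a.val < r) (h : a.val < b.val) :
    skewOfColumns p r η a b = -η ⟨⟨a, ha⟩, ⟨b, h⟩⟩ :=
  (dif_neg (by omega)).trans (dif_pos ⟨ha, h⟩)

lemma skewOfColumns_eq_zero {a b : Fin p} (h : a = b ∨ (r ≤ a.val ∧ r ≤ b.val)) :
    skewOfColumns p r η a b = 0 :=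
  (dif_neg (by rcases h with rfl | h <;> omega)).trans
    (dif_neg (by rcases h with rfl | h <;> omega))

lemma skewOfColumns_transpose : (skewOfColumns p r η)ᵀ = -skewOfColumns p r η := by
  ext a b
  rw [Matrix.transpose_apply, Matrix.neg_apply]
  rcases lt_trichotomy a.val b.val with h | h | h
  · by_cases ha : a.val < r
    · rw [skewOfColumns_of_lt η ha h, skewOfColumns_of_gt η ha h, neg_neg]
    · rw [skewOfColumns_eq_zero η (.inr (by omega)), skewOfColumns_eq_zero η (.inr (by omega)),
        neg_zero]
  · rw [skewOfColumns_eq_zero η (.inl (Fin.ext h.symm)), skewOfColumns_eq_zero η (.inl (Fin.ext h)),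
      neg_zero]
  · by_cases hb : b.val < r
    · rw [skewOfColumns_of_lt η hb h, skewOfColumns_of_gt η hb h]
    · rw [skewOfColumns_eq_zero η (.inr (by omega)), skewOfColumns_eq_zero η (.inr (by omega)),
        neg_zero]

/-- Position of the vectors `eᵢ`. -/
def diagIndex (hp : r < p) (hpq : p ≤ q) (i : Fin r) : Fin p × Fin q :=
  (⟨i, i.2.trans hp⟩, ⟨i, (i.2.trans hp).trans_le hpq⟩)

lemma determinantal_isCoordinate (hp : r < p) (hpq : p ≤ q) :
    IsCoordinate (determinantal p q r) (diagIndex hp hpq) {j | r ≤ j.1.val ∧ r ≤ j.2.val} where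
  e_eq i := by
    ext ⟨s, t⟩
    simp only [determinantal, ofMat, Matrix.of_apply, PiLp.single_apply, diagIndex,
      Prod.mk.injEq, Fin.ext_iff]
  K_eq := by
    simp only [determinantal]
    congr 1
    ext X
    constructor
    · rintro ⟨s, t, hs, ht, rfl⟩
      exact ⟨(s, t), ⟨hs, ht⟩, rfl⟩
    · rintro ⟨⟨s, t⟩, ⟨hs, ht⟩, rfl⟩
      exact ⟨s, t, hs, ht, rfl⟩
  injective i j h := by
    simp only [diagIndex, Prod.mk.injEq, Fin.mk.injEq] at h
    exact Fin.ext h.1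
  notMem i h := by
    have h1 : r ≤ (i : ℕ) := h.1
    have := i.2
    omega

section Entries

variable (hp : r < p) (hpq : p ≤ q) (x : Fin r → ℝ) {N : MatSpace p q}
  (hN : N ∈ (determinantal p q r).K)
include hp hpq hN

lemma determinantal_entry_row (s : Fin p) (t : Fin q) (hs : s.val < r) :
    toMat ((determinantal p q r).M x + N) s t = if s.val = t.val then x ⟨s, hs⟩ else 0 := by
  have hD := determinantal_isCoordinate hp hpq
  have h1 : N (s, t) = 0 := hD.apply_eq_zero hN (fun h => absurd h.1 (by simpa using hs))
  simp only [toMat, Matrix.of_apply, PiLp.add_apply, h1, add_zero]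
  split_ifs with h
  · have h2 : (s, t) = diagIndex hp hpq ⟨s, hs⟩ := Prod.ext rfl (Fin.ext h.symm)
    rw [h2, hD.M_apply]
  · refine hD.M_apply_of_notMem x fun i hi => h ?_
    have h3 := congrArg (fun z => z.1.val) hi
    have h4 := congrArg (fun z => z.2.val) hi
    simp only [diagIndex] at h3 h4
    rw [← h3, ← h4]

lemma determinantal_entry_col (s : Fin p) (t : Fin q) (ht : t.val < r) :
    toMat ((determinantal p q r).M x + N) s t = if s.val = t.val then x ⟨t, ht⟩ else 0 := by
  by_cases hs : s.val < r
  · rw [determinantal_entry_row hp hpq x hN s t hs]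
    split_ifs with h
    · congr 1; exact Fin.ext h
    · rfl
  · have hD := determinantal_isCoordinate hp hpq
    have h1 : N (s, t) = 0 := hD.apply_eq_zero hN (fun h => absurd h.2 (by simpa using ht))
    rw [if_neg (by omega)]
    simp only [toMat, Matrix.of_apply, PiLp.add_apply, h1, add_zero]
    refine hD.M_apply_of_notMem x fun i hi => hs ?_
    exact congrArg (fun z => z.1.val) hi ▸ i.2

lemma determinantal_entry_corner (s : Fin p) (t : Fin q) (hs : r ≤ s.val) :
    toMat ((determinantal p q r).M x + N) s t = N (s, t) := by
  have hD := determinantal_isCoordinate hp hpq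
  have h2 : (determinantal p q r).M x (s, t) = 0 :=
    hD.M_apply_of_notMem x fun i hi => absurd (congrArg (fun z => z.1.val) hi ▸ i.2) (not_lt.2 hs)
  simp [toMat, h2]

end Entries

end Determinantal

section Determinantal

variable {p q r : ℕ}

section Entries

variable (hp : r < p) (hpq : p ≤ q) (x : Fin r → ℝ) {N : MatSpace p q}
  (hN : N ∈ (determinantal p q r).K)
include hp hpq hN

lemma determinantal_row_sum (f : Fin q → ℝ) (s : Fin p) (hs : s.val < r) :
    ∑ k, toMat ((determinantal p q r).M x + N) s k * f k
      = x ⟨s, hs⟩ * f ⟨s, s.2.trans_le hpq⟩ := by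
  rw [Finset.sum_eq_single ⟨s, s.2.trans_le hpq⟩]
  · rw [determinantal_entry_row hp hpq x hN s _ hs, if_pos rfl]
  · intro k _ hk
    rw [determinantal_entry_row hp hpq x hN s _ hs, if_neg fun h => hk (Fin.ext h.symm), zero_mul]
  · simp

lemma determinantal_col_sum (f : Fin p → ℝ) (t : Fin q) (ht : t.val < r) :
    ∑ k, toMat ((determinantal p q r).M x + N) k t * f k
      = x ⟨t, ht⟩ * f ⟨t, ht.trans hp⟩ := by
  rw [Finset.sum_eq_single ⟨t, ht.trans hp⟩]
  · rw [determinantal_entry_col hp hpq x hN _ t ht, if_pos rfl]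
  · intro k _ hk
    rw [determinantal_entry_col hp hpq x hN _ t ht, if_neg fun h => hk (Fin.ext h), zero_mul]
  · simp

lemma determinantal_isWedge : IsWedge (fun t : Fin q => t.val) x ‖N‖
    (toMat ((determinantal p q r).M x + N)) where
  gram s t h := by
    simp only [Matrix.mul_apply, Matrix.transpose_apply]
    rw [determinantal_col_sum hp hpq x hN _ s h, determinantal_entry_row hp hpq x hN _ t h]
    simp only [Fin.ext_iff]
    split_ifs <;> ring
  norm_le u hu := by
    have h1 : ∀ s, (toMat ((determinantal p q r).M x + N) *ᵥ u) s = ∑ t, N (s, t) * u t := by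
      intro s
      rw [Matrix.mulVec, dotProduct]
      refine Finset.sum_congr rfl fun t _ => ?_
      by_cases ht : t.val < r
      · rw [hu t ht, mul_zero, mul_zero]
      · by_cases hs : s.val < r
        · rw [determinantal_entry_row hp hpq x hN s t hs, if_neg (by omega),
            (determinantal_isCoordinate hp hpq).apply_eq_zero hN
              (fun h => absurd h.1 (by simpa using hs))]
        · rw [determinantal_entry_corner hp hpq x hN s t (not_lt.1 hs)]
    have hnorm : ‖N‖ ^ 2 = ∑ s, ∑ t, N (s, t) ^ 2 := by
      rw [EuclideanSpace.real_norm_sq_eq, Fintype.sum_prod_type]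
    rw [hnorm, Finset.sum_mul, dotProduct]
    -- Cauchy–Schwarz row by row: the Hilbert–Schmidt norm dominates the operator norm.
    refine Finset.sum_le_sum fun s _ => ?_
    rw [h1, ← sq]
    refine (Finset.sum_mul_sq_le_sq_mul_sq _ _ _).trans (le_of_eq ?_)
    simp [dotProduct, sq]

lemma determinantal_isBlock : IsBlock (fun s : Fin p => s.val) (fun t : Fin q => t.val) x
    (toMat ((determinantal p q r).M x + N)) where
  gram s t h := by
    simp only [Matrix.mul_apply, Matrix.transpose_apply]
    rw [determinantal_row_sum hp hpq x hN _ s h, determinantal_entry_col hp hpq x hN t _ h]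
    simp only [Fin.ext_iff]
    by_cases hst : s.val = t.val
    · rw [if_pos hst, if_pos hst.symm]; ring
    · rw [if_neg hst, if_neg (Ne.symm hst), mul_zero]
  eq_zero s t h hne := by
    rcases h with h | h
    · rw [determinantal_entry_row hp hpq x hN s t h, if_neg hne]
    · rw [determinantal_entry_col hp hpq x hN s t h, if_neg hne]

end Entries

/-- Matrices with prescribed entries below and to the right of the first `r` diagonal entries. -/
def matOfHooks (p q r : ℕ) : (RotIndex (fun s : Fin p => s.val) (fun t : Fin q => t.val) r → ℝ)
    →ₗ[ℝ] MatSpace p q where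
  toFun ξ := WithLp.toLp 2 fun j =>
    if h : j.2.val < r ∧ j.2.val < j.1.val then ξ ⟨⟨j.2, h.1⟩, Sum.inl ⟨j.1, h.2⟩⟩
    else if h : j.1.val < r ∧ j.1.val < j.2.val then ξ ⟨⟨j.1, h.1⟩, Sum.inr ⟨j.2, h.2⟩⟩ else 0
  map_add' ξ η := by
    ext j
    simp only [PiLp.add_apply, Pi.add_apply]
    split_ifs <;> ring
  map_smul' c ξ := by
    ext j
    simp only [PiLp.smul_apply, Pi.smul_apply, smul_eq_mul, RingHom.id_apply]
    split_ifs <;> ring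

variable (ξ : RotIndex (fun s : Fin p => s.val) (fun t : Fin q => t.val) r → ℝ)

lemma matOfHooks_below {s : Fin p} {t : Fin q} (ht : t.val < r) (h : t.val < s.val) :
    matOfHooks p q r ξ (s, t) = ξ ⟨⟨t, ht⟩, Sum.inl ⟨s, h⟩⟩ := dif_pos ⟨ht, h⟩

lemma matOfHooks_right {s : Fin p} {t : Fin q} (hs : s.val < r) (h : s.val < t.val) :
    matOfHooks p q r ξ (s, t) = ξ ⟨⟨s, hs⟩, Sum.inr ⟨t, h⟩⟩ :=
  (dif_neg (by dsimp only; omega)).trans (dif_pos ⟨hs, h⟩)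

lemma matOfHooks_eq_zero {s : Fin p} {t : Fin q}
    (h : s.val = t.val ∨ (r ≤ s.val ∧ r ≤ t.val)) : matOfHooks p q r ξ (s, t) = 0 :=
  (dif_neg (by dsimp only; omega)).trans (dif_neg (by dsimp only; omega))

/-- Infinitesimal rotations of the rows. -/
def rowRotation (p q r : ℕ) :
    (RotIndex (fun s : Fin p => s.val) (fun t : Fin q => t.val) r → ℝ) →ₗ[ℝ]
      Matrix (Fin p) (Fin p) ℝ :=
  skewOfColumns p r ∘ₗ LinearMap.funLeft ℝ ℝ fun z => ⟨z.1, Sum.inl z.2⟩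

/-- Infinitesimal rotations of the columns. -/
def colRotation (p q r : ℕ) :
    (RotIndex (fun s : Fin p => s.val) (fun t : Fin q => t.val) r → ℝ) →ₗ[ℝ]
      Matrix (Fin q) (Fin q) ℝ :=
  skewOfColumns q r ∘ₗ LinearMap.funLeft ℝ ℝ fun z => ⟨z.1, Sum.inr z.2⟩

lemma rowRotation_of_lt {a b : Fin p} (hb : b.val < r) (h : b.val < a.val) :
    rowRotation p q r ξ a b = ξ ⟨⟨b, hb⟩, Sum.inl ⟨a, h⟩⟩ := skewOfColumns_of_lt _ hb h

lemma rowRotation_of_gt {a b : Fin p} (ha : a.val < r) (h : a.val < b.val) :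
    rowRotation p q r ξ a b = -ξ ⟨⟨a, ha⟩, Sum.inl ⟨b, h⟩⟩ := skewOfColumns_of_gt _ ha h

lemma colRotation_of_lt {a b : Fin q} (hb : b.val < r) (h : b.val < a.val) :
    colRotation p q r ξ a b = ξ ⟨⟨b, hb⟩, Sum.inr ⟨a, h⟩⟩ := skewOfColumns_of_lt _ hb h

lemma colRotation_of_gt {a b : Fin q} (ha : a.val < r) (h : a.val < b.val) :
    colRotation p q r ξ a b = -ξ ⟨⟨a, ha⟩, Sum.inr ⟨b, h⟩⟩ := skewOfColumns_of_gt _ ha h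

/-- At a position below the diagonal in column t < r, the row rotation meets only the entry xₜ of
that column, and the column rotation contributes, with a minus sign, the entries of the row with
labels beyond t. Positions to the right are symmetric. On the first diagonal entries and in the
corner both terms vanish. -/
lemma determinantal_action_eq (hp : r < p) (hpq : p ≤ q) (x : Fin r → ℝ) {N : MatSpace p q}
    (hN : N ∈ (determinantal p q r).K) (s : Fin p) (t : Fin q) :
    (rowRotation p q r ξ * toMat ((determinantal p q r).M x + N)
        + toMat ((determinantal p q r).M x + N) * (colRotation p q r ξ)ᵀ) s t
      = matOfHooks p q r (rotMatrix _ _ x (toMat ((determinantal p q r).M x + N)) *ᵥ ξ) (s, t) := by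
  have hrow := determinantal_entry_row hp hpq x hN
  have hcol := determinantal_entry_col hp hpq x hN
  have hrowsum := determinantal_row_sum hp hpq x hN
  have hcolsum := determinantal_col_sum hp hpq x hN
  set X := toMat ((determinantal p q r).M x + N)
  have hA : (rowRotation p q r ξ * X) s t = ∑ k, X k t * rowRotation p q r ξ s k := by
    rw [Matrix.mul_apply]
    exact Finset.sum_congr rfl fun _ _ => mul_comm _ _
  have hB : (X * (colRotation p q r ξ)ᵀ) s t = ∑ k, X s k * colRotation p q r ξ t k := rfl
  rw [Matrix.add_apply, hA, hB]
  by_cases h1 : t.val < r ∧ t.val < s.val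
  · rw [matOfHooks_below _ h1.1 h1.2, rotMatrix_mulVec_inl, hcolsum _ t h1.1, sub_eq_add_neg,
      ← Finset.sum_neg_distrib]
    congr 1
    · congr 1
      exact rowRotation_of_lt ξ (b := ⟨t, h1.1.trans hp⟩) h1.1 h1.2
    · symm
      refine Fintype.sum_of_injective Subtype.val Subtype.val_injective _ _ (fun k hk => ?_)
        fun k => ?_
      · have hk' : ¬ t.val < k.val := fun h => hk ⟨⟨k, h⟩, rfl⟩
        rcases eq_or_ne k t with rfl | hne
        · rw [colRotation, LinearMap.comp_apply, skewOfColumns_eq_zero _ (.inl rfl), mul_zero]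
        · rw [hcol s k (by omega), if_neg (by omega), zero_mul]
      · rw [← mul_neg]
        congr 1
        exact (colRotation_of_gt ξ h1.1 k.2).symm
  by_cases h2 : s.val < r ∧ s.val < t.val
  · rw [matOfHooks_right _ h2.1 h2.2, rotMatrix_mulVec_inr, hrowsum _ s h2.1, sub_eq_add_neg,
      ← Finset.sum_neg_distrib, add_comm]
    congr 1
    · congr 1
      exact colRotation_of_lt ξ (b := ⟨s, s.2.trans_le hpq⟩) h2.1 h2.2
    · symm
      refine Fintype.sum_of_injective Subtype.val Subtype.val_injective _ _ (fun k hk => ?_)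
        fun k => ?_
      · have hk' : ¬ s.val < k.val := fun h => hk ⟨⟨k, h⟩, rfl⟩
        rcases eq_or_ne s k with rfl | hne
        · rw [rowRotation, LinearMap.comp_apply, skewOfColumns_eq_zero _ (.inl rfl), mul_zero]
        · rw [hrow k t (by omega), if_neg (by omega), zero_mul]
      · rw [← mul_neg]
        congr 1
        exact (rowRotation_of_gt ξ h2.1 k.2).symm
  · rw [matOfHooks_eq_zero _ (by omega)]
    by_cases ht : t.val < r
    · have hst : s.val = t.val := by omega
      rw [hcolsum _ t ht, hrowsum _ s (by omega)]
      have e1 : rowRotation p q r ξ s ⟨t, ht.trans hp⟩ = 0 :=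
        skewOfColumns_eq_zero _ (.inl (Fin.ext hst))
      have e2 : colRotation p q r ξ t ⟨s, s.2.trans_le hpq⟩ = 0 :=
        skewOfColumns_eq_zero _ (.inl (Fin.ext hst.symm))
      rw [e1, e2]
      simp
    · rw [Finset.sum_eq_zero, Finset.sum_eq_zero, add_zero]
      · intro k _
        by_cases hk : k.val < r
        · rw [hcol s k hk, if_neg (by omega), zero_mul]
        · rw [colRotation, LinearMap.comp_apply, skewOfColumns_eq_zero _ (.inr (by omega)), mul_zero]
      · intro k _
        by_cases hk : k.val < r
        · rw [hrow k t hk, if_neg (by omega), zero_mul]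
        · rw [rowRotation, LinearMap.comp_apply, skewOfColumns_eq_zero _ (.inr (by omega)), mul_zero]

lemma card_filter_val_lt {n m : ℕ} (h : m ≤ n) :
    (Finset.univ.filter fun t : Fin n => t.val < m).card = m := by
  rw [Fin.card_filter_val_lt, min_eq_right h]

/-- The matrix model of the determinantal slicing. -/
def determinantalModel (hp : r < p) (hpq : p ≤ q) :
    Model (determinantal p q r) (Fin p) (Fin q) where
  toM :=
    { toFun := toMat
      map_add' := fun X Y => rfl
      map_smul' := fun c X => rfl }
  row j := j.1
  col j := j.2
  labR s := s.val
  labC t := t.val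
  LA := rowRotation p q r
  LB := colRotation p q r
  σ := matOfHooks p q r
  isOrtho := (determinantal_isCoordinate hp hpq).isOrtho
  toM_row_col X j := rfl
  exp_mem ξ := ⟨_, exp_mem_specialOrthogonalGroup (skewOfColumns_transpose _), _,
    exp_mem_specialOrthogonalGroup (skewOfColumns_transpose _), rfl⟩
  exists_rot := by
    rintro φ ⟨P, hP, Q, hQ, rfl⟩
    exact ⟨P, (Matrix.mem_specialOrthogonalGroup_iff.1 hP).1, Q,
      (Matrix.mem_specialOrthogonalGroup_iff.1 hQ).1, fun X => rfl⟩
  σ_injective := by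
    intro ξ η h
    have h' : ∀ s t, matOfHooks p q r ξ (s, t) = matOfHooks p q r η (s, t) := fun s t => by rw [h]
    funext z
    rcases z with ⟨i, ⟨s, hs⟩ | ⟨t, ht⟩⟩
    · have := h' s ⟨i, (i.2.trans hp).trans_le hpq⟩
      rwa [matOfHooks_below (t := ⟨i, (i.2.trans hp).trans_le hpq⟩) _ i.2 hs,
        matOfHooks_below (t := ⟨i, (i.2.trans hp).trans_le hpq⟩) _ i.2 hs] at this
    · have := h' ⟨i, i.2.trans hp⟩ t
      rwa [matOfHooks_right (s := ⟨i, i.2.trans hp⟩) _ i.2 ht,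
        matOfHooks_right (s := ⟨i, i.2.trans hp⟩) _ i.2 ht] at this
  range_σ := by
    ext v
    rw [(determinantal_isCoordinate hp hpq).mem_span_orthogonal]
    constructor
    · rintro ⟨ξ, rfl⟩
      exact ⟨fun i => matOfHooks_eq_zero ξ (.inl rfl), fun j hj => matOfHooks_eq_zero ξ (.inr hj)⟩
    · rintro ⟨h1, h2⟩
      refine ⟨fun z => Sum.elim (fun s => v (s.1, ⟨z.1, (z.1.2.trans hp).trans_le hpq⟩))
        (fun t => v (⟨z.1, z.1.2.trans hp⟩, t.1)) z.2, ?_⟩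
      ext ⟨s, t⟩
      by_cases h3 : t.val < r ∧ t.val < s.val
      · rw [matOfHooks_below _ h3.1 h3.2]; rfl
      by_cases h4 : s.val < r ∧ s.val < t.val
      · rw [matOfHooks_right _ h4.1 h4.2]; rfl
      rw [matOfHooks_eq_zero _ (by omega)]
      by_cases ht : t.val < r
      · have hst : (s, t) = diagIndex hp hpq ⟨t, ht⟩ := Prod.ext (Fin.ext (by
          simp only [diagIndex]; omega)) rfl
        rw [hst, h1]
      · rw [h2 (s, t) ⟨by dsimp only; omega, by dsimp only; omega⟩]
  action_eq x N hN ξ j := determinantal_action_eq ξ hp hpq x hN j.1 j.2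
  isWedge x N hN := determinantal_isWedge hp hpq x hN
  isBlock x N hN := determinantal_isBlock hp hpq x hN
  exists_labC j := ⟨⟨j, (j.2.trans hp).trans_le hpq⟩, rfl⟩
  toM_M a x hx N hN := by
    ext s t
    rw [Matrix.mul_diagonal]
    have h0 := (determinantal p q r).K.zero_mem
    have hMa : toMat ((determinantal p q r).M a) = toMat ((determinantal p q r).M a + 0) := by
      rw [add_zero]
    change toMat ((determinantal p q r).M a) s t
      = toMat ((determinantal p q r).M x + N) s t * _
    rw [hMa]
    by_cases ht : t.val < r
    · rw [determinantal_entry_col hp hpq a h0 s t ht, determinantal_entry_col hp hpq x hN s t ht,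
        dif_pos ht]
      have := (hx ⟨t, ht⟩).ne'
      split_ifs
      · field_simp
      · rw [zero_mul]
    · rw [dif_neg ht, mul_zero]
      by_cases hs : s.val < r
      · rw [determinantal_entry_row hp hpq a h0 s t hs, if_neg (by omega)]
      · rw [determinantal_entry_corner hp hpq a h0 s t (not_lt.1 hs)]; rfl
  exists_entry_ne_zero x N hN hN0 := by
    obtain ⟨⟨s, t⟩, hst⟩ : ∃ j, N j ≠ 0 := by
      by_contra! h
      exact hN0 (by ext j; exact h j)
    have h1 : r ≤ s.val ∧ r ≤ t.val := by
      by_contra h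
      exact hst ((determinantal_isCoordinate hp hpq).apply_eq_zero hN h)
    refine ⟨s, t, not_lt.2 h1.2, ?_⟩
    change toMat ((determinantal p q r).M x + N) s t ≠ 0
    rwa [determinantal_entry_corner hp hpq x hN s t h1.1]
  mem_cone X := by
    rw [card_filter_val_lt (by omega)]
    rfl

lemma card_val_gt (n i : ℕ) (h : i < n) : Fintype.card {t : Fin n // i < t.val} = n - 1 - i := by
  have h1 := Fintype.card_subtype_compl (fun t : Fin n => t.val < i + 1)
  rw [Fintype.card_subtype (fun t : Fin n => t.val < i + 1), card_filter_val_lt (by omega),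
    Fintype.card_fin] at h1
  rw [Fintype.card_congr (Equiv.subtypeEquivRight (q := fun t : Fin n => ¬ t.val < i + 1)
    fun t => by omega), h1]
  omega

lemma card_le_val (n i : ℕ) (h : i ≤ n) : Fintype.card {t : Fin n // i ≤ t.val} = n - i := by
  have h1 := Fintype.card_subtype_compl (fun t : Fin n => t.val < i)
  rw [Fintype.card_subtype (fun t : Fin n => t.val < i), card_filter_val_lt h,
    Fintype.card_fin] at h1
  rw [Fintype.card_congr (Equiv.subtypeEquivRight (q := fun t : Fin n => ¬ t.val < i)
    fun t => by omega), h1]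

lemma determinantalModel_colExcess (hp : r < p) (hpq : p ≤ q) :
    (determinantalModel hp hpq).ColExcess (q - p) := by
  intro i
  have := i.2
  change Fintype.card {t : Fin q // i.val < t.val} = Fintype.card {s : Fin p // i.val < s.val} + _
  rw [card_val_gt _ _ (by omega), card_val_gt _ _ (by omega)]
  omega

lemma determinantalModel_normalRows (hp : r < p) (hpq : p ≤ q) :
    (determinantalModel hp hpq).normalRows = p - r := card_le_val p r hp.le

lemma determinantal_trace_corner (hp : r < p) (hpq : p ≤ q) (x : Fin r → ℝ) {N : MatSpace p q}
    (hN : N ∈ (determinantal p q r).K) :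
    (corner (fun s : Fin p => s.val) (fun t : Fin q => t.val) r
      (toMat ((determinantal p q r).M x + N)) *
      (corner (fun s : Fin p => s.val) (fun t : Fin q => t.val) r
        (toMat ((determinantal p q r).M x + N)))ᵀ).trace = ‖N‖ ^ 2 := by
  have hD := determinantal_isCoordinate hp hpq
  rw [EuclideanSpace.real_norm_sq_eq, Fintype.sum_prod_type, Matrix.trace]
  refine Fintype.sum_of_injective Subtype.val Subtype.val_injective _ _ (fun s hs => ?_)
    fun s => ?_
  · refine Finset.sum_eq_zero fun t _ => ?_
    rw [hD.apply_eq_zero hN fun h => hs ⟨⟨s, h.1⟩, rfl⟩]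
    ring
  · rw [Matrix.diag_apply, Matrix.mul_apply]
    refine Fintype.sum_of_injective Subtype.val Subtype.val_injective _ _ (fun t ht => ?_)
      fun t => ?_
    · rw [hD.apply_eq_zero hN fun h => ht ⟨⟨t, h.2⟩, rfl⟩]
      ring
    · rw [← determinantal_entry_corner hp hpq x hN s t s.2]
      exact (sq _).symm

/-- The exponent is the sum of the column excess q − p and of 2(p − r) − 2, what the normal factor
retains after one factor xᵢ² − |N|² is split off. -/
theorem determinantal_weightGE (hp : r < p) (hpq : p ≤ q) {a : Fin r → ℝ} (ha : a ∈ chamber r) :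
    (determinantal p q r).WeightGE a (p + q - 2 * r - 2) := by
  have h := (determinantalModel hp hpq).weightGE (determinantalModel_colExcess hp hpq) ha
    (b := 1) (d := 2 * (p - r) - 2) (by rw [determinantalModel_normalRows]; omega)
    fun x hx N hN hlt i => by
      refine pow_mul_le_det _ (hx.2 i) (determinantal_trace_corner hp hpq x hN)
        (pow_le_pow_left₀ (norm_nonneg _) (hlt i).le 2) ?_
      rw [card_le_val p r hp.le]
      omega
  convert h using 1
  omega

/-- The corner has a single row, so the normal factor is exactly xᵢ² − |N|², which is constant on
the slicing set, and only the column excess survives. -/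
theorem determinantal_weightEq (hp : r + 1 = p) (hpq : p ≤ q) {a : Fin r → ℝ}
    (ha : a ∈ chamber r) : (determinantal p q r).WeightEq a (q - p) := by
  have hp' : r < p := by omega
  refine (determinantalModel hp' hpq).weightEq (determinantalModel_colExcess hp' hpq) ha
    (b := 1) (d := 0) fun x hx N hN hlt i => ?_
  refine det_eq_of_card_eq_one _ (determinantal_trace_corner hp' hpq x hN) ?_
  exact (card_le_val p r hp'.le).trans (by omega)

end Determinantal

/-! ### Sharp bounds for skew-symmetric matrices. -/

section SkewBounds

lemma det_eq_of_skew_of_card_eq_two {n : Type*} [Fintype n] [DecidableEq n] {N : Matrix n n ℝ}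
    (hN : Nᵀ = -N) (hn : Fintype.card n = 2) {y t : ℝ} (ht : (N * Nᵀ).trace = 2 * t) :
    (y • (1 : Matrix n n ℝ) - N * Nᵀ).det = (y - t) ^ 2 := by
  obtain ⟨μ, hsymm, htr, hdet⟩ := exists_eigenvalues_of_skew hN
  obtain ⟨a, b, hab, huniv⟩ := Finset.card_eq_two.1 (Finset.card_univ.trans hn)
  -- One value suffices: (1 − a)(1 − b) = (1 + a)(1 + b) says a + b = 0.
  have h1 := hsymm 1
  rw [huniv, Finset.prod_pair hab, Finset.prod_pair hab] at h1
  have h2 : μ a = -μ b := by linarith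
  rw [huniv, Finset.sum_pair hab, ht] at htr
  rw [hdet, huniv, Finset.prod_pair hab]
  have h3 : t = μ b ^ 2 := by rw [h2] at htr; linarith
  rw [h2, h3]
  ring

/-- The operator norm of a skew-symmetric matrix is at most half of its squared Hilbert-Schmidt
norm. -/
lemma mulVec_dotProduct_self_le_of_skew {n : Type*} [Fintype n] {A : Matrix n n ℝ}
    (hA : ∀ s t, A s t = -A t s) {τ : ℝ} (hτ : ∑ s, ∑ t, A s t ^ 2 = 2 * τ) (u : n → ℝ) :
    (A *ᵥ u) ⬝ᵥ (A *ᵥ u) ≤ τ * (u ⬝ᵥ u) := by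
  obtain ⟨w, hw⟩ : ∃ w, w = A *ᵥ u := ⟨_, rfl⟩
  rw [← hw]
  -- Pairing `A` with the antisymmetric tensor w ∧ u rather than w ⊗ u gains the factor 2.
  -- Cauchy–Schwarz gives 4|w|⁴ ≤ 2τ(2|w|²|u|² − 2(w·u)²), and |w|² is cancelled.
  have h1 : ∑ j : n × n, A j.1 j.2 * (w j.1 * u j.2 - w j.2 * u j.1) = 2 * (w ⬝ᵥ w) := by
    have e1 : ∑ s, ∑ t, A s t * (w s * u t) = w ⬝ᵥ w := by
      rw [dotProduct]
      refine Finset.sum_congr rfl fun s _ => ?_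
      have hs : w s = ∑ t, A s t * u t := congrFun hw s
      calc ∑ t, A s t * (w s * u t) = w s * ∑ t, A s t * u t := by
            rw [Finset.mul_sum]
            exact Finset.sum_congr rfl fun t _ => by ring
        _ = w s * w s := by rw [← hs]
    have e2 : ∑ s, ∑ t, A s t * (w t * u s) = -(w ⬝ᵥ w) := by
      rw [← e1, Finset.sum_comm, ← Finset.sum_neg_distrib]
      refine Finset.sum_congr rfl fun s _ => ?_
      rw [← Finset.sum_neg_distrib]
      exact Finset.sum_congr rfl fun t _ => by rw [hA t s]; ring
    rw [Fintype.sum_prod_type]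
    simp only [mul_sub, Finset.sum_sub_distrib, e1, e2]
    ring
  have h2 : ∑ j : n × n, (w j.1 * u j.2 - w j.2 * u j.1) ^ 2
      = 2 * ((w ⬝ᵥ w) * (u ⬝ᵥ u)) - 2 * (w ⬝ᵥ u) ^ 2 := by
    have e1 : ∑ s, ∑ t, (w s * u t) ^ 2 = (w ⬝ᵥ w) * (u ⬝ᵥ u) := by
      rw [dotProduct, dotProduct, Finset.sum_mul_sum]
      exact Finset.sum_congr rfl fun s _ => Finset.sum_congr rfl fun t _ => by ring
    have e2 : ∑ s, ∑ t, (w t * u s) ^ 2 = (w ⬝ᵥ w) * (u ⬝ᵥ u) := by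
      rw [← e1, Finset.sum_comm]
    have e3 : ∑ s, ∑ t, 2 * ((w s * u s) * (w t * u t)) = 2 * (w ⬝ᵥ u) ^ 2 := by
      rw [sq, dotProduct, Finset.sum_mul_sum]
      simp only [Finset.mul_sum]
    have e4 : ∀ s t, (w s * u t - w t * u s) ^ 2
        = (w s * u t) ^ 2 + (w t * u s) ^ 2 - 2 * ((w s * u s) * (w t * u t)) := fun s t => by ring
    rw [Fintype.sum_prod_type]
    simp only [e4, Finset.sum_add_distrib, Finset.sum_sub_distrib, e1, e2, e3]
    ring
  have h3 := Finset.sum_mul_sq_le_sq_mul_sq Finset.univ (fun j : n × n => A j.1 j.2)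
    (fun j => w j.1 * u j.2 - w j.2 * u j.1)
  rw [h1, h2, Fintype.sum_prod_type, hτ] at h3
  have hw0 : 0 ≤ w ⬝ᵥ w := Finset.sum_nonneg fun _ _ => mul_self_nonneg _
  have hu0 : 0 ≤ u ⬝ᵥ u := Finset.sum_nonneg fun _ _ => mul_self_nonneg _
  have hτ0 : 0 ≤ τ := by
    have : 0 ≤ ∑ s, ∑ t, A s t ^ 2 :=
      Finset.sum_nonneg fun _ _ => Finset.sum_nonneg fun _ _ => sq_nonneg _
    linarith
  rcases hw0.eq_or_lt with h0 | h0
  · rw [← h0]; positivity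
  · refine le_of_mul_le_mul_left ?_ h0
    nlinarith [mul_nonneg hτ0 (sq_nonneg (w ⬝ᵥ u))]

end SkewBounds

/-! ### Skew-symmetric matrices and their coordinates above the diagonal. -/

section Skew

variable {m : ℕ}

lemma toSkew_of_lt (X : SkewSpace m) {s t : Fin m} (h : s < t) : toSkew X s t = X ⟨(s, t), h⟩ :=
  dif_pos h

lemma toSkew_of_gt (X : SkewSpace m) {s t : Fin m} (h : t < s) : toSkew X s t = -X ⟨(t, s), h⟩ :=
  (dif_neg h.asymm).trans (dif_pos h)

lemma toSkew_self (X : SkewSpace m) (s : Fin m) : toSkew X s s = 0 :=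
  (dif_neg (lt_irrefl s)).trans (dif_neg (lt_irrefl s))

lemma toSkew_swap (X : SkewSpace m) (s t : Fin m) : toSkew X s t = -toSkew X t s := by
  rcases lt_trichotomy s t with h | rfl | h
  · rw [toSkew_of_lt X h, toSkew_of_gt X h, neg_neg]
  · rw [toSkew_self, neg_zero]
  · rw [toSkew_of_gt X h, toSkew_of_lt X h]

lemma toSkew_transpose (X : SkewSpace m) : (toSkew X)ᵀ = -toSkew X := by
  ext s t
  exact toSkew_swap X t s

lemma toSkew_ofSkew {A : Matrix (Fin m) (Fin m) ℝ} (hA : Aᵀ = -A) : toSkew (ofSkew A) = A := by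
  have h1 : ∀ s t, A s t = -A t s := fun s t => congrFun (congrFun hA t) s
  ext s t
  rcases lt_trichotomy s t with h | rfl | h
  · rw [toSkew_of_lt _ h]; rfl
  · rw [toSkew_self]; linarith [h1 s s]
  · rw [toSkew_of_gt _ h, h1 s t]; rfl

lemma sum_toSkew_sq (X : SkewSpace m) : ∑ s, ∑ t, toSkew X s t ^ 2 = 2 * ‖X‖ ^ 2 := by
  let f : Fin m → Fin m → ℝ := fun s t => if h : s < t then X ⟨(s, t), h⟩ ^ 2 else 0
  have hf : ∑ s, ∑ t, f s t = ‖X‖ ^ 2 := by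
    rw [EuclideanSpace.real_norm_sq_eq, ← Fintype.sum_prod_type' f]
    symm
    refine Fintype.sum_of_injective Subtype.val Subtype.val_injective _ _ (fun j hj => ?_)
      fun j => ?_
    · exact dif_neg fun h => hj ⟨⟨j, h⟩, rfl⟩
    · simp [f, j.2]
  have h : ∀ s t, toSkew X s t ^ 2 = f s t + f t s := by
    intro s t
    rcases lt_trichotomy s t with h | rfl | h
    · simp [f, toSkew_of_lt X h, h, h.asymm]
    · simp [f, toSkew_self]
    · simp [f, toSkew_of_gt X h, h, h.asymm]
  simp only [h, Finset.sum_add_distrib]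
  rw [Finset.sum_comm (f := fun s t => f t s), hf]
  ring

end Skew

section Pfaffian

/-! ### Pfaffian varieties -/

variable {m r : ℕ}

/-- The other index in the same two-plane. -/
def partner (n : ℕ) : ℕ := if n % 2 = 0 then n + 1 else n - 1

/-- The sign of the rotation of the two-planes. -/
def paritySign (n : ℕ) : ℝ := if n % 2 = 0 then 1 else -1

lemma partner_partner (n : ℕ) : partner (partner n) = n := by
  unfold partner; split_ifs <;> omega

lemma partner_div (n : ℕ) : partner n / 2 = n / 2 := by
  unfold partner; split_ifs <;> omega

lemma paritySign_partner (n : ℕ) : paritySign (partner n) = -paritySign n := by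
  unfold partner paritySign
  split_ifs <;> first | omega | simp

lemma paritySign_mul_self (n : ℕ) : paritySign n * paritySign n = 1 := by
  unfold paritySign; split_ifs <;> norm_num

/-- Position of the vectors `eᵢ`. -/
def pairIndex (hm : 2 * r < m) (i : Fin r) : {ij : Fin m × Fin m // ij.1 < ij.2} :=
  ⟨(⟨2 * i, by omega⟩, ⟨2 * i + 1, by omega⟩), Fin.mk_lt_mk.2 (Nat.lt_succ_self _)⟩

lemma pfaffian_isCoordinate (hm : 2 * r < m) :
    IsCoordinate (pfaffian m r) (pairIndex hm) {j | 2 * r ≤ j.1.1.val} where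
  e_eq i := by
    ext ⟨⟨s, t⟩, h⟩
    simp only [pfaffian, PiLp.single_apply, pairIndex, Subtype.mk.injEq,
      Prod.mk.injEq, Fin.ext_iff]
  K_eq := by
    simp only [pfaffian]
    congr 1
  injective i j h := by
    simp only [pairIndex, Subtype.mk.injEq, Prod.mk.injEq, Fin.mk.injEq] at h
    exact Fin.ext (by omega)
  notMem i h := by
    have h1 : 2 * r ≤ 2 * (i : ℕ) := h
    have := i.2
    omega

section Entries

variable (hm : 2 * r < m) (x : Fin r → ℝ) {N : SkewSpace m} (hN : N ∈ (pfaffian m r).K)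
include hm hN

lemma toSkew_K_eq_zero (s t : Fin m) (hs : s.val / 2 < r) : toSkew N s t = 0 := by
  have hD := pfaffian_isCoordinate hm
  rcases lt_trichotomy s t with h | rfl | h
  · rw [toSkew_of_lt _ h]
    exact hD.apply_eq_zero hN (fun h' => absurd h' (by simp only [mem_ofPred_eq]; omega))
  · exact toSkew_self _ _
  · rw [toSkew_of_gt _ h, neg_eq_zero]
    refine hD.apply_eq_zero hN (fun h' => absurd h' ?_)
    have := Fin.lt_def.1 h
    simp only [mem_ofPred_eq]; omega

omit hm hN in
lemma toSkew_add (X Y : SkewSpace m) : toSkew (X + Y) = toSkew X + toSkew Y := by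
  ext s t
  simp only [toSkew, Matrix.of_apply, Matrix.add_apply, PiLp.add_apply]
  split_ifs <;> ring

omit hN in
lemma toSkew_M_of_lt (s t : Fin m) (h : s < t) : toSkew ((pfaffian m r).M x) s t =
    if h : s.val / 2 < r ∧ t.val = partner s then x ⟨s / 2, h.1⟩ else 0 := by
  have hD := pfaffian_isCoordinate hm
  have h' := Fin.lt_def.1 h
  rw [toSkew_of_lt _ h]
  split_ifs with h1
  · have h0 : s.val % 2 = 0 := by
      have := h1.2
      unfold partner at this
      split_ifs at this <;> omega
    have h2 : (⟨(s, t), h⟩ : {ij : Fin m × Fin m // ij.1 < ij.2})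
        = pairIndex hm ⟨s / 2, h1.1⟩ := by
      have := h1.2
      unfold partner at this
      rw [if_pos h0] at this
      refine Subtype.ext (Prod.ext (Fin.ext ?_) (Fin.ext ?_)) <;> simp only [pairIndex] <;> omega
    rw [h2, hD.M_apply]
  · refine hD.M_apply_of_notMem x fun i hi => h1 ?_
    have h3 := congrArg (fun z => z.1.1.val) hi
    have h4 := congrArg (fun z => z.1.2.val) hi
    simp only [pairIndex] at h3 h4
    have := i.2
    unfold partner
    split_ifs <;> omega

lemma pfaffian_entry_row (s t : Fin m) (hs : s.val / 2 < r) :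
    toSkew ((pfaffian m r).M x + N) s t
      = if t.val = partner s then paritySign s * x ⟨s / 2, hs⟩ else 0 := by
  rw [toSkew_add, Matrix.add_apply, toSkew_K_eq_zero hm hN s t hs, add_zero]
  rcases lt_trichotomy s t with h | rfl | h
  · have h' := Fin.lt_def.1 h
    rw [toSkew_M_of_lt hm x s t h]
    by_cases h1 : t.val = partner s
    · have h0 : s.val % 2 = 0 := by
        have := h1
        unfold partner at this
        split_ifs at this <;> omega
      rw [dif_pos ⟨hs, h1⟩, if_pos h1, paritySign, if_pos h0, one_mul]
    · rw [dif_neg (by tauto), if_neg h1]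
  · rw [toSkew_self, if_neg]
    unfold partner
    split_ifs <;> omega
  · have h' := Fin.lt_def.1 h
    rw [toSkew_swap, toSkew_M_of_lt hm x t s h]
    by_cases h1 : t.val = partner s
    · have h2 : s.val = partner t := by rw [h1, partner_partner]
      have h0 : s.val % 2 ≠ 0 := by
        have := h1
        unfold partner at this
        split_ifs at this <;> omega
      have h3 : t.val / 2 = s.val / 2 := by rw [h1, partner_div]
      rw [dif_pos ⟨by omega, h2⟩, if_pos h1, paritySign, if_neg h0, neg_one_mul]
      simp only [h3]
    · rw [dif_neg (fun h => h1 (by rw [h.2, partner_partner])), if_neg h1, neg_zero]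

lemma pfaffian_entry_col (s t : Fin m) (ht : t.val / 2 < r) :
    toSkew ((pfaffian m r).M x + N) s t
      = if s.val = partner t then -(paritySign t * x ⟨t / 2, ht⟩) else 0 := by
  rw [toSkew_swap, pfaffian_entry_row hm x hN t s ht]
  split_ifs <;> simp

lemma pfaffian_entry_corner (s t : Fin m) (hs : r ≤ s.val / 2) :
    toSkew ((pfaffian m r).M x + N) s t = toSkew N s t := by
  by_cases ht : t.val / 2 < r
  · rw [pfaffian_entry_col hm x hN s t ht, toSkew_swap, toSkew_K_eq_zero hm hN t s ht, if_neg]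
    · simp
    · intro h
      have := partner_div t
      omega
  · have h0 : toSkew ((pfaffian m r).M x) s t = 0 := by
      rcases lt_trichotomy s t with h | rfl | h
      · rw [toSkew_M_of_lt hm x s t h, dif_neg (by omega)]
      · exact toSkew_self _ _
      · rw [toSkew_swap, toSkew_M_of_lt hm x t s h, dif_neg (by omega), neg_zero]
    rw [toSkew_add, Matrix.add_apply, h0, zero_add]

omit hN in
lemma partner_lt {n : ℕ} (h : n / 2 < r) : partner n < m := by
  have := partner_div n
  omega

lemma pfaffian_row_sum (f : Fin m → ℝ) (s : Fin m) (hs : s.val / 2 < r) :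
    ∑ k, toSkew ((pfaffian m r).M x + N) s k * f k
      = paritySign s * x ⟨s / 2, hs⟩ * f ⟨partner s, partner_lt hm hs⟩ := by
  rw [Finset.sum_eq_single ⟨partner s, partner_lt hm hs⟩]
  · rw [pfaffian_entry_row hm x hN s _ hs, if_pos rfl]
  · intro k _ hk
    rw [pfaffian_entry_row hm x hN s _ hs, if_neg fun h => hk (Fin.ext h), zero_mul]
  · simp

lemma pfaffian_col_sum (f : Fin m → ℝ) (t : Fin m) (ht : t.val / 2 < r) :
    ∑ k, toSkew ((pfaffian m r).M x + N) k t * f k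
      = -(paritySign t * x ⟨t / 2, ht⟩) * f ⟨partner t, partner_lt hm ht⟩ := by
  rw [Finset.sum_eq_single ⟨partner t, partner_lt hm ht⟩]
  · rw [pfaffian_entry_col hm x hN _ t ht, if_pos rfl]
  · intro k _ hk
    rw [pfaffian_entry_col hm x hN _ t ht, if_neg fun h => hk (Fin.ext h), zero_mul]
  · simp

lemma pfaffian_isWedge : IsWedge (fun t : Fin m => t.val / 2) x ‖N‖
    (toSkew ((pfaffian m r).M x + N)) where
  gram s t h := by
    have hp : partner s / 2 < r := by rw [partner_div]; exact h
    simp only [Matrix.mul_apply, Matrix.transpose_apply]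
    rw [pfaffian_col_sum hm x hN _ s h, pfaffian_entry_row hm x hN _ t hp]
    simp only [Fin.ext_iff, partner_partner, partner_div, paritySign_partner]
    by_cases hst : s.val = t.val
    · rw [if_pos hst, if_pos hst.symm]
      linear_combination x ⟨s / 2, h⟩ ^ 2 * paritySign_mul_self s
    · rw [if_neg hst, if_neg (Ne.symm hst), mul_zero]
  norm_le u hu := by
    have h1 : toSkew ((pfaffian m r).M x + N) *ᵥ u = toSkew N *ᵥ u := by
      funext s
      rw [Matrix.mulVec, Matrix.mulVec, dotProduct, dotProduct]
      refine Finset.sum_congr rfl fun t _ => ?_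
      by_cases ht : t.val / 2 < r
      · rw [hu t ht, mul_zero, mul_zero]
      · by_cases hs : s.val / 2 < r
        · rw [pfaffian_entry_row hm x hN s t hs, if_neg, toSkew_K_eq_zero hm hN s t hs]
          intro h
          have := partner_div s
          omega
        · rw [pfaffian_entry_corner hm x hN s t (not_lt.1 hs)]
    rw [h1]
    -- The squared Hilbert–Schmidt norm of the matrix is 2|N|², so the plain bound would lose a
    -- factor 2 against the condition |N| < xᵢ.
    exact mulVec_dotProduct_self_le_of_skew (toSkew_swap N) (sum_toSkew_sq N) u

lemma pfaffian_isBlock : IsBlock (fun s : Fin m => s.val / 2) (fun t : Fin m => t.val / 2) x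
    (toSkew ((pfaffian m r).M x + N)) where
  gram s t h := by
    rw [← (pfaffian_isWedge hm x hN).gram s t h]
    have := toSkew_transpose ((pfaffian m r).M x + N)
    rw [this, Matrix.mul_neg, Matrix.neg_mul]
  eq_zero s t h hne := by
    rcases h with h | h
    · rw [pfaffian_entry_row hm x hN s t h, if_neg]
      intro h'
      exact hne (by rw [h', partner_div])
    · rw [pfaffian_entry_col hm x hN s t h, if_neg]
      intro h'
      exact hne (by rw [h', partner_div])

lemma pfaffian_corner_transpose :
    (corner (fun s : Fin m => s.val / 2) (fun t : Fin m => t.val / 2) r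
      (toSkew ((pfaffian m r).M x + N)))ᵀ =
    -corner (fun s : Fin m => s.val / 2) (fun t : Fin m => t.val / 2) r
      (toSkew ((pfaffian m r).M x + N)) := by
  ext s t
  exact toSkew_swap _ _ _

lemma pfaffian_trace_corner :
    (corner (fun s : Fin m => s.val / 2) (fun t : Fin m => t.val / 2) r
      (toSkew ((pfaffian m r).M x + N)) *
      (corner (fun s : Fin m => s.val / 2) (fun t : Fin m => t.val / 2) r
        (toSkew ((pfaffian m r).M x + N)))ᵀ).trace = 2 * ‖N‖ ^ 2 := by
  rw [← sum_toSkew_sq, Matrix.trace]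
  refine Fintype.sum_of_injective Subtype.val Subtype.val_injective _ _ (fun s hs => ?_)
    fun s => ?_
  · refine Finset.sum_eq_zero fun t _ => ?_
    rw [toSkew_K_eq_zero hm hN s t (not_le.1 fun h => hs ⟨⟨s, h⟩, rfl⟩)]
    ring
  · rw [Matrix.diag_apply, Matrix.mul_apply]
    refine Fintype.sum_of_injective Subtype.val Subtype.val_injective _ _ (fun t ht => ?_)
      fun t => ?_
    · rw [toSkew_swap, toSkew_K_eq_zero hm hN t s (not_le.1 fun h => ht ⟨⟨t, h⟩, rfl⟩)]
      ring
    · rw [← pfaffian_entry_corner hm x hN s t s.2]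
      exact (sq _).symm

end Entries

end Pfaffian

section Pfaffian

variable {m r : ℕ}

/-- Index set of the infinitesimal rotations for skew-symmetric matrices. -/
abbrev PairRotIndex (m r : ℕ) :=
  RotIndex (fun s : Fin m => s.val / 2) (fun s : Fin m => s.val / 2) r

lemma pairRotIndex_inl_congr {i i' : Fin r} (h : i.val = i'.val) {t : Fin m}
    (ht : i.val < t.val / 2) (ht' : i'.val < t.val / 2) :
    (⟨i, Sum.inl ⟨t, ht⟩⟩ : PairRotIndex m r) = ⟨i', Sum.inl ⟨t, ht'⟩⟩ := by
  obtain rfl := Fin.ext h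
  rfl

lemma pairRotIndex_inr_congr {i i' : Fin r} (h : i.val = i'.val) {t : Fin m}
    (ht : i.val < t.val / 2) (ht' : i'.val < t.val / 2) :
    (⟨i, Sum.inr ⟨t, ht⟩⟩ : PairRotIndex m r) = ⟨i', Sum.inr ⟨t, ht'⟩⟩ := by
  obtain rfl := Fin.ext h
  rfl

/-- The parameter which rotates the coordinate `s` into the coordinate `t`. -/
def pairCoord (s t : Fin m) (hs : s.val / 2 < r) (h : s.val / 2 < t.val / 2) : PairRotIndex m r :=
  if s.val % 2 = 0 then ⟨⟨s / 2, hs⟩, Sum.inl ⟨t, h⟩⟩ else ⟨⟨s / 2, hs⟩, Sum.inr ⟨t, h⟩⟩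

/-- Infinitesimal rotations. -/
def pairRotation (m r : ℕ) : (PairRotIndex m r → ℝ) →ₗ[ℝ] Matrix (Fin m) (Fin m) ℝ where
  toFun ξ := Matrix.of fun s t =>
    if h : s.val / 2 < r ∧ s.val / 2 < t.val / 2 then ξ (pairCoord s t h.1 h.2)
    else if h : t.val / 2 < r ∧ t.val / 2 < s.val / 2 then -ξ (pairCoord t s h.1 h.2) else 0
  map_add' ξ η := by
    ext s t
    simp only [Matrix.of_apply, Matrix.add_apply, Pi.add_apply]
    split_ifs <;> ring
  map_smul' c ξ := by
    ext s t
    simp only [Matrix.of_apply, Matrix.smul_apply, Pi.smul_apply, smul_eq_mul, RingHom.id_apply]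
    split_ifs <;> ring

/-- Skew-symmetric matrices with prescribed entries outside of the diagonal blocks of the first
two-planes. -/
def skewOfHooks (m r : ℕ) : (PairRotIndex m r → ℝ) →ₗ[ℝ] SkewSpace m where
  toFun ξ := WithLp.toLp 2 fun j =>
    if h : j.1.1.val / 2 < r ∧ j.1.1.val / 2 < j.1.2.val / 2 then
      if j.1.1.val % 2 = 0 then -ξ ⟨⟨j.1.1 / 2, h.1⟩, Sum.inr ⟨j.1.2, h.2⟩⟩
      else ξ ⟨⟨j.1.1 / 2, h.1⟩, Sum.inl ⟨j.1.2, h.2⟩⟩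
    else 0
  map_add' ξ η := by
    ext j
    simp only [PiLp.add_apply, Pi.add_apply]
    split_ifs <;> ring
  map_smul' c ξ := by
    ext j
    simp only [PiLp.smul_apply, Pi.smul_apply, smul_eq_mul, RingHom.id_apply]
    split_ifs <;> ring

variable (ξ : PairRotIndex m r → ℝ)

lemma pairRotation_of_lt {s t : Fin m} (hs : s.val / 2 < r) (h : s.val / 2 < t.val / 2) :
    pairRotation m r ξ s t = ξ (pairCoord s t hs h) := dif_pos ⟨hs, h⟩

lemma pairRotation_of_gt {s t : Fin m} (ht : t.val / 2 < r) (h : t.val / 2 < s.val / 2) :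
    pairRotation m r ξ s t = -ξ (pairCoord t s ht h) :=
  (dif_neg (by omega)).trans (dif_pos ⟨ht, h⟩)

lemma pairRotation_eq_zero {s t : Fin m}
    (h : s.val / 2 = t.val / 2 ∨ (r ≤ s.val / 2 ∧ r ≤ t.val / 2)) : pairRotation m r ξ s t = 0 :=
  (dif_neg (by omega)).trans (dif_neg (by omega))

lemma pairRotation_transpose : (pairRotation m r ξ)ᵀ = -pairRotation m r ξ := by
  ext s t
  rw [Matrix.transpose_apply, Matrix.neg_apply]
  by_cases h1 : s.val / 2 < r ∧ s.val / 2 < t.val / 2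
  · rw [pairRotation_of_lt ξ h1.1 h1.2, pairRotation_of_gt ξ h1.1 h1.2]
  by_cases h2 : t.val / 2 < r ∧ t.val / 2 < s.val / 2
  · rw [pairRotation_of_lt ξ h2.1 h2.2, pairRotation_of_gt ξ h2.1 h2.2, neg_neg]
  · rw [pairRotation_eq_zero ξ (by omega), pairRotation_eq_zero ξ (by omega), neg_zero]

lemma skewOfHooks_even {j : {ij : Fin m × Fin m // ij.1 < ij.2}} (hs : j.1.1.val / 2 < r)
    (h : j.1.1.val / 2 < j.1.2.val / 2) (h0 : j.1.1.val % 2 = 0) :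
    skewOfHooks m r ξ j = -ξ ⟨⟨j.1.1 / 2, hs⟩, Sum.inr ⟨j.1.2, h⟩⟩ :=
  (dif_pos ⟨hs, h⟩).trans (if_pos h0)

lemma skewOfHooks_odd {j : {ij : Fin m × Fin m // ij.1 < ij.2}} (hs : j.1.1.val / 2 < r)
    (h : j.1.1.val / 2 < j.1.2.val / 2) (h0 : j.1.1.val % 2 ≠ 0) :
    skewOfHooks m r ξ j = ξ ⟨⟨j.1.1 / 2, hs⟩, Sum.inl ⟨j.1.2, h⟩⟩ :=
  (dif_pos ⟨hs, h⟩).trans (if_neg h0)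

lemma skewOfHooks_eq_zero {j : {ij : Fin m × Fin m // ij.1 < ij.2}}
    (h : ¬ (j.1.1.val / 2 < r ∧ j.1.1.val / 2 < j.1.2.val / 2)) : skewOfHooks m r ξ j = 0 :=
  dif_neg h

/-- The position `(2i, t)`. -/
def evenIndex (i : Fin r) (t : {t : Fin m // (i : ℕ) < t.val / 2}) :
    {ij : Fin m × Fin m // ij.1 < ij.2} :=
  ⟨(⟨2 * i, by omega⟩, t.1), Fin.lt_def.2 (by have := t.2; dsimp only; omega)⟩

/-- The position `(2i + 1, t)`. -/
def oddIndex (i : Fin r) (t : {t : Fin m // (i : ℕ) < t.val / 2}) :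
    {ij : Fin m × Fin m // ij.1 < ij.2} :=
  ⟨(⟨2 * i + 1, by omega⟩, t.1), Fin.lt_def.2 (by have := t.2; dsimp only; omega)⟩

lemma skewOfHooks_evenIndex (i : Fin r) (t : {t : Fin m // (i : ℕ) < t.val / 2}) :
    skewOfHooks m r ξ (evenIndex i t) = -ξ ⟨i, Sum.inr t⟩ := by
  have h : 2 * (i : ℕ) / 2 = i := by omega
  have hs : (evenIndex i t).1.1.val / 2 < r := by simp [evenIndex]
  rw [skewOfHooks_even ξ hs (by simp [evenIndex, t.2]) (by simp [evenIndex])]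
  exact congrArg (fun z => -ξ z) (pairRotIndex_inr_congr h _ _)

lemma skewOfHooks_oddIndex (i : Fin r) (t : {t : Fin m // (i : ℕ) < t.val / 2}) :
    skewOfHooks m r ξ (oddIndex i t) = ξ ⟨i, Sum.inl t⟩ := by
  have h : (2 * (i : ℕ) + 1) / 2 = i := by omega
  have hs : (oddIndex i t).1.1.val / 2 < r := by simp [oddIndex, h]
  rw [skewOfHooks_odd ξ hs (by simp [oddIndex, h, t.2]) (by simp only [oddIndex]; omega)]
  exact congrArg ξ (pairRotIndex_inl_congr h _ _)

/-- On each two-plane the wedge matrix acts as xᵢ times a quarter turn, exchanging the rows 2i and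
2i+1. Even rows therefore give, up to sign, the second family of coordinates and odd rows the first.
With this labelling the action has the same block matrix as in the rectangular case. -/
lemma pfaffian_action_eq (hm : 2 * r < m) (x : Fin r → ℝ) {N : SkewSpace m}
    (hN : N ∈ (pfaffian m r).K) (j : {ij : Fin m × Fin m // ij.1 < ij.2}) :
    (pairRotation m r ξ * toSkew ((pfaffian m r).M x + N)
        + toSkew ((pfaffian m r).M x + N) * (pairRotation m r ξ)ᵀ) j.1.1 j.1.2
      = skewOfHooks m r (rotMatrix _ _ x (toSkew ((pfaffian m r).M x + N)) *ᵥ ξ) j := by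
  obtain ⟨⟨s, t⟩, hst⟩ := j
  have hst' := Fin.lt_def.1 hst
  dsimp only at hst' ⊢
  have hrow := pfaffian_entry_row hm x hN
  have hcol := pfaffian_entry_col hm x hN
  have hrowsum := pfaffian_row_sum hm x hN
  have hcolsum := pfaffian_col_sum hm x hN
  have hswap := toSkew_swap ((pfaffian m r).M x + N)
  set X := toSkew ((pfaffian m r).M x + N)
  have hA : (pairRotation m r ξ * X) s t = ∑ k, X k t * pairRotation m r ξ s k := by
    rw [Matrix.mul_apply]
    exact Finset.sum_congr rfl fun _ _ => mul_comm _ _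
  have hB : (X * (pairRotation m r ξ)ᵀ) s t = ∑ k, X s k * pairRotation m r ξ t k := rfl
  rw [Matrix.add_apply, hA, hB]
  by_cases h1 : s.val / 2 < r ∧ s.val / 2 < t.val / 2
  · have hp : partner s / 2 = s.val / 2 := partner_div s
    have hsum : ∑ k, X k t * pairRotation m r ξ s k
        = ∑ k : {k : Fin m // s.val / 2 < k.val / 2}, X k t * ξ (pairCoord s k h1.1 k.2) := by
      symm
      refine Fintype.sum_of_injective Subtype.val Subtype.val_injective _ _ (fun k hk => ?_)
        fun k => ?_
      · have hk' : ¬ s.val / 2 < k.val / 2 := fun h => hk ⟨⟨k, h⟩, rfl⟩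
        rcases eq_or_ne (s.val / 2) (k.val / 2) with h | hne
        · rw [pairRotation_eq_zero ξ (.inl h), mul_zero]
        · rw [hrow k t (by omega), if_neg, zero_mul]
          intro h
          have := partner_div k
          omega
      · rw [pairRotation_of_lt ξ h1.1 k.2]
    rw [hsum, hrowsum _ s h1.1, pairRotation_of_gt ξ (t := ⟨partner s, partner_lt hm h1.1⟩)
      (by dsimp only; omega) (by dsimp only; omega)]
    by_cases h0 : s.val % 2 = 0
    · have hp0 : partner s % 2 ≠ 0 := by
        unfold partner; rw [if_pos h0]; omega
      rw [skewOfHooks_even _ h1.1 h1.2 h0, rotMatrix_mulVec_inr]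
      simp only [pairCoord, if_pos h0, if_neg hp0, paritySign]
      rw [pairRotIndex_inr_congr (i' := ⟨s.val / 2, h1.1⟩) hp _ h1.2]
      ring
    · have hp0 : partner s % 2 = 0 := by
        unfold partner; rw [if_neg h0]; omega
      rw [skewOfHooks_odd _ h1.1 h1.2 h0, rotMatrix_mulVec_inl, sub_eq_add_neg,
        ← Finset.sum_neg_distrib]
      simp only [pairCoord, if_neg h0, if_pos hp0, paritySign]
      rw [pairRotIndex_inl_congr (i' := ⟨s.val / 2, h1.1⟩) hp _ h1.2]
      have : ∀ k, -(X t k) = X k t := fun k => (hswap k t).symm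
      simp only [← neg_mul, this]
      ring
  · rw [skewOfHooks_eq_zero _ h1]
    by_cases hs : s.val / 2 < r
    · have h2 : s.val / 2 = t.val / 2 := by omega
      have ht : t.val / 2 < r := by omega
      rw [hcolsum _ t ht, hrowsum _ s hs,
        pairRotation_eq_zero ξ (.inl (by dsimp only; rw [partner_div, h2])),
        pairRotation_eq_zero ξ (.inl (by dsimp only; rw [partner_div, h2]))]
      simp
    · rw [Finset.sum_eq_zero, Finset.sum_eq_zero, add_zero]
      · intro k _
        by_cases hk : k.val / 2 < r
        · rw [hcol s k hk, if_neg, zero_mul]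
          intro h
          have := partner_div k
          omega
        · rw [pairRotation_eq_zero ξ (.inr (by omega)), mul_zero]
      · intro k _
        by_cases hk : k.val / 2 < r
        · rw [hrow k t hk, if_neg, zero_mul]
          intro h
          have := partner_div k
          omega
        · rw [pairRotation_eq_zero ξ (.inr (by omega)), mul_zero]

/-- The matrix model of the Pfaffian slicing. -/
def pfaffianModel (hm : 2 * r < m) : Model (pfaffian m r) (Fin m) (Fin m) where
  toM :=
    { toFun := toSkew
      map_add' := toSkew_add
      map_smul' := fun c X => by
        ext s t
        simp only [toSkew, Matrix.of_apply, Matrix.smul_apply, PiLp.smul_apply, smul_eq_mul,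
          RingHom.id_apply]
        split_ifs <;> ring }
  row j := j.1.1
  col j := j.1.2
  labR s := s.val / 2
  labC t := t.val / 2
  LA := pairRotation m r
  LB := pairRotation m r
  σ := skewOfHooks m r
  isOrtho := (pfaffian_isCoordinate hm).isOrtho
  toM_row_col X j := toSkew_of_lt X j.2
  exp_mem ξ := ⟨_, exp_mem_specialOrthogonalGroup (pairRotation_transpose ξ), rfl⟩
  exists_rot := by
    rintro φ ⟨Q, hQ, rfl⟩
    have hQ' := (Matrix.mem_specialOrthogonalGroup_iff.1 hQ).1
    refine ⟨Q, hQ', Q, hQ', fun X => toSkew_ofSkew ?_⟩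
    rw [Matrix.transpose_mul, Matrix.transpose_mul, Matrix.transpose_transpose, toSkew_transpose,
      Matrix.neg_mul, Matrix.mul_neg, Matrix.mul_assoc]
  σ_injective := by
    intro ξ η h
    have h' : ∀ j, skewOfHooks m r ξ j = skewOfHooks m r η j := fun j => by rw [h]
    funext z
    rcases z with ⟨i, t | t⟩
    · simpa only [skewOfHooks_oddIndex] using h' (oddIndex i t)
    · simpa only [skewOfHooks_evenIndex, neg_inj] using h' (evenIndex i t)
  range_σ := by
    ext v
    rw [(pfaffian_isCoordinate hm).mem_span_orthogonal]
    constructor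
    · rintro ⟨ξ, rfl⟩
      refine ⟨fun i => skewOfHooks_eq_zero ξ ?_, fun j hj => skewOfHooks_eq_zero ξ ?_⟩
      · simp only [pairIndex]; omega
      · have : 2 * r ≤ j.1.1.val := hj
        omega
    · rintro ⟨h1, h2⟩
      refine ⟨fun z => Sum.elim (fun t => v (oddIndex z.1 t)) (fun t => -v (evenIndex z.1 t)) z.2,
        ?_⟩
      ext j
      have hj := Fin.lt_def.1 j.2
      by_cases h3 : j.1.1.val / 2 < r ∧ j.1.1.val / 2 < j.1.2.val / 2
      · by_cases h0 : j.1.1.val % 2 = 0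
        · rw [skewOfHooks_even _ h3.1 h3.2 h0, Sum.elim_inr, neg_neg]
          refine congrArg v (Subtype.ext (Prod.ext (Fin.ext ?_) rfl))
          simp only [evenIndex]
          omega
        · rw [skewOfHooks_odd _ h3.1 h3.2 h0, Sum.elim_inl]
          refine congrArg v (Subtype.ext (Prod.ext (Fin.ext ?_) rfl))
          simp only [oddIndex]
          omega
      · rw [skewOfHooks_eq_zero _ h3]
        by_cases hs : j.1.1.val / 2 < r
        · have hj' : j = pairIndex hm ⟨j.1.1 / 2, hs⟩ := by
            refine Subtype.ext (Prod.ext (Fin.ext ?_) (Fin.ext ?_)) <;>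
              simp only [pairIndex] <;> omega
          rw [hj', h1]
        · rw [h2 j (show 2 * r ≤ j.1.1.val by omega)]
  action_eq x N hN ξ j := pfaffian_action_eq ξ hm x hN j
  isWedge x N hN := pfaffian_isWedge hm x hN
  isBlock x N hN := pfaffian_isBlock hm x hN
  exists_labC j := ⟨⟨2 * j, by omega⟩, by simp⟩
  toM_M a x hx N hN := by
    ext s t
    rw [Matrix.mul_diagonal]
    have h0 := (pfaffian m r).K.zero_mem
    have hMa : toSkew ((pfaffian m r).M a) = toSkew ((pfaffian m r).M a + 0) := by
      rw [add_zero]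
    change toSkew ((pfaffian m r).M a) s t
      = toSkew ((pfaffian m r).M x + N) s t * _
    rw [hMa]
    by_cases ht : t.val / 2 < r
    · rw [pfaffian_entry_col hm a h0 s t ht, pfaffian_entry_col hm x hN s t ht, dif_pos ht]
      have := (hx ⟨t.val / 2, ht⟩).ne'
      split_ifs
      · field_simp
      · rw [zero_mul]
    · rw [dif_neg ht, mul_zero]
      by_cases hs : s.val / 2 < r
      · rw [pfaffian_entry_row hm a h0 s t hs, if_neg]
        intro h
        have := partner_div s
        omega
      · rw [pfaffian_entry_corner hm a h0 s t (not_lt.1 hs)]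
        simp [toSkew]
  exists_entry_ne_zero x N hN hN0 := by
    obtain ⟨j, hj0⟩ : ∃ j, N j ≠ 0 := by
      by_contra! h
      exact hN0 (by ext j; exact h j)
    have h1 : 2 * r ≤ j.1.1.val := by
      by_contra h
      exact hj0 ((pfaffian_isCoordinate hm).apply_eq_zero hN h)
    have hj := Fin.lt_def.1 j.2
    refine ⟨j.1.1, j.1.2, by omega, ?_⟩
    change toSkew ((pfaffian m r).M x + N) j.1.1 j.1.2 ≠ 0
    rwa [pfaffian_entry_corner hm x hN _ _ (by omega), toSkew_of_lt _ j.2]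
  mem_cone X := by
    have h : (Finset.univ.filter fun t : Fin m => t.val / 2 < r).card = 2 * r := by
      rw [Finset.filter_congr (q := fun t : Fin m => t.val < 2 * r) fun t _ => by omega,
        card_filter_val_lt hm.le]
    rw [h]
    rfl

lemma pfaffianModel_colExcess (hm : 2 * r < m) : (pfaffianModel hm).ColExcess 0 := fun _ => rfl

lemma card_le_val_div_two (h : 2 * r ≤ m) :
    Fintype.card {t : Fin m // r ≤ t.val / 2} = m - 2 * r := by
  rw [← card_le_val m (2 * r) h]
  exact Fintype.card_congr (Equiv.subtypeEquivRight fun t => by omega)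

theorem pfaffian_weightGE (hm : 2 * r + 2 ≤ m) {a : Fin r → ℝ} (ha : a ∈ chamber r) :
    (pfaffian m r).WeightGE a (2 * (m - 2 * r) - 4) := by
  have hm' : 2 * r < m := by omega
  have hcard := card_le_val_div_two hm'.le
  rw [← Nat.zero_add (2 * (m - 2 * r) - 4)]
  -- The factor xᵢ² − |N|² appears squared because the nonzero eigenvalues of N Nᵀ are paired.
  refine (pfaffianModel hm').weightGE (pfaffianModel_colExcess hm') ha (b := 2)
    ?_ fun x hx N hN hlt i => ?_
  · have : (pfaffianModel hm').normalRows = m - 2 * r := hcard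
    omega
  · have h := pow_card_mul_le_sq_mul_det_of_skew (pfaffian_corner_transpose hm' x hN)
      (pfaffian_trace_corner hm' x hN) (pow_le_pow_left₀ (norm_nonneg _) (hlt i).le 2)
    rw [hcard] at h
    refine le_of_mul_le_mul_left (le_trans (le_of_eq ?_) h) (pow_pos (pow_pos (hx.2 i) 2) 2)
    rw [← mul_assoc]
    congr 1
    rw [← pow_mul, ← pow_mul, ← pow_add]
    congr 1
    omega

/-- The corner is a skew-symmetric 2 × 2 matrix, for which the normal factor is exactly (xᵢ² −
|N|²)², so the primary weight is constant on each slicing set. -/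
theorem pfaffian_weightEq (hm : 2 * r + 2 = m) {a : Fin r → ℝ} (ha : a ∈ chamber r) :
    (pfaffian m r).WeightEq a 0 := by
  have hm' : 2 * r < m := by omega
  refine (pfaffianModel hm').weightEq (pfaffianModel_colExcess hm') ha (b := 2) (d := 0)
    fun x hx N hN hlt i => ?_
  rw [pow_zero, one_mul]
  refine det_eq_of_skew_of_card_eq_two (pfaffian_corner_transpose hm' x hN) ?_
    (pfaffian_trace_corner hm' x hN)
  rw [card_le_val_div_two hm'.le]
  omega

end Pfaffian

end DirectedSlicing

end

/-! ### The ranges of the exponent in the three statements. -/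

open DirectedSlicing in
theorem proposition4p1 :
    -- (1)
    (∀ g : ℝ → ℝ, (∀ s, 0 < s → 0 ≤ g s) → MonotoneOn g (Ioi 0) →
      (∀ p q r : ℕ, 1 ≤ r → r < p → p ≤ q → 2 * r + 4 ≤ p + q →
        ∀ a ∈ chamber r, (determinantal p q r).MinimalAtCone a g) ∧
      (∀ m r : ℕ, 1 ≤ r → 2 * r + 3 ≤ m →
        ∀ a ∈ chamber r, (pfaffian m r).MinimalAtCone a g)) ∧
    -- (2)
    ((∀ g : ℝ → ℝ, (∀ s, 0 < s → 0 ≤ g s) → MonotoneOn (fun s => g s / s) (Ioi 0) →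
      ∀ a ∈ chamber 1,
        (determinantal 2 2 1).MinimalAtCone a g ∧
        (determinantal 2 3 1).MinimalAtCone a g ∧
        (pfaffian 4 1).MinimalAtCone a g) ∧
      (∀ α : ℝ, 1 ≤ α → (∀ s : ℝ, 0 < s → 0 ≤ s ^ α) ∧
        MonotoneOn (fun s : ℝ => s ^ α / s) (Ioi 0))) ∧
    -- (3)
    (∀ n : ℕ, 3 ≤ n → ∀ a ∈ chamber (n - 1), ∀ g : ℝ → ℝ,
      ContDiffOn ℝ 1 g (Ioi 0) → (∀ s, 0 < s → 0 ≤ g s) → (∃ s, 0 < s ∧ g s ≠ 0) →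
        ¬ (determinantal n (n + 1) (n - 1)).MinimalAtCone a g ∧
        ¬ (determinantal n n (n - 1)).MinimalAtCone a g ∧
        ¬ (pfaffian (2 * n) (n - 1)).MinimalAtCone a g) := by
  refine ⟨fun g hg hmono => ⟨fun p q r hr hp hpq h a ha => ?_, fun m r hr hm a ha => ?_⟩,
    ⟨fun g hg hmono a ha => ⟨?_, ?_, ?_⟩, fun α hα => ⟨fun s hs => Real.rpow_nonneg hs.le α, ?_⟩⟩,
    fun n hn a ha g hcont hg hne => ⟨?_, ?_, ?_⟩⟩
  -- The size condition is exactly p + q − 2r − 2 ≥ 2; in the Pfaffian case 2(m − 2r) − 4 ≥ 2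
  -- amounts to m − 2r ≥ 3.
  · exact Data.minimalAtCone_of_monotoneOn (determinantalModel hp hpq).isOrtho
      (determinantalModel hp hpq).coneSpec (by omega) hr (determinantal_weightGE hp hpq ha) hg hmono
  · have hm' : 2 * r < m := by omega
    exact Data.minimalAtCone_of_monotoneOn (pfaffianModel hm').isOrtho (pfaffianModel hm').coneSpec
      (by omega) hr (pfaffian_weightGE (by omega) ha) hg hmono
  -- The exponents of the three cones are 0, 1 and 0, too small for the previous argument, but r =
  -- 1.
  · have T : Model (determinantal 2 2 1) _ _ := determinantalModel (by norm_num) (by norm_num)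
    exact Data.minimalAtCone_of_monotoneOn_div T.isOrtho T.coneSpec
      (determinantal_weightGE (by norm_num) (by norm_num) ha) hg hmono
  · have T : Model (determinantal 2 3 1) _ _ := determinantalModel (by norm_num) (by norm_num)
    exact Data.minimalAtCone_of_monotoneOn_div T.isOrtho T.coneSpec
      (determinantal_weightGE (by norm_num) (by norm_num) ha) hg hmono
  · have T : Model (pfaffian 4 1) _ _ := pfaffianModel (by norm_num)
    exact Data.minimalAtCone_of_monotoneOn_div T.isOrtho T.coneSpec
      (pfaffian_weightGE (by norm_num) ha) hg hmono
  · have h : EqOn (fun s : ℝ => s ^ (α - 1)) (fun s => s ^ α / s) (Ioi 0) := fun s hs =>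
      Real.rpow_sub_one (ne_of_gt hs) α
    refine MonotoneOn.congr (fun s hs t _ hst => ?_) h
    exact Real.rpow_le_rpow (le_of_lt hs) hst (by linarith)
  -- Here the exponents are 1, 0 and 0, and n ≥ 3 provides the two wedge coordinates needed. The
  -- nonzero normal vector is a coordinate vector of the corner.
  · have hp : n - 1 < n := by omega
    have hpq : n ≤ n + 1 := by omega
    refine Data.not_minimalAtCone (e := n + 1 - n) (determinantalModel hp hpq).isOrtho
      (determinantalModel hp hpq).coneSpec (by omega) (by omega)
      (determinantal_weightEq (by omega) hpq ha) ⟨_, (determinantal_isCoordinate hp hpq).single_mem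
        (j := (⟨n - 1, hp⟩, ⟨n - 1, by omega⟩)) ⟨le_rfl, le_rfl⟩, ?_⟩ hcont.continuousOn hg hne
    simp
  · have hp : n - 1 < n := by omega
    refine Data.not_minimalAtCone (e := n - n) (determinantalModel hp le_rfl).isOrtho
      (determinantalModel hp le_rfl).coneSpec (by omega) (by omega)
      (determinantal_weightEq (by omega) le_rfl ha) ⟨_, (determinantal_isCoordinate hp
        le_rfl).single_mem (j := (⟨n - 1, hp⟩, ⟨n - 1, by omega⟩)) ⟨le_rfl, le_rfl⟩, ?_⟩
      hcont.continuousOn hg hne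
    simp
  · have hm : 2 * (n - 1) < 2 * n := by omega
    refine Data.not_minimalAtCone (pfaffianModel hm).isOrtho (pfaffianModel hm).coneSpec
      zero_le_one (by omega) (pfaffian_weightEq (by omega) ha)
      ⟨_, (pfaffian_isCoordinate hm).single_mem (j := ⟨(⟨2 * (n - 1), by omega⟩,
        ⟨2 * (n - 1) + 1, by omega⟩), Fin.mk_lt_mk.2 (Nat.lt_succ_self _)⟩)
        (le_refl (2 * (n - 1))), ?_⟩
      hcont.continuousOn hg hne
    simp
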